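/- **Setting.** Let $\mathcal H_S=(\mathbb C^2)^{\otimes N}$ with basis $\varphi_\sigma=\varphi_{\sigma_1}\otimes\cdots\otimes\varphi_{\sigma_N}$, $\sigma\in\{\pm1\}^N$, let $S^z_j$, $S^x_j$ be the Pauli matrices acting on the $j$-th factor, and let $H_S=\sum_j B_jS^z_j$ (no pair interaction, $J_{ij}=0$), where $B_j>0$ and the field is generic: if $n_j\in\{0,\pm1,\pm2\}$ and $\sum_jB_jn_j=0$ then all $n_j=0$. Put $v_1=\sum_jS_j^z$, $v_2=\sum_jS^x_j$, $L_S=H_S\otimes 1-1\otimes H_S$, and $\varphi_{\sigma\tau}=\varphi_\sigma\otimes\varphi_\tau\in\mathcal H_S\otimes\mathcal H_S=(\mathbb C^2\otimes\mathbb C^2)^{\otimes N}$, an eigenvector of $L_S$ with eigenvalue $e=e(\sigma,\tau)=\sum_jB_j(\sigma_j-\tau_j)$. Let $\mathcal F$ be the bosonic Fock space over $L^2(\mathbb R\times S^2,du\,d\Sigma)$, with vacuum $\Omega$, creation and annihilation operators $a^*(f),a(f)$, and $\phi(f)=2^{-1/2}(a^*(f)+a(f))$. Fix $0<\beta<\infty$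 and a phase $\phi\in\mathbb R$. For a form factor $h$ on $\mathbb R^3$, written $h(u,\Sigma)$ in spherical coordinates, put $$h_\beta(u,\Sigma)=\sqrt{\tfrac{u}{1-e^{-\beta u}}}\;|u|^{1/2}\begin{cases}h(u,\Sigma),&u\ge0,\\ e^{i\phi}\overline{h(-u,\Sigma)},&u<0.\end{cases}$$ Let $g_1,g_2$ be form factors such that, for $h=g_1,g_2$, the map $\omega\mapsto h_\beta(\cdot+\omega,\cdot)\in L^2(\mathbb R\times S^2)$ has an analytic continuation to some disc $|\omega|<r$, and such that $\mathcal G_k(u)=\int_{S^2}|g_k(|u|,\Sigma)|^2d\Sigma$ ($k=1,2$) is continuous on $(0,\infty)$ (this fixes its values pointwise). For real $\lambda_1,\lambda_2$ let, on $\mathcal H_S\otimes\mathcal H_S\otimes\mathcal F$, $$L_0=L_S+d\Gamma(u),\qquad V=\lambda_1(v_1\otimes1)\otimes\phi((g_1)_\beta)+\lambda_2(v_2\otimes1)\otimes\phi((g_2)_\beta),\qquad I=V-J\Delta^{1/2}VJ\Delta^{1/2}.$$ Here $J,\Delta$ are the modular data of the reference vector (trace state of the register) $\otimes\,\Omega$.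 Thus $\Delta=1\otimes e^{-\beta\, d\Gamma(u)}$ and $J=J_S\otimes J_R$, with $J_S(\varphi_l\otimes\varphi_r)=C\varphi_r\otimes C\varphi_l$ ($C$ is complex conjugation of coordinates) and $(J_R\psi)_n(u_1,\Sigma_1,\ldots,u_n,\Sigma_n)=e^{in\phi}\,\overline{\psi_n(-u_1,\Sigma_1,\ldots,-u_n,\Sigma_n)}$. With $P_e$ the spectral projection of $L_0$ for $\{e\}$ and $\overline P_e=1-P_e$, the level shift operator is, on the range of $P_e$, $$\Lambda_e=-\lim_{\epsilon\downarrow0}P_eI\overline P_e(\overline L_0-e+i\epsilon)^{-1}\overline P_eIP_e ,\qquad \overline L_0=L_0\restriction_{\operatorname{Ran}\overline P_e}.$$ Put $e_0=\sum_j(\sigma_j-\tau_j)$, $\gamma_+=\lim_{u\downarrow0}u\,\mathcal G_1(u)$, and $$y_1(e)=\frac{\pi e_0^2}{2\beta}\gamma_+,\qquad y_2(e)=2\pi\sum_{j:\sigma_j\ne\tau_j}B_j^2\,\mathcal G_2(2B_j)\coth(\beta B_j),$$ $$x_2(e)=-2\sum_{j:\sigma_j\neq\tau_j}\sigma_j\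 \mathrm{P.V.}\!\int_{\mathbb R}u^2\,\mathcal G_2(2u)\coth(\beta|u|)\frac{du}{u-B_j},$$ $$a=-\lambda_1^2e_0\int_{\mathbb R^3}\frac{|g_1(k)|^2}{|k|}d^3k,\qquad b_j=4\pi\lambda_2^2\frac{B_j^2\,\mathcal G_2(2B_j)}{e^{2\beta B_j}-1},\qquad c_j=e^{2\beta B_j},$$ $$M^j=\begin{pmatrix}a+ib_jc_j&-ib_jc_j\\-ib_j&-a+ib_j\end{pmatrix},$$ $$z_j^\pm=\tfrac12\Big[ib_j(c_j+1)\pm\sqrt{-b_j^2(c_j+1)^2+4a\,[a+ib_j(c_j-1)]}\,\Big]\quad\text{(principal square root)}.$$ **Theorem 3.4.** For all $\sigma,\tau\in\{\pm1\}^N$, with $e=e(\sigma,\tau)$, the integrals, limits and principal values above exist (the integral in $a$ converges absolutely), and: (1) the limit defining $\Lambda_e$ exists on the whole range of $P_e$, and there $$\Lambda_e=i\lambda_1^2y_1(e)+\lambda_2^2[x_2(e)+iy_2(e)]+\sum_{j:\sigma_j=\tau_j}M^j,$$ where $M^j$ acts through the matrix above, in the basis $\{\varphi_{++},\varphi_{--}\}$,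 on the span of these two vectors in the $j$-th factor $\mathbb C^2\otimes\mathbb C^2$, and as the identity on the other factors. (2) For every $j$, the eigenvalues of $M^j$, with multiplicity, are $z_j^+$ and $z_j^-$. They satisfy $\operatorname{Im}z_j^\pm\ge0$, and $\operatorname{Im}z_j^\pm>0$ if $ab_j\neq0$. If $a=0$ then $z_j^+=ib_j(c_j+1)$ and $z_j^-=0$. If $b_j=0$ then $z_j^\pm=\pm|a|$, so that $\{z_j^+,z_j^-\}=\{a,-a\}$. If $b_j\ne0$, the eigenspace of $M^j$ for each $z_j^{\pm}$ is spanned by $$\xi_j^\pm=\varphi_{++}+\Big[1+i\,\frac{z_j^\pm-a}{b_jc_j}\Big]\varphi_{--}.$$ -/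

import Mathlib

open MeasureTheory Filter Topology
open scoped ENNReal Kronecker

noncomputable section

namespace QubitRegister

/-! ### The register -/

/-- Spin configurations `σ ∈ {+1,-1}^N`. -/
abbrev Conf (N : ℕ) := Fin N → ℤˣ

/-- A sign, as a real number. -/
def sgn (s : ℤˣ) : ℝ := ((s : ℤ) : ℝ)

/-- Physical momentum space `ℝ³`. -/
abbrev R3 := EuclideanSpace ℝ (Fin 3)

/-- The unit sphere `S²`. -/
abbrev S2 := Metric.sphere (0 : R3) 1

/-- The data of the model: pair interactions `J`, magnetic field `B`, coupling constants
`lam1` (energy conserving) and `lam2` (energy exchange), form factors `g1`, `g2` on `ℝ³`,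
inverse temperature `β`, and the arbitrary fixed phase of the glued representation. -/
structure Model (N : ℕ) where
  J : Fin N → Fin N → ℝ
  B : Fin N → ℝ
  lam1 : ℝ
  lam2 : ℝ
  g1 : R3 → ℂ
  g2 : R3 → ℂ
  β : ℝ
  phase : ℝ

/-- The operators on `H_S = ℂ² ⊗ ⋯ ⊗ ℂ²`, as matrices in the basis `φ_σ`. -/
abbrev SysMatrix (N : ℕ) := Matrix (Conf N) (Conf N) ℂ

/-- The doubled space `H_S ⊗ H_S`, with orthonormal basis `φ_{σ,τ}`. -/
abbrev Doubled (N : ℕ) := EuclideanSpace ℂ (Conf N × Conf N)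

/-- The operators on `H_S ⊗ H_S`, as matrices in the basis `φ_{σ,τ}`. -/
abbrev DoubledMatrix (N : ℕ) := Matrix (Conf N × Conf N) (Conf N × Conf N) ℂ

/-- The Pauli matrix `S^z`, in the basis `φ_+`, `φ_-` of `ℂ²`. -/
def pauliZ : Matrix ℤˣ ℤˣ ℂ := Matrix.diagonal fun s => ((sgn s : ℝ) : ℂ)

/-- The Pauli matrix `S^x`, in the basis `φ_+`, `φ_-` of `ℂ²`. -/
def pauliX : Matrix ℤˣ ℤˣ ℂ := fun s t => if s = t then 0 else 1

open Classical in
/-- The matrix `A` acting on the `j`-th factor of `H_S`, the identity acting on the others. -/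
def site {N : ℕ} (A : Matrix ℤˣ ℤˣ ℂ) (j : Fin N) : SysMatrix N := fun σ σ' =>
  if ∀ k, k ≠ j → σ k = σ' k then A (σ j) (σ' j) else 0

/-- The register Hamiltonian `H_S = ∑ J_ij S_i^z S_j^z + ∑ B_j S_j^z`. -/
def hamiltonian {N : ℕ} (Q : Model N) : SysMatrix N :=
  (∑ i, ∑ j, (Q.J i j : ℂ) • (site pauliZ i * site pauliZ j)) +
    ∑ j, (Q.B j : ℂ) • site pauliZ j

/-- The Liouville operator `L_S = H_S ⊗ 1 - 1 ⊗ H_S` of the register. -/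
def liouvilleS {N : ℕ} (Q : Model N) : DoubledMatrix N :=
  hamiltonian Q ⊗ₖ (1 : SysMatrix N) - (1 : SysMatrix N) ⊗ₖ hamiltonian Q

/-- `v_1 = ∑_j S_j^z`. -/
def v1 (N : ℕ) : SysMatrix N := ∑ j, site pauliZ j

/-- `v_2 = ∑_j S_j^x`. -/
def v2 (N : ℕ) : SysMatrix N := ∑ j, site pauliX j

/-- The energy `E(σ)`. -/
def energy {N : ℕ} (Q : Model N) (σ : Conf N) : ℝ :=
  (∑ i, ∑ j, Q.J i j * sgn (σ i) * sgn (σ j)) + ∑ j, Q.B j * sgn (σ j)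

/-- The energy difference `e(σ,τ) = E(σ) - E(τ)`, the eigenvalue of `L_S` at `φ_{σ,τ}`. -/
def energyDiff {N : ℕ} (Q : Model N) (σ τ : Conf N) : ℝ := energy Q σ - energy Q τ

/-- Genericity of the magnetic field: `∑ B_j n_j = 0` with all `n_j ∈ {0,±1,±2}` forces `n = 0`. -/
def GenericField {N : ℕ} (B : Fin N → ℝ) : Prop :=
  ∀ n : Fin N → ℤ, (∀ j, |n j| ≤ 2) → ∑ j, B j * (n j : ℝ) = 0 → ∀ j, n j = 0

/-! ### The reservoir: Fock space over `L²(ℝ × S²)` -/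

/-- The one-particle configuration space `ℝ × S²`. -/
abbrev X := ℝ × S2

/-- The surface measure `dΣ` on `S²`. -/
def sphereMeasure : Measure S2 := (volume : Measure R3).toSphere

instance : IsFiniteMeasure sphereMeasure :=
  inferInstanceAs (IsFiniteMeasure (volume : Measure R3).toSphere)

/-- The measure `du × dΣ` on `ℝ × S²`. -/
def oneMeasure : Measure X := (volume : Measure ℝ).prod sphereMeasure

instance : SigmaFinite oneMeasure :=
  inferInstanceAs (SigmaFinite ((volume : Measure ℝ).prod sphereMeasure))

/-- The product measure on `(ℝ × S²)^n`. -/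
def nMeasure (n : ℕ) : Measure (Fin n → X) := Measure.pi fun _ => oneMeasure

/-- Permuting the particles preserves the product measure. -/
theorem measurePreserving_perm {n : ℕ} (π : Equiv.Perm (Fin n)) :
    MeasurePreserving (fun x : Fin n → X => fun i => x (π i)) (nMeasure n) (nMeasure n) := by
  have h := measurePreserving_piCongrLeft (α := fun _ : Fin n => X)
    (fun _ : Fin n => oneMeasure) π.symm
  have h2 : (fun x : Fin n → X => fun i => x (π i)) =
      (MeasurableEquiv.piCongrLeft (fun _ : Fin n => X) π.symm) := by
    funext x i
    have := MeasurableEquiv.piCongrLeft_apply_apply π.symm (β := fun _ : Fin n => X) x (π i)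
    simpa using this.symm
  rw [h2]
  exact h

/-- The `n`-particle sector without statistics: `H_S ⊗ H_S ⊗ L²((ℝ × S²)^n)`. -/
abbrev Sector (N n : ℕ) := Lp (Doubled N) 2 (nMeasure n)

/-- `H_S ⊗ H_S` tensored with the full Fock space: the Hilbert sum of the sectors. -/
abbrev FullSpace (N : ℕ) := lp (fun n => Sector N n) 2

/-- The total Hilbert space `H_S ⊗ H_S ⊗ F(L²(ℝ × S²))`, where `F` is the bosonic Fock space:
the vectors whose `n`-particle components are symmetric in the particle variables. -/
def totalSpace (N : ℕ) : Submodule ℂ (FullSpace N) where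
  carrier := {ψ | ∀ (n : ℕ) (π : Equiv.Perm (Fin n)),
    Lp.compMeasurePreserving _ (measurePreserving_perm π) (ψ n) = ψ n}
  add_mem' := by
    intro ψ χ hψ hχ n π
    have : (ψ + χ) n = ψ n + χ n := rfl
    rw [this, map_add, hψ n π, hχ n π]
  zero_mem' := by
    intro n π
    exact map_zero _
  smul_mem' := by
    intro c ψ hψ n π
    have : (c • ψ) n = c • ψ n := rfl
    rw [this]
    exact ((Lp.compMeasurePreservingₗ ℂ _ (measurePreserving_perm π)).map_smul c (ψ n)).trans
      (congrArg (c • ·) (hψ n π))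

/-- The vectors of the total Hilbert space. -/
abbrev Vec (N : ℕ) := totalSpace N

/-- The `n`-particle component of a vector, as a function on `(ℝ × S²)^n` (up to null sets). -/
def comp {N : ℕ} (ψ : Vec N) (n : ℕ) : (Fin n → X) → Doubled N := (ψ : FullSpace N) n

/-! ### Operators on the total space

A possibly unbounded operator `T` is given by its graph: `T ψ χ` means that `ψ` belongs to the
domain of `T` and `T ψ = χ`. -/

/-- Application of a matrix to a vector of the doubled space. -/
def act {N : ℕ} (A : DoubledMatrix N) (v : Doubled N) : Doubled N := Matrix.toEuclideanLin A v

/-- The operator `A ⊗ 1` on `(H_S ⊗ H_S) ⊗ F`. -/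
def SysOp {N : ℕ} (A : DoubledMatrix N) (ψ χ : Vec N) : Prop :=
  ∀ n, ∀ᵐ x ∂(nMeasure n), comp χ n x = act A (comp ψ n x)

/-- The total energy `u_1 + ⋯ + u_n` of `n` particles. -/
def sumU {n : ℕ} (x : Fin n → X) : ℝ := ∑ i, (x i).1

/-- The uncoupled Liouville operator `L_0 = L_S + dΓ(u)`. -/
def L0 {N : ℕ} (Q : Model N) (ψ χ : Vec N) : Prop :=
  ∀ n, ∀ᵐ x ∂(nMeasure n),
    comp χ n x = act (liouvilleS Q) (comp ψ n x) + ((sumU x : ℝ) : ℂ) • comp ψ n x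

/-- The eigenspace of `L_0` for `e`, that is, the range of `P_e`. -/
def RanP {N : ℕ} (Q : Model N) (e : ℝ) (ψ : Vec N) : Prop := L0 Q ψ ((e : ℂ) • ψ)

/-- The spectral projection `P_e` of `L_0` for `{e}`: the orthogonal projection onto the
eigenspace. -/
def P {N : ℕ} (Q : Model N) (e : ℝ) (ψ χ : Vec N) : Prop :=
  RanP Q e χ ∧ ∀ η, RanP Q e η → inner ℂ η (ψ - χ) = 0

/-- The complementary projection `1 - P_e`. -/
def Pbar {N : ℕ} (Q : Model N) (e : ℝ) (ψ χ : Vec N) : Prop := P Q e ψ (ψ - χ)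

/-- The resolvent `(L_0 - e + iε)⁻¹`: `χ` is the image of `ψ` iff `(L_0 - e + iε) χ = ψ`. -/
def Res {N : ℕ} (Q : Model N) (e ε : ℝ) (ψ χ : Vec N) : Prop :=
  L0 Q χ (ψ + ((e : ℂ) - Complex.I * (ε : ℂ)) • χ)

/-- The components of `a*(f) ψ`. -/
def createFn {N : ℕ} (f : X → ℂ) (ψ : Vec N) : (n : ℕ) → (Fin n → X) → Doubled N
  | 0, _ => 0
  | m + 1, x => (((Real.sqrt (m + 1))⁻¹ : ℝ) : ℂ) •
      ∑ i : Fin (m + 1), f (x i) • comp ψ m (fun k => x (i.succAbove k))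

/-- The components of `a(f) ψ`. -/
def annihilateFn {N : ℕ} (f : X → ℂ) (ψ : Vec N) (n : ℕ) (x : Fin n → X) : Doubled N :=
  ((Real.sqrt (n + 1) : ℝ) : ℂ) •
    ∫ y, (starRingEnd ℂ) (f y) • comp ψ (n + 1) (Fin.cons y x) ∂oneMeasure

/-- The self-adjoint field operator `1 ⊗ φ(f) = 2^{-1/2} (a*(f) + a(f))`, `f ∈ L²(ℝ × S²)`. -/
def Field {N : ℕ} (f : X → ℂ) (ψ χ : Vec N) : Prop :=
  ∀ n, ∀ᵐ x ∂(nMeasure n),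
    comp χ n x = (((Real.sqrt 2)⁻¹ : ℝ) : ℂ) • (createFn f ψ n x + annihilateFn f ψ n x)

/-- The function `h_β` on `ℝ × S²` associated to a form factor `h` on `ℝ³`; in spherical
coordinates `h(u,Σ)` is `h (u • Σ)`. -/
def glue {N : ℕ} (Q : Model N) (h : R3 → ℂ) (x : X) : ℂ :=
  ((Real.sqrt (x.1 / (1 - Real.exp (-Q.β * x.1))) * Real.sqrt |x.1| : ℝ) : ℂ) *
    (if 0 ≤ x.1 then h (x.1 • (x.2 : R3))
      else Complex.exp (Complex.I * (Q.phase : ℂ)) * (starRingEnd ℂ) (h ((-x.1) • (x.2 : R3))))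

/-- The regularity condition on a form factor: `ω ↦ h_β(· + ω, ·)` has an analytic continuation,
with values in `L²(ℝ × S²)`, to a disc `|ω| < r`. -/
def Regular {N : ℕ} (Q : Model N) (h : R3 → ℂ) : Prop :=
  ∃ r : ℝ, 0 < r ∧ ∃ F : ℂ → Lp ℂ 2 oneMeasure,
    DifferentiableOn ℂ F (Metric.ball 0 r) ∧
    ∀ ω : ℝ, |ω| < r → ∀ᵐ x ∂oneMeasure, F (ω : ℂ) x = glue Q h (x.1 + ω, x.2)

/-- `V = λ_1 (v_1 ⊗ 1) ⊗ φ_β(g_1) + λ_2 (v_2 ⊗ 1) ⊗ φ_β(g_2)`, where `φ_β(g) = φ(g_β)`. -/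
def V {N : ℕ} (Q : Model N) (ψ χ : Vec N) : Prop :=
  ∃ χ₁ χ₂ χ₃ χ₄ : Vec N,
    Field (glue Q Q.g1) ψ χ₁ ∧ SysOp (v1 N ⊗ₖ (1 : SysMatrix N)) χ₁ χ₂ ∧
    Field (glue Q Q.g2) ψ χ₃ ∧ SysOp (v2 N ⊗ₖ (1 : SysMatrix N)) χ₃ χ₄ ∧
    χ = (Q.lam1 : ℂ) • χ₂ + (Q.lam2 : ℂ) • χ₄

/-- The operator `Δ^{1/2}`, with `Δ` the modular operator of the reference vector
(trace state of the register) ⊗ (vacuum): it is `1 ⊗ exp(-β dΓ(u))`. -/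
def ModularHalf {N : ℕ} (Q : Model N) (ψ χ : Vec N) : Prop :=
  ∀ n, ∀ᵐ x ∂(nMeasure n),
    comp χ n x = ((Real.exp (-(Q.β * sumU x) / 2) : ℝ) : ℂ) • comp ψ n x

/-- The modular conjugation `J = J_S ⊗ J_R`: `J_S (φ_l ⊗ φ_r) = C φ_r ⊗ C φ_l`, with `C` the
complex conjugation of coordinates, and
`(J_R ψ)_n(u_1,Σ_1,…,u_n,Σ_n) = exp(i n phase) conj ψ_n(-u_1,Σ_1,…,-u_n,Σ_n)`. -/
def Conj {N : ℕ} (Q : Model N) (ψ χ : Vec N) : Prop :=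
  ∀ n, ∀ᵐ x ∂(nMeasure n), ∀ σ τ : Conf N,
    comp χ n x (σ, τ) = Complex.exp (Complex.I * ((n : ℂ) * (Q.phase : ℂ))) *
      (starRingEnd ℂ) (comp ψ n (fun i => (-(x i).1, (x i).2)) (τ, σ))

/-- The operator `J Δ^{1/2}`. -/
def Tomita {N : ℕ} (Q : Model N) (ψ χ : Vec N) : Prop :=
  ∃ η, ModularHalf Q ψ η ∧ Conj Q η χ

/-- The interaction `I = V - J Δ^{1/2} V J Δ^{1/2}`. -/
def Interaction {N : ℕ} (Q : Model N) (ψ χ : Vec N) : Prop :=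
  ∃ χ₁ χ₂ χ₃ χ₄ : Vec N,
    V Q ψ χ₁ ∧ Tomita Q ψ χ₂ ∧ V Q χ₂ χ₃ ∧ Tomita Q χ₃ χ₄ ∧ χ = χ₁ - χ₄

/-- The operator `P_e I P̄_e (L̄_0 - e + iε)⁻¹ P̄_e I`. -/
def LevelShiftReg {N : ℕ} (Q : Model N) (e ε : ℝ) (ψ χ : Vec N) : Prop :=
  ∃ ψ₁ ψ₂ ψ₃ ψ₄ ψ₅ : Vec N,
    Interaction Q ψ ψ₁ ∧ Pbar Q e ψ₁ ψ₂ ∧ Res Q e ε ψ₂ ψ₃ ∧ Pbar Q e ψ₃ ψ₄ ∧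
    Interaction Q ψ₄ ψ₅ ∧ P Q e ψ₅ χ

/-- The level shift operator `Λ_e = - P_e I P̄_e (L̄_0 - e + i0)⁻¹ P̄_e I P_e` on the range of
`P_e`, where `i0` stands for the limit `ε ↓ 0`. -/
def LevelShift {N : ℕ} (Q : Model N) (e : ℝ) (ψ χ : Vec N) : Prop :=
  RanP Q e ψ ∧ ∃ Φ : ℝ → Vec N,
    (∀ ε, 0 < ε → LevelShiftReg Q e ε ψ (Φ ε)) ∧ Tendsto Φ (𝓝[>] 0) (𝓝 (-χ))

/-! ### The explicit quantities -/

/-- `𝒢(u) = ∫_{S²} |g(|u|,Σ)|² dΣ`. -/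
def angular (g : R3 → ℂ) (u : ℝ) : ℝ := ∫ s, ‖g (|u| • (s : R3))‖ ^ 2 ∂sphereMeasure

/-- `γ_+ = lim_{u ↓ 0} u 𝒢_1(u)`. -/
def gammaPlus {N : ℕ} (Q : Model N) : ℝ := limUnder (𝓝[>] 0) fun u : ℝ => u * angular Q.g1 u

/-- `⟨g_1, ω⁻¹ g_1⟩ = ∫ |g_1(k)|² / |k| d³k`. -/
def invOmega {N : ℕ} (Q : Model N) : ℝ := ∫ k : R3, ‖Q.g1 k‖ ^ 2 / ‖k‖

/-- `e_0 = ∑ (σ_j - τ_j)`. -/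
def e0 {N : ℕ} (σ τ : Conf N) : ℝ := ∑ j, (sgn (σ j) - sgn (τ j))

/-- The hyperbolic cotangent. -/
def coth (x : ℝ) : ℝ := Real.cosh x / Real.sinh x

/-- `P.V. ∫ f(u) / (u - c) du = L`. -/
def HasPV (f : ℝ → ℝ) (c L : ℝ) : Prop :=
  (∀ δ, 0 < δ → IntegrableOn (fun u => f u / (u - c)) {u | δ < |u - c|}) ∧
  Tendsto (fun δ : ℝ => ∫ u in {u | δ < |u - c|}, f u / (u - c)) (𝓝[>] 0) (𝓝 L)

/-- The value of `P.V. ∫ f(u) / (u - c) du`. -/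
def pv (f : ℝ → ℝ) (c : ℝ) : ℝ :=
  limUnder (𝓝[>] 0) fun δ : ℝ => ∫ u in {u | δ < |u - c|}, f u / (u - c)

/-- `u² 𝒢_2(2u) coth(β|u|)`. -/
def kernel2 {N : ℕ} (Q : Model N) (u : ℝ) : ℝ :=
  u ^ 2 * angular Q.g2 (2 * u) * coth (Q.β * |u|)

/-- `y_1(e)`. -/
def y1 {N : ℕ} (Q : Model N) (σ τ : Conf N) : ℝ :=
  Real.pi * e0 σ τ ^ 2 / (2 * Q.β) * gammaPlus Q

/-- `x_2(e)`. -/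
def x2 {N : ℕ} (Q : Model N) (σ τ : Conf N) : ℝ :=
  -2 * ∑ j with σ j ≠ τ j, sgn (σ j) * pv (kernel2 Q) (Q.B j)

/-- `y_2(e)`. -/
def y2 {N : ℕ} (Q : Model N) (σ τ : Conf N) : ℝ :=
  2 * Real.pi * ∑ j with σ j ≠ τ j,
    Q.B j ^ 2 * angular Q.g2 (2 * Q.B j) * coth (Q.β * Q.B j)

/-- `a = -λ_1² e_0 ⟨g_1, ω⁻¹ g_1⟩`. -/
def coefA {N : ℕ} (Q : Model N) (σ τ : Conf N) : ℝ := -Q.lam1 ^ 2 * e0 σ τ * invOmega Q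

/-- `b_j = 4π λ_2² B_j² 𝒢_2(2B_j) / (exp(2βB_j) - 1)`. -/
def coefB {N : ℕ} (Q : Model N) (j : Fin N) : ℝ :=
  4 * Real.pi * Q.lam2 ^ 2 * (Q.B j ^ 2 * angular Q.g2 (2 * Q.B j)) /
    (Real.exp (2 * Q.β * Q.B j) - 1)

/-- `c_j = exp(2βB_j)`. -/
def coefC {N : ℕ} (Q : Model N) (j : Fin N) : ℝ := Real.exp (2 * Q.β * Q.B j)

/-- The matrix `M^j` in the basis `φ_{++}, φ_{--}`, as a function of `a`, `b`, `c`. -/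
def matM (a b c : ℝ) : Matrix (Fin 2) (Fin 2) ℂ :=
  !![(a : ℂ) + Complex.I * b * c, -Complex.I * b * c;
     -Complex.I * b, -(a : ℂ) + Complex.I * b]

/-- A square root of the discriminant of `M^j` (principal branch). -/
def rootM (a b c : ℝ) : ℂ :=
  (-(b : ℂ) ^ 2 * ((c : ℂ) + 1) ^ 2 +
    4 * (a : ℂ) * ((a : ℂ) + Complex.I * b * ((c : ℂ) - 1))) ^ (1 / 2 : ℂ)

/-- `z_j^+`. -/
def zPlus (a b c : ℝ) : ℂ := (1 / 2) * (Complex.I * b * ((c : ℂ) + 1) + rootM a b c)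

/-- `z_j^-`. -/
def zMinus (a b c : ℝ) : ℂ := (1 / 2) * (Complex.I * b * ((c : ℂ) + 1) - rootM a b c)

/-- The vector `φ_{++} + [1 + i (z - a) / (b c)] φ_{--}`, in coordinates. -/
def xi (a b c : ℝ) (z : ℂ) : Fin 2 → ℂ :=
  ![1, 1 + Complex.I * (z - (a : ℂ)) / ((b : ℂ) * (c : ℂ))]

/-- The position of `φ_{ss}` in the basis `φ_{++}, φ_{--}`. -/
def pos (s : ℤˣ) : Fin 2 := if s = 1 then 0 else 1

open Classical in
/-- The operator on `H_S ⊗ H_S` that acts as the `2 × 2` matrix `m` on the span of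
`φ_{++}, φ_{--}` in the `j`-th factor `ℂ² ⊗ ℂ²`, as zero on `φ_{+-}, φ_{-+}` there, and as the
identity on the other factors. -/
def onPair {N : ℕ} (m : Matrix (Fin 2) (Fin 2) ℂ) (j : Fin N) : DoubledMatrix N := fun p q =>
  if (∀ k, k ≠ j → p.1 k = q.1 k ∧ p.2 k = q.2 k) ∧ p.1 j = p.2 j ∧ q.1 j = q.2 j
  then m (pos (p.1 j)) (pos (q.1 j)) else 0

/-- The explicit operator
`iλ_1² y_1(e) + λ_2² [x_2(e) + i y_2(e)] + ∑_{j : σ_j = τ_j} M^j` on `H_S ⊗ H_S`. -/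
def explicitShift {N : ℕ} (Q : Model N) (σ τ : Conf N) : DoubledMatrix N :=
  (Complex.I * (Q.lam1 : ℂ) ^ 2 * (y1 Q σ τ : ℂ) +
      (Q.lam2 : ℂ) ^ 2 * ((x2 Q σ τ : ℂ) + Complex.I * (y2 Q σ τ : ℂ))) •
      (1 : DoubledMatrix N) +
    ∑ j with σ j = τ j, onPair (matM (coefA Q σ τ) (coefB Q j) (coefC Q j)) j

end QubitRegister

end

/-! On the `n`-particle sector with `n ≥ 1`, `dΓ(u)` multiplies by `u_1 + ⋯ + u_n`, and this sum
avoids any given value almost everywhere. Hence the range of `P_e` is `ker(L_S - e) ⊗ Ω`, a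
finite-dimensional space, and everything reduces to vectors with at most two particles. The
interaction sends `w ⊗ Ω` to a one-particle vector, the resolvent of `L_0` multiplies it by `(u +
energy shift + iε)⁻¹`, and the second interaction is needed only through its vacuum component.

The gluing makes `g_β` invariant under `J Δ^{1/2}` (`glue_conj_refl`). The second term of `I`
therefore acts by right multiplication on the register; when it annihilates a particle it carries
the weight `exp(-β u)`. Put `G(u) = ∫ |g_β(u,Σ)|² dΣ`. Left multiplication produces Cauchy integrals
of `G(u)`. Right multiplication produces those of `exp(-β u) G(u) = G(-u)`, which is detailed
balance (`IsEnergyDensity.neg_eq`).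

The Sokhotski–Plemelj formula evaluates the limits as `P.V. - iπ G(pole)`. It needs regularity of
`G`. Since `∫_{a+s}^{b+s} G` is the squared norm of the boosted form factor on a fixed window, it is
twice differentiable in `s`, so `G` has an integrable, bounded, Lipschitz version
(`Regular.exists_tameDensity`). Continuity of the angular integral makes the formula for `G`
pointwise away from `0`, while `G(0) = γ_+ / β` is a limit.

Genericity says that `e(σ,τ)` determines every difference `σ_j - τ_j` (`resonance_iff`).
Consequently the cross terms in `λ_1 λ_2` vanish, and a spin flip must be undone at the same site,
either on the same copy or on the other one. The `λ_1` term has its pole at `0` and gives `y_1`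
together with a real part proportional to `∑(σ_j + τ_j)`, the source of the diagonal entries `±a`.
In the `λ_2` term the poles are at `±2B_j`. At sites with `σ_j = τ_j` the principal values cancel
and the imaginary parts form the jump matrix with rates `b_j` and `b_j c_j`. At sites with `σ_j ≠
τ_j` the double flip is not resonant, and the scalars `x_2` and `y_2` remain. The computation is
`vacI_apply`, followed by `limitValue_eq`.

The statements on `M^j` are algebra of a `2 × 2` matrix: trace and determinant give the eigenvalues,
and the sign of the imaginary parts follows from bounding the imaginary part of the square root of
the discriminant by `b(c+1)`. -/

namespace QubitRegister

/-! ### Integrable Lipschitz densities and the Sokhotski–Plemelj formula -/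

/-- A function whose symmetric increments over all windows are differentiable under translation
is almost everywhere the primitive of the density of the derivative. -/
theorem ae_eq_primitive {G D : ℝ → ℝ} (hG : Integrable G) (hD : Integrable D)
    (h : ∀ a b, a < b → HasDerivAt (fun s => ∫ u in (a + s)..(b + s), G u)
      (∫ u in a..b, D u) 0) :
    ∃ c, G =ᵐ[volume] fun u => c + ∫ t in (0 : ℝ)..u, D t := by
  have key := LocallyIntegrable.ae_hasDerivAt_integral hG.locallyIntegrable
  have hint : ∀ a b, IntervalIntegrable G volume a b := fun a b => hG.intervalIntegrable
  have hintD : ∀ a b, IntervalIntegrable D volume a b := fun a b => hD.intervalIntegrable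
  -- At Lebesgue points `a` and `b` the window integral has derivative `G b - G a` at `s = 0`;
  -- uniqueness of derivatives identifies it with the given one.
  have step : ∀ a b, a < b → (∀ c, HasDerivAt (fun x => ∫ t in c..x, G t) (G a) a) →
      (∀ c, HasDerivAt (fun x => ∫ t in c..x, G t) (G b) b) → G b - G a = ∫ u in a..b, D u := by
    intro a b hab ha hb
    have h1 : HasDerivAt (fun s => ∫ t in (0:ℝ)..(a + s), G t) (G a) 0 :=
      HasDerivAt.comp_const_add a 0 (by simpa using ha 0)
    have h2 : HasDerivAt (fun s => ∫ t in (0:ℝ)..(b + s), G t) (G b) 0 :=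
      HasDerivAt.comp_const_add b 0 (by simpa using hb 0)
    have h3 := h2.sub h1
    have h4 : (fun s => ∫ u in (a + s)..(b + s), G u) =
        (fun s => ∫ t in (0:ℝ)..(b + s), G t) - (fun s => ∫ t in (0:ℝ)..(a + s), G t) := by
      funext s
      simp only [Pi.sub_apply]
      rw [intervalIntegral.integral_interval_sub_left (hint _ _) (hint _ _)]
    have h5 := h a b hab
    rw [h4] at h5
    exact h3.unique h5
  obtain ⟨a0, ha0⟩ := key.exists
  refine ⟨G a0 - ∫ t in (0:ℝ)..a0, D t, ?_⟩
  filter_upwards [key] with u hu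
  have hsub := intervalIntegral.integral_interval_sub_left (hintD 0 u) (hintD 0 a0)
  rcases lt_trichotomy u a0 with hlt | heq | hgt
  · have := step u a0 hlt hu ha0
    rw [intervalIntegral.integral_symm] at this
    linarith
  · subst heq; simp
  · have := step a0 u hgt ha0 hu
    linarith

/-- Integrable, bounded and Lipschitz functions on the line. -/
structure TameDensity (G : ℝ → ℝ) : Prop where
  integrable : Integrable G
  lipschitz : ∃ K : ℝ, ∀ x y, |G x - G y| ≤ K * |x - y|
  bounded : ∃ M : ℝ, ∀ x, |G x| ≤ M

theorem TameDensity.continuous {G : ℝ → ℝ} (hG : TameDensity G) : Continuous G := by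
  obtain ⟨K, hK⟩ := hG.lipschitz
  have : LipschitzWith (Real.toNNReal K) G := by
    apply LipschitzWith.of_dist_le_mul
    intro x y
    rw [Real.dist_eq, Real.dist_eq]
    exact (hK x y).trans (mul_le_mul_of_nonneg_right (Real.le_coe_toNNReal K) (abs_nonneg _))
  exact this.continuous

/-- The density `D` is itself almost everywhere a primitive of an integrable function, hence
essentially bounded by `|c'| + ∫ ‖D'‖`. That bound is a Lipschitz constant for the primitive of `D`
that represents `G`. -/
theorem exists_tameDensity {G D D' : ℝ → ℝ} (hG : Integrable G) (hD : Integrable D)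
    (hD' : Integrable D')
    (h : ∀ a b, a < b → HasDerivAt (fun s => ∫ u in (a + s)..(b + s), G u)
      (∫ u in a..b, D u) 0)
    (h' : ∀ a b, a < b → HasDerivAt (fun s => ∫ u in (a + s)..(b + s), D u)
      (∫ u in a..b, D' u) 0) :
    ∃ G', TameDensity G' ∧ G =ᵐ[volume] G' := by
  obtain ⟨c, hc⟩ := ae_eq_primitive hG hD h
  obtain ⟨c', hc'⟩ := ae_eq_primitive hD hD' h'
  have bound : ∀ {F : ℝ → ℝ}, Integrable F → ∀ u, |∫ t in (0:ℝ)..u, F t| ≤ ∫ t, ‖F t‖ := by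
    intro F hF u
    have h1 := intervalIntegral.norm_integral_le_integral_norm_uIoc (f := F) (a := 0) (b := u)
      (μ := volume)
    exact h1.trans (setIntegral_le_integral hF.norm (ae_of_all _ fun _ => norm_nonneg _))
  refine ⟨_, ⟨hG.congr hc, ⟨|c'| + ∫ t, ‖D' t‖, ?_⟩, ⟨|c| + ∫ t, ‖D t‖, ?_⟩⟩, hc⟩
  · intro x y
    have hsub := intervalIntegral.integral_interval_sub_left
      (hD.intervalIntegrable (a := 0) (b := x)) (hD.intervalIntegrable (a := 0) (b := y))
    have : (c + ∫ t in (0:ℝ)..x, D t) - (c + ∫ t in (0:ℝ)..y, D t) = ∫ t in y..x, D t := by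
      linarith
    rw [this]
    rw [← Real.norm_eq_abs]
    refine intervalIntegral.norm_integral_le_of_norm_le_const_ae ?_
    filter_upwards [hc'] with t ht _
    rw [ht]
    exact (norm_add_le _ _).trans (add_le_add le_rfl (bound hD' t))
  · intro x
    exact (abs_add_le _ _).trans (add_le_add le_rfl (bound hD x))

/-- The odd part of `G` at `c`, divided by the distance to `c`. -/
noncomputable def oddQuot (G : ℝ → ℝ) (c t : ℝ) : ℝ := (G (c + t) - G (c - t)) / t

/-- On `(0,1]` the Lipschitz property bounds the quotient by `2K`; for `t > 1` it is dominated by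
`|G (c + t)| + |G (c - t)|`. -/
theorem TameDensity.integrableOn_oddQuot {G : ℝ → ℝ} (hG : TameDensity G) (c : ℝ) :
    IntegrableOn (oddQuot G c) (Set.Ioi 0) := by
  obtain ⟨K, hK⟩ := hG.lipschitz
  have hm : Measurable (oddQuot G c) := by
    have := hG.continuous.measurable
    unfold oddQuot
    fun_prop
  have h1 : Integrable (fun t => G (c + t)) := hG.integrable.comp_add_left c
  have h2 : Integrable (fun t => G (c - t)) := hG.integrable.comp_sub_left c
  have h3 : Integrable ((Set.Ioc (0:ℝ) 1).indicator fun _ => 2 * K) := by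
    rw [integrable_indicator_iff measurableSet_Ioc]
    exact integrableOn_const (by simp)
  have hK0 : 0 ≤ K := by simpa using (abs_nonneg _).trans (hK 1 0)
  refine Integrable.mono' ((h3.add (h1.norm.add h2.norm)).integrableOn) hm.aestronglyMeasurable ?_
  refine (ae_restrict_iff' measurableSet_Ioi).2 (ae_of_all _ fun t ht => ?_)
  have ht : 0 < t := ht
  simp only [Pi.add_apply, Real.norm_eq_abs, oddQuot, abs_div, abs_of_pos ht]
  rw [div_le_iff₀ ht]
  have hsum : 0 ≤ |G (c + t)| + |G (c - t)| := by positivity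
  by_cases h : t ≤ 1
  · rw [Set.indicator_of_mem (show t ∈ Set.Ioc (0:ℝ) 1 from ⟨ht, h⟩)]
    have := hK (c + t) (c - t)
    rw [show c + t - (c - t) = 2 * t by ring, abs_of_pos (by linarith : 0 < 2 * t)] at this
    nlinarith
  · rw [Set.indicator_of_notMem (fun hh => h hh.2), zero_add]
    have := abs_sub (G (c + t)) (G (c - t))
    push Not at h
    nlinarith

theorem integral_eq_integral_Ioi_fold {E : Type*} [NormedAddCommGroup E] [NormedSpace ℝ E]
    {f : ℝ → E} (hf : Integrable f) :
    ∫ t, f t = ∫ t in Set.Ioi (0:ℝ), (f t + f (-t)) := by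
  rw [integral_add hf.integrableOn hf.comp_neg.integrableOn, integral_comp_neg_Ioi, neg_zero,
    add_comm, intervalIntegral.integral_Iic_add_Ioi hf.integrableOn hf.integrableOn]

/-- Folding the symmetric truncation around `c` cancels the singularity: what remains is the
integral of the integrable function `oddQuot G c` over `t > δ`, and dominated convergence applies.
-/
theorem TameDensity.hasPV {G : ℝ → ℝ} (hG : TameDensity G) (c : ℝ) :
    HasPV G c (∫ t in Set.Ioi (0:ℝ), oddQuot G c t) := by
  have hmG := hG.continuous.measurable
  have hset : ∀ δ : ℝ, MeasurableSet {u : ℝ | δ < |u - c|} := fun δ =>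
    measurableSet_lt measurable_const (by fun_prop)
  have hint : ∀ δ, 0 < δ → IntegrableOn (fun u => G u / (u - c)) {u | δ < |u - c|} := by
    intro δ hδ
    refine Integrable.mono' ((hG.integrable.norm.const_mul δ⁻¹).integrableOn)
      (hmG.div (measurable_id.sub_const c)).aestronglyMeasurable ?_
    refine (ae_restrict_iff' (hset δ)).2 (ae_of_all _ fun u hu => ?_)
    have hu : δ < |u - c| := hu
    rw [norm_div, div_eq_inv_mul]
    gcongr
    exact hu.le
  refine ⟨hint, ?_⟩
  have hfold : ∀ δ, 0 < δ → ∫ u in {u | δ < |u - c|}, G u / (u - c) =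
      ∫ t in Set.Ioi (0:ℝ), (Set.Ioi δ).indicator (oddQuot G c) t := by
    intro δ hδ
    rw [← integral_indicator (hset δ), ← integral_add_right_eq_self _ c,
      integral_eq_integral_Ioi_fold]
    · refine setIntegral_congr_fun measurableSet_Ioi fun t ht => ?_
      have ht : 0 < t := ht
      by_cases h : δ < t
      · rw [Set.indicator_of_mem (by simpa [abs_of_pos ht] using h),
          Set.indicator_of_mem (by simpa [abs_of_pos ht] using h), Set.indicator_of_mem (show t ∈ Set.Ioi δ from h)]
        simp only [oddQuot, add_sub_cancel_right]
        rw [add_comm t c, show -t + c = c - t by ring]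
        field_simp
        ring
      · rw [Set.indicator_of_notMem (by simpa [abs_of_pos ht] using h),
          Set.indicator_of_notMem (by simpa [abs_of_pos ht] using h), Set.indicator_of_notMem (show t ∉ Set.Ioi δ from h),
          add_zero]
    · exact ((integrable_indicator_iff (hset δ)).2 (hint δ hδ)).comp_add_right c
  refine Tendsto.congr' (f₁ := fun δ => ∫ t in Set.Ioi (0:ℝ),
    (Set.Ioi δ).indicator (oddQuot G c) t) ?_ ?_
  · filter_upwards [self_mem_nhdsWithin] with δ hδ
    exact (hfold δ hδ).symm
  · have hI := hG.integrableOn_oddQuot c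
    refine tendsto_integral_filter_of_dominated_convergence (fun t => ‖oddQuot G c t‖) ?_ ?_
      hI.norm ?_
    · exact Eventually.of_forall fun δ => hI.1.indicator measurableSet_Ioi
    · exact Eventually.of_forall fun δ => ae_of_all _ fun t => norm_indicator_le_norm_self _ _
    · refine (ae_restrict_iff' measurableSet_Ioi).2 (ae_of_all _ fun t ht => ?_)
      refine tendsto_const_nhds.congr' ?_
      have : ∀ᶠ δ in 𝓝[>] (0:ℝ), δ < t := nhdsWithin_le_nhds (Iio_mem_nhds ht)
      filter_upwards [this] with δ hδ
      rw [Set.indicator_of_mem (show t ∈ Set.Ioi δ from hδ)]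

/-- The substitution `t = ε s` turns the kernel into `(1 + s²)⁻¹`, of total mass `π`; boundedness
and continuity of `G` give dominated convergence. -/
theorem TameDensity.tendsto_poisson {G : ℝ → ℝ} (hG : TameDensity G) (c : ℝ) :
    Tendsto (fun ε : ℝ => ∫ t, G (c + t) * (ε / (t ^ 2 + ε ^ 2))) (𝓝[>] 0)
      (𝓝 (Real.pi * G c)) := by
  obtain ⟨M, hM⟩ := hG.bounded
  have hc := hG.continuous
  have hsub : ∀ ε, 0 < ε → ∫ t, G (c + t) * (ε / (t ^ 2 + ε ^ 2)) =
      ∫ s, G (c + ε * s) * (1 + s ^ 2)⁻¹ := by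
    intro ε hε
    have := Measure.integral_comp_mul_left (fun t => G (c + t) * (ε / (t ^ 2 + ε ^ 2))) ε
    rw [abs_of_pos (inv_pos.2 hε), smul_eq_mul] at this
    rw [eq_comm, inv_mul_eq_iff_eq_mul₀ hε.ne'] at this
    rw [this, ← integral_const_mul]
    congr 1 with s
    field_simp
    ring
  have hlim : Tendsto (fun ε : ℝ => ∫ s, G (c + ε * s) * (1 + s ^ 2)⁻¹) (𝓝[>] 0)
      (𝓝 (∫ s, G c * (1 + s ^ 2)⁻¹)) := by
    refine tendsto_integral_filter_of_dominated_convergence (fun s => M * (1 + s ^ 2)⁻¹) ?_ ?_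
      (integrable_inv_one_add_sq.const_mul M) ?_
    · exact Eventually.of_forall fun ε => (Measurable.aestronglyMeasurable (by
        have := hc.measurable; fun_prop))
    · refine Eventually.of_forall fun ε => ae_of_all _ fun s => ?_
      rw [norm_mul, Real.norm_eq_abs, Real.norm_of_nonneg (by positivity : 0 ≤ (1 + s ^ 2)⁻¹)]
      gcongr
      exact hM _
    · refine ae_of_all _ fun s => ?_
      have : Continuous fun ε : ℝ => G (c + ε * s) * (1 + s ^ 2)⁻¹ := by fun_prop
      simpa using (this.tendsto 0).mono_left nhdsWithin_le_nhds
  rw [integral_const_mul, integral_univ_inv_one_add_sq, mul_comm] at hlim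
  refine hlim.congr' ?_
  filter_upwards [self_mem_nhdsWithin] with ε hε
  exact (hsub ε hε).symm

theorem TameDensity.integrable_mul_of_bounded {G : ℝ → ℝ} (hG : TameDensity G) {k : ℝ → ℝ}
    (hk : Measurable k) {C : ℝ} (hC : ∀ t, |k t| ≤ C) (c : ℝ) :
    Integrable fun t => G (c + t) * k t :=
  (hG.integrable.comp_add_left c).mul_bdd hk.aestronglyMeasurable (ae_of_all _ hC)

/-- The kernel is odd, so folding leaves `oddQuot G c t` times `t² / (t² + ε²) ≤ 1`. The limit is
therefore the same integral as for the sharp cut-off in `TameDensity.hasPV`. -/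
theorem TameDensity.tendsto_conjPoisson {G : ℝ → ℝ} (hG : TameDensity G) (c : ℝ) :
    Tendsto (fun ε : ℝ => ∫ t, G (c + t) * (t / (t ^ 2 + ε ^ 2))) (𝓝[>] 0)
      (𝓝 (∫ t in Set.Ioi (0:ℝ), oddQuot G c t)) := by
  have hI := hG.integrableOn_oddQuot c
  have hfold : ∀ ε, 0 < ε → ∫ t, G (c + t) * (t / (t ^ 2 + ε ^ 2)) =
      ∫ t in Set.Ioi (0:ℝ), oddQuot G c t * (t ^ 2 / (t ^ 2 + ε ^ 2)) := by
    intro ε hε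
    rw [integral_eq_integral_Ioi_fold]
    · refine setIntegral_congr_fun measurableSet_Ioi fun t ht => ?_
      have ht : 0 < t := ht
      simp only [oddQuot]
      rw [← sub_eq_add_neg]
      field_simp
      ring
    · refine hG.integrable_mul_of_bounded (by fun_prop) (C := ε⁻¹) (fun t => ?_) c
      rw [abs_div, abs_of_pos (by positivity : 0 < t ^ 2 + ε ^ 2), div_le_iff₀ (by positivity),
        inv_mul_eq_div, le_div_iff₀ hε]
      nlinarith [sq_abs t, sq_nonneg (|t| - ε), abs_nonneg t]
  refine Tendsto.congr' (f₁ := fun ε => ∫ t in Set.Ioi (0:ℝ),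
    oddQuot G c t * (t ^ 2 / (t ^ 2 + ε ^ 2))) ?_ ?_
  · filter_upwards [self_mem_nhdsWithin] with ε hε
    exact (hfold ε hε).symm
  · refine tendsto_integral_filter_of_dominated_convergence (fun t => ‖oddQuot G c t‖) ?_ ?_
      hI.norm ?_
    · exact Eventually.of_forall fun ε => hI.1.mul
        (Measurable.aestronglyMeasurable (by fun_prop))
    · refine Eventually.of_forall fun ε => ae_of_all _ fun t => ?_
      rw [norm_mul]
      refine mul_le_of_le_one_right (norm_nonneg _) ?_
      rw [Real.norm_of_nonneg (by positivity)]
      exact div_le_one_of_le₀ (by nlinarith [sq_nonneg ε]) (by positivity)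
    · refine (ae_restrict_iff' measurableSet_Ioi).2 (ae_of_all _ fun t ht => ?_)
      have ht : 0 < t := ht
      have : ContinuousAt (fun ε : ℝ => oddQuot G c t * (t ^ 2 / (t ^ 2 + ε ^ 2))) 0 := by
        refine continuousAt_const.mul (continuousAt_const.div (by fun_prop) (by positivity))
      have h2 := this.tendsto.mono_left (nhdsWithin_le_nhds (s := Set.Ioi 0))
      have h0 : t ^ 2 / (t ^ 2 + (0:ℝ) ^ 2) = 1 := by field_simp; ring
      rwa [h0, mul_one] at h2

/-- The Sokhotski–Plemelj formula. -/
theorem TameDensity.tendsto_cauchy {G : ℝ → ℝ} (hG : TameDensity G) (c : ℝ) :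
    Tendsto (fun ε : ℝ => ∫ u : ℝ, (G u : ℂ) * (((u - c : ℝ) : ℂ) + Complex.I * ε)⁻¹) (𝓝[>] 0)
      (𝓝 (((∫ t in Set.Ioi (0:ℝ), oddQuot G c t : ℝ) : ℂ) -
        Complex.I * ((Real.pi * G c : ℝ) : ℂ))) := by
  -- The real and imaginary parts of `(t + iε)⁻¹` are `t / (t² + ε²)` and `-ε / (t² + ε²)`, the two
  -- kernels treated above.
  have hlim := ((Complex.continuous_ofReal.tendsto _).comp (hG.tendsto_conjPoisson c)).sub
    (((Complex.continuous_ofReal.tendsto _).comp (hG.tendsto_poisson c)).const_mul Complex.I)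
  refine hlim.congr' ?_
  filter_upwards [self_mem_nhdsWithin] with ε hε
  have hε : 0 < ε := hε
  simp only [Function.comp]
  rw [← integral_complex_ofReal, ← integral_complex_ofReal, ← integral_const_mul, ← integral_sub]
  · rw [← integral_add_left_eq_self (fun u : ℝ => (G u : ℂ) *
      (((u - c : ℝ) : ℂ) + Complex.I * ε)⁻¹) c]
    congr 1 with t
    have hne : (t : ℂ) + Complex.I * ε ≠ 0 := by
      intro h
      have := congrArg Complex.im h
      simp at this
      exact hε.ne' this
    have hne2 : ((t : ℂ) ^ 2 + (ε : ℂ) ^ 2) ≠ 0 := by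
      have : (0:ℝ) < t ^ 2 + ε ^ 2 := by positivity
      exact_mod_cast this.ne'
    rw [add_sub_cancel_left]
    have hinv : ((t : ℂ) + Complex.I * ε)⁻¹ = (t - Complex.I * ε) / (t ^ 2 + ε ^ 2) := by
      rw [inv_eq_one_div, div_eq_div_iff hne hne2]
      linear_combination (ε : ℂ) ^ 2 * Complex.I_sq
    rw [hinv]
    push_cast
    ring
  · refine (hG.integrable_mul_of_bounded (by fun_prop) (C := ε⁻¹) (fun t => ?_) c).ofReal
    rw [abs_div, abs_of_pos (by positivity : 0 < t ^ 2 + ε ^ 2), div_le_iff₀ (by positivity),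
      inv_mul_eq_div, le_div_iff₀ hε]
    nlinarith [sq_abs t, sq_nonneg (|t| - ε), abs_nonneg t]
  · refine ((hG.integrable_mul_of_bounded (by fun_prop) (C := ε⁻¹) (fun t => ?_) c).ofReal).const_mul _
    rw [abs_div, abs_of_pos (by positivity : 0 < t ^ 2 + ε ^ 2), div_le_iff₀ (by positivity),
      inv_mul_eq_div, le_div_iff₀ hε, abs_of_pos hε]
    nlinarith [sq_nonneg t]

theorem TameDensity.comp_neg {G : ℝ → ℝ} (hG : TameDensity G) : TameDensity fun u => G (-u) := by
  obtain ⟨K, hK⟩ := hG.lipschitz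
  obtain ⟨M, hM⟩ := hG.bounded
  refine ⟨hG.integrable.comp_neg, ⟨K, fun x y => ?_⟩, ⟨M, fun x => hM _⟩⟩
  have := hK (-x) (-y)
  rwa [show -x - -y = -(x - y) by ring, abs_neg] at this

/-- Needed because `kernel2` agrees with a Lipschitz function only away from `u = 0`. -/
theorem HasPV.congr {f g : ℝ → ℝ} {c L : ℝ} (hf : HasPV f c L) (h : f =ᵐ[volume] g) :
    HasPV g c L := by
  have h' : (fun u => f u / (u - c)) =ᵐ[volume] fun u => g u / (u - c) := by
    filter_upwards [h] with u hu
    rw [hu]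
  refine ⟨fun δ hδ => (hf.1 δ hδ).congr (ae_restrict_of_ae h'), hf.2.congr fun δ => ?_⟩
  exact integral_congr_ae (ae_restrict_of_ae h')

theorem HasPV.pv_eq {f : ℝ → ℝ} {c L : ℝ} (hf : HasPV f c L) : pv f c = L := hf.2.limUnder_eq

/-! ### The energy density of a regular form factor -/

/-- The surface integral of the pointwise real inner product. -/
noncomputable def innerDensity (f g : X → ℂ) (u : ℝ) : ℝ :=
  ∫ s, inner ℝ (f (u, s)) (g (u, s)) ∂sphereMeasure

theorem integrable_innerDensity {f g : X → ℂ} (hf : MemLp f 2 oneMeasure)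
    (hg : MemLp g 2 oneMeasure) : Integrable (innerDensity f g) := by
  have h : Integrable (fun x => inner ℝ (f x) (g x)) oneMeasure := by
    have := L2.integrable_inner (𝕜 := ℝ) hf.toLp hg.toLp
    refine this.congr ?_
    filter_upwards [hf.coeFn_toLp, hg.coeFn_toLp] with x h1 h2
    rw [h1, h2]
  exact Integrable.integral_prod_left h

/-- Makes window integrals of `innerDensity` bilinear in `L²` vectors, so that they can be
differentiated by the product rule. -/
theorem inner_restrict_window (f g : Lp ℂ 2 oneMeasure) {a b : ℝ} (hab : a ≤ b) :
    inner ℝ (LpToLpRestrictCLM X ℂ ℝ oneMeasure 2 (Set.Ioc a b ×ˢ Set.univ) f)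
      (LpToLpRestrictCLM X ℂ ℝ oneMeasure 2 (Set.Ioc a b ×ˢ Set.univ) g) =
      ∫ u in a..b, innerDensity f g u := by
  have hI : Integrable (fun x => inner ℝ (f x) (g x)) oneMeasure := L2.integrable_inner f g
  rw [L2.inner_def, intervalIntegral.integral_of_le hab]
  have h1 : ∫ x in Set.Ioc a b ×ˢ Set.univ, inner ℝ (f x) (g x) ∂oneMeasure =
      ∫ u in Set.Ioc a b, innerDensity f g u := by
    have := setIntegral_prod (μ := (volume : Measure ℝ)) (ν := sphereMeasure)
      (s := Set.Ioc a b) (t := Set.univ) (fun x => inner ℝ (f x) (g x)) hI.integrableOn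
    simp only [Measure.restrict_univ] at this
    exact this
  rw [← h1]
  refine integral_congr_ae ?_
  filter_upwards [LpToLpRestrictCLM_coeFn ℝ (Set.Ioc a b ×ˢ Set.univ) f,
    LpToLpRestrictCLM_coeFn ℝ (Set.Ioc a b ×ˢ Set.univ) g] with x h1 h2
  rw [h1, h2]

theorem innerDensity_congr {f f' g g' : X → ℂ} (h : f =ᵐ[oneMeasure] f')
    (h' : g =ᵐ[oneMeasure] g') : innerDensity f g =ᵐ[volume] innerDensity f' g' := by
  have h1 := Measure.ae_ae_of_ae_prod h
  have h2 := Measure.ae_ae_of_ae_prod h'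
  filter_upwards [h1, h2] with u hu hu'
  refine integral_congr_ae ?_
  filter_upwards [hu, hu'] with s hs hs'
  rw [hs, hs']

theorem Regular.memLp_glue {N : ℕ} {Q : Model N} {h : R3 → ℂ} (hreg : Regular Q h) :
    MemLp (glue Q h) 2 oneMeasure := by
  obtain ⟨r, hr, F, -, hF⟩ := hreg
  have := hF 0 (by simpa using hr)
  refine (memLp_congr_ae ?_).1 (Lp.memLp (F ((0 : ℝ) : ℂ)))
  filter_upwards [this] with x hx
  rw [hx, add_zero]

/-- Moving the window by `s` is the same as keeping it fixed and boosting the form factor by `s`.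
The boosted vector `F s` is analytic, so the window energy `‖W a b (F s)‖²` can be differentiated
twice in `s`; by the product rule both derivatives are window integrals of integrable densities, `D`
and `D'`. -/
theorem Regular.exists_tameDensity {N : ℕ} {Q : Model N} {h : R3 → ℂ} (hreg : Regular Q h) :
    ∃ G, TameDensity G ∧ innerDensity (glue Q h) (glue Q h) =ᵐ[volume] G := by
  have hmem := hreg.memLp_glue
  obtain ⟨r, hr, F, hd, hF⟩ := hreg
  have hopen : IsOpen (Metric.ball (0:ℂ) r) := Metric.isOpen_ball
  have hd1 := hd.deriv hopen
  have hin : ∀ s : ℝ, |s| < r → (s : ℂ) ∈ Metric.ball (0:ℂ) r := fun s hs => by simpa using hs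
  have hreal : ∀ {f : ℂ → Lp ℂ 2 oneMeasure} {s : ℝ}, DifferentiableAt ℂ f s →
      HasDerivAt (fun s : ℝ => f s) (deriv f s) s := fun {f s} hf => by
    simpa [Function.comp_def] using hf.hasDerivAt.scomp s Complex.ofRealCLM.hasDerivAt
  have hder : ∀ s : ℝ, |s| < r → HasDerivAt (fun s : ℝ => F s) (deriv F s) s := fun s hs =>
    hreal (hd.differentiableAt (hopen.mem_nhds (hin s hs)))
  have hder1 : ∀ s : ℝ, |s| < r →
      HasDerivAt (fun s : ℝ => deriv F s) (deriv (deriv F) s) s := fun s hs =>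
    hreal (hd1.differentiableAt (hopen.mem_nhds (hin s hs)))
  set W := fun a b : ℝ => LpToLpRestrictCLM X ℂ ℝ oneMeasure 2 (Set.Ioc a b ×ˢ Set.univ) with hW
  have hr0 : |(0:ℝ)| < r := by simpa using hr
  set p0 := F ((0:ℝ):ℂ)
  set p1 := deriv F ((0:ℝ):ℂ)
  set p2 := deriv (deriv F) ((0:ℝ):ℂ)
  set G := innerDensity (glue Q h) (glue Q h)
  set D := fun u => innerDensity p0 p1 u + innerDensity p1 p0 u with hDdef
  set D' := fun u => (innerDensity p0 p2 u + innerDensity p1 p1 u) +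
    (innerDensity p1 p1 u + innerDensity p2 p0 u) with hD'def
  have hI : ∀ f g : Lp ℂ 2 oneMeasure, Integrable (innerDensity f g) := fun f g =>
    integrable_innerDensity (Lp.memLp f) (Lp.memLp g)
  have hIi : ∀ (f g : Lp ℂ 2 oneMeasure) a b, IntervalIntegrable (innerDensity f g) volume a b :=
    fun f g a b => (hI f g).intervalIntegrable
  -- the energy of a window is translated by the boost
  have hwin : ∀ a b, a ≤ b → ∀ s : ℝ, |s| < r →
      inner ℝ (W a b (F s)) (W a b (F s)) = ∫ u in (a + s)..(b + s), G u := by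
    intro a b hab s hs
    rw [hW, inner_restrict_window _ _ hab, ← intervalIntegral.integral_comp_add_right]
    refine intervalIntegral.integral_congr_ae ?_
    have h1 : innerDensity (F s) (F s) =ᵐ[volume] _ := innerDensity_congr (hF s hs) (hF s hs)
    filter_upwards [h1] with u hu _
    rw [hu]
    rfl
  have hderiv : ∀ a b, a ≤ b → ∀ s : ℝ, |s| < r →
      HasDerivAt (fun s => ∫ u in (a + s)..(b + s), G u)
        (inner ℝ (W a b (F s)) (W a b (deriv F s)) +
          inner ℝ (W a b (deriv F s)) (W a b (F s))) s := by
    intro a b hab s hs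
    have h1 : HasDerivAt (fun s : ℝ => W a b (F s)) (W a b (deriv F s)) s :=
      (W a b).hasFDerivAt.comp_hasDerivAt s (hder s hs)
    refine (h1.inner ℝ h1).congr_of_eventuallyEq ?_
    have : ∀ᶠ t in 𝓝 s, |t| < r := (continuous_abs.tendsto s).eventually (Iio_mem_nhds hs)
    filter_upwards [this] with t ht
    exact (hwin a b hab t ht).symm
  have hG1 : ∀ a b, a < b → HasDerivAt (fun s => ∫ u in (a + s)..(b + s), G u)
      (∫ u in a..b, D u) 0 := by
    intro a b hab
    have := hderiv a b hab.le 0 hr0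
    rw [hW, inner_restrict_window _ _ hab.le, inner_restrict_window _ _ hab.le,
      ← intervalIntegral.integral_add (hIi _ _ _ _) (hIi _ _ _ _)] at this
    exact this
  -- The first derivative at `s` is computed in two ways: from `hG1` for the window already moved by
  -- `s`, and from `hderiv` at `s`. Uniqueness expresses the moved window integral of `D` through
  -- inner products, which can be differentiated again.
  have hDwin : ∀ a b, a < b → ∀ s : ℝ, |s| < r → ∫ u in (a + s)..(b + s), D u =
      inner ℝ (W a b (F s)) (W a b (deriv F s)) +
        inner ℝ (W a b (deriv F s)) (W a b (F s)) := by
    intro a b hab s hs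
    have h1 := hG1 (a + s) (b + s) (by linarith)
    have h2 := HasDerivAt.comp_const_add s 0 (by simpa using hderiv a b hab.le s hs)
    refine h1.unique (h2.congr_of_eventuallyEq (Eventually.of_forall fun t => ?_))
    simp only [add_assoc]
  have hG2 : ∀ a b, a < b → HasDerivAt (fun s => ∫ u in (a + s)..(b + s), D u)
      (∫ u in a..b, D' u) 0 := by
    intro a b hab
    have h0 : HasDerivAt (fun s : ℝ => W a b (F s)) (W a b p1) 0 :=
      (W a b).hasFDerivAt.comp_hasDerivAt 0 (hder 0 hr0)
    have h1 : HasDerivAt (fun s : ℝ => W a b (deriv F s)) (W a b p2) 0 :=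
      (W a b).hasFDerivAt.comp_hasDerivAt 0 (hder1 0 hr0)
    have h2 := (h0.inner ℝ h1).add (h1.inner ℝ h0)
    have hev : ∀ᶠ t in 𝓝 (0:ℝ), |t| < r :=
      (continuous_abs.tendsto 0).eventually (Iio_mem_nhds hr0)
    refine (h2.congr_of_eventuallyEq ?_).congr_deriv ?_
    · filter_upwards [hev] with t ht
      exact hDwin a b hab t ht
    · simp only [hW]
      simp only [inner_restrict_window _ _ hab.le]
      rw [← intervalIntegral.integral_add (hIi _ _ _ _) (hIi _ _ _ _),
        ← intervalIntegral.integral_add (hIi _ _ _ _) (hIi _ _ _ _),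
        ← intervalIntegral.integral_add ((hIi _ _ _ _).add (hIi _ _ _ _))
          ((hIi _ _ _ _).add (hIi _ _ _ _))]
  exact QubitRegister.exists_tameDensity (integrable_innerDensity hmem hmem)
    ((hI _ _).add (hI _ _)) (((hI _ _).add (hI _ _)).add ((hI _ _).add (hI _ _))) hG1 hG2

theorem div_one_sub_exp_pos {β u : ℝ} (hβ : 0 < β) (hu : u ≠ 0) :
    0 < u / (1 - Real.exp (-β * u)) := by
  rcases lt_or_gt_of_ne hu with h | h
  · refine div_pos_of_neg_of_neg h (sub_neg.2 (Real.one_lt_exp_iff.2 ?_))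
    nlinarith
  · refine div_pos h (sub_pos.2 (Real.exp_lt_one_iff.2 ?_))
    nlinarith

theorem norm_glue_sq {N : ℕ} {Q : Model N} (hβ : 0 < Q.β) (h : R3 → ℂ) (u : ℝ) (s : S2) :
    ‖glue Q h (u, s)‖ ^ 2 = u / (1 - Real.exp (-Q.β * u)) * |u| * ‖h (|u| • (s : R3))‖ ^ 2 := by
  by_cases hu : u = 0
  · simp [glue, hu]
  have hpos := div_one_sub_exp_pos hβ hu
  unfold glue
  rw [norm_mul, mul_pow, Complex.norm_real, norm_mul, mul_pow, Real.norm_eq_abs,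
    Real.norm_eq_abs, sq_abs, sq_abs, Real.sq_sqrt hpos.le, Real.sq_sqrt (abs_nonneg _)]
  congr 2
  by_cases h0 : 0 ≤ u
  · simp only [h0, if_true, abs_of_nonneg h0]
  · simp only [h0, if_false, abs_of_neg (not_le.1 h0), norm_mul, RCLike.norm_conj]
    rw [mul_comm Complex.I, Complex.norm_exp_ofReal_mul_I, one_mul]

theorem innerDensity_glue {N : ℕ} {Q : Model N} (hβ : 0 < Q.β) (h : R3 → ℂ) (u : ℝ) :
    innerDensity (glue Q h) (glue Q h) u =
      u / (1 - Real.exp (-Q.β * u)) * |u| * angular h u := by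
  unfold innerDensity angular
  rw [← integral_const_mul]
  congr 1 with s
  rw [real_inner_self_eq_norm_sq, norm_glue_sq hβ]

/-- Two functions that are continuous on an open half line and agree almost everywhere there agree
everywhere. The point `0` is excluded: the explicit formula takes the value `0` there, whereas `G 0`
is the limit of the nearby values. -/
theorem Regular.exists_density {N : ℕ} {Q : Model N} {h : R3 → ℂ} (hβ : 0 < Q.β)
    (hreg : Regular Q h) (hcont : ContinuousOn (angular h) (Set.Ioi 0)) :
    ∃ G, TameDensity G ∧
      ∀ u, u ≠ 0 → G u = u / (1 - Real.exp (-Q.β * u)) * |u| * angular h u := by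
  obtain ⟨G, hG, hae⟩ := hreg.exists_tameDensity
  refine ⟨G, hG, ?_⟩
  have hae' : (fun u => u / (1 - Real.exp (-Q.β * u)) * |u| * angular h u) =ᵐ[volume] G := by
    filter_upwards [hae] with u hu
    rw [← hu, innerDensity_glue hβ]
  have hw : ContinuousOn (fun u : ℝ => u / (1 - Real.exp (-Q.β * u)) * |u|) {0}ᶜ := by
    refine ContinuousOn.mul (ContinuousOn.div continuousOn_id (by fun_prop) fun u hu h0 => ?_)
      continuous_abs.continuousOn
    have := div_one_sub_exp_pos hβ hu
    rw [h0, div_zero] at this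
    exact lt_irrefl _ this
  have hang : ∀ u, angular h (-u) = angular h u := fun u => by simp [angular]
  have hcont' : ContinuousOn (angular h) (Set.Iio 0) := by
    have := hcont.comp (s := Set.Iio 0) continuous_neg.continuousOn
      fun u hu => neg_pos.2 (show u < 0 from hu)
    exact this.congr fun u _ => (hang u).symm
  intro u hu
  rcases lt_or_gt_of_ne hu with hlt | hgt
  · exact (Measure.eqOn_open_of_ae_eq (μ := (volume : Measure ℝ)) (ae_restrict_of_ae hae') isOpen_Iio
      ((hw.mono fun v hv => ne_of_lt hv).mul hcont') hG.continuous.continuousOn hlt).symm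
  · exact (Measure.eqOn_open_of_ae_eq (μ := (volume : Measure ℝ)) (ae_restrict_of_ae hae') isOpen_Ioi
      ((hw.mono fun v hv => ne_of_gt hv).mul hcont) hG.continuous.continuousOn hgt).symm

/-! ### Polar coordinates -/

/-- The radial measure `volumeIoiPow 0` has density `1`, so it is Lebesgue measure on the open half
line. -/
theorem sigmaFinite_comap_Ioi :
    SigmaFinite (Measure.comap (Subtype.val : Set.Ioi (0:ℝ) → ℝ) volume) := by
  have h : Measure.volumeIoiPow 0 = Measure.comap (Subtype.val : Set.Ioi (0:ℝ) → ℝ) volume := by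
    simp only [Measure.volumeIoiPow, pow_zero, ENNReal.ofReal_one]
    exact withDensity_one
  rw [← h]
  infer_instance

attribute [instance] sigmaFinite_comap_Ioi

/-- The polar coordinates `(Σ, u) ↦ (u, Σ)` on the open half line. -/
theorem measurePreserving_sphere_Ioi : MeasurePreserving
    (fun y : S2 × Set.Ioi (0:ℝ) => ((y.2 : ℝ), y.1))
    (sphereMeasure.prod (Measure.comap Subtype.val volume))
    (oneMeasure.restrict (Set.Ioi 0 ×ˢ Set.univ)) := by
  have h1 : MeasurePreserving (Subtype.val : Set.Ioi (0:ℝ) → ℝ) (Measure.comap Subtype.val volume)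
      (volume.restrict (Set.Ioi 0)) :=
    ⟨measurable_subtype_coe, map_comap_subtype_coe measurableSet_Ioi _⟩
  have h2 := h1.prod (MeasurePreserving.id sphereMeasure)
  have h3 := h2.comp (Measure.measurePreserving_swap (μ := sphereMeasure)
    (ν := Measure.comap (Subtype.val : Set.Ioi (0:ℝ) → ℝ) volume))
  have h4 : oneMeasure.restrict (Set.Ioi 0 ×ˢ Set.univ) =
      (volume.restrict (Set.Ioi (0:ℝ))).prod sphereMeasure := by
    conv_rhs => rw [← Measure.restrict_univ (μ := sphereMeasure)]
    rw [Measure.prod_restrict]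
    rfl
  rw [h4]
  exact h3

theorem measurableEmbedding_sphere_Ioi : MeasurableEmbedding
    (fun y : S2 × Set.Ioi (0:ℝ) => ((y.2 : ℝ), y.1)) :=
  ((MeasurableEmbedding.subtype_coe measurableSet_Ioi).prodMap MeasurableEmbedding.id).comp
    MeasurableEquiv.prodComm.measurableEmbedding

theorem sphere_prod_volumeIoiPow : sphereMeasure.prod (Measure.volumeIoiPow 2) =
    (sphereMeasure.prod (Measure.comap Subtype.val volume)).withDensity
      (fun y : S2 × Set.Ioi (0:ℝ) => ENNReal.ofReal (y.2.1 ^ 2)) := by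
  rw [Measure.volumeIoiPow, prod_withDensity_right]
  fun_prop

theorem polar_comp_homeomorph (f : R3 → ℝ) :
    (fun y : S2 × Set.Ioi (0:ℝ) => f ((y.2 : ℝ) • (y.1 : R3))) ∘ homeomorphUnitSphereProd R3 =
      f ∘ Subtype.val := by
  funext x
  have : ‖(x : R3)‖ ≠ 0 := norm_ne_zero_iff.2 x.2
  simp [homeomorphUnitSphereProd_apply_fst_coe, smul_smul, this]

theorem measurePreserving_polar : MeasurePreserving (homeomorphUnitSphereProd R3)
    ((volume : Measure R3).comap Subtype.val) (sphereMeasure.prod (Measure.volumeIoiPow 2)) := by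
  have := (volume : Measure R3).measurePreserving_homeomorphUnitSphereProd
  simp only [finrank_euclideanSpace, Fintype.card_fin] at this
  exact this


/-- The origin is a null set; off it the homeomorphism onto sphere times half line carries Lebesgue
measure to the product of the surface measure and `r² dr`. -/
theorem integrable_polar_iff (f : R3 → ℝ) : Integrable f ↔
    IntegrableOn (fun x : X => x.1 ^ 2 * f (x.1 • (x.2 : R3))) (Set.Ioi 0 ×ˢ Set.univ)
      oneMeasure := by
  have h1 := measurePreserving_polar.integrable_comp_emb (Homeomorph.measurableEmbedding _)
    (g := fun y : S2 × Set.Ioi (0:ℝ) => f ((y.2 : ℝ) • (y.1 : R3)))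
  rw [polar_comp_homeomorph, ← integrableOn_iff_comap_subtypeVal (by measurability), IntegrableOn,
    restrict_compl_singleton, sphere_prod_volumeIoiPow,
    integrable_withDensity_iff_integrable_smul' (by fun_prop) (by simp)] at h1
  have h2 := measurePreserving_sphere_Ioi.integrable_comp_emb measurableEmbedding_sphere_Ioi
    (g := fun x : X => x.1 ^ 2 * f (x.1 • (x.2 : R3)))
  rw [IntegrableOn, ← h2, h1]
  refine integrable_congr (ae_of_all _ fun y => ?_)
  simp only [Function.comp, smul_eq_mul, ENNReal.toReal_ofReal (sq_nonneg _)]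

theorem integral_polar (f : R3 → ℝ) : ∫ k, f k =
    ∫ x in Set.Ioi (0:ℝ) ×ˢ Set.univ, x.1 ^ 2 * f (x.1 • (x.2 : R3)) ∂oneMeasure := by
  have h1 := measurePreserving_polar.integral_comp (Homeomorph.measurableEmbedding _)
    (fun y : S2 × Set.Ioi (0:ℝ) => f ((y.2 : ℝ) • (y.1 : R3)))
  have h2 := measurePreserving_sphere_Ioi.integral_comp measurableEmbedding_sphere_Ioi
    (fun x : X => x.1 ^ 2 * f (x.1 • (x.2 : R3)))
  have h3 : ∫ x, (f ∘ Subtype.val) x ∂((volume : Measure R3).comap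
      (Subtype.val : ({0}ᶜ : Set R3) → R3)) = ∫ k, f k := by
    have := integral_subtype_comap (μ := (volume : Measure R3))
      (measurableSet_singleton (0 : R3)).compl f
    rwa [restrict_compl_singleton] at this
  rw [← h2, ← h3, ← polar_comp_homeomorph]
  refine h1.trans ?_
  rw [sphere_prod_volumeIoiPow,
    integral_withDensity_eq_integral_toReal_smul (by fun_prop) (by simp)]
  refine integral_congr_ae (ae_of_all _ fun y => ?_)
  simp only [smul_eq_mul, ENNReal.toReal_ofReal (sq_nonneg _)]

/-! ### Consequences for the explicit quantities -/

/-- `G` is the continuous version of the energy density of the glued form factor. -/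
structure IsEnergyDensity {N : ℕ} (Q : Model N) (h : R3 → ℂ) (G : ℝ → ℝ) : Prop where
  tame : TameDensity G
  eq : ∀ u, u ≠ 0 → G u = u / (1 - Real.exp (-Q.β * u)) * |u| * angular h u

section

variable {N : ℕ} {Q : Model N} {h : R3 → ℂ} {G : ℝ → ℝ}

theorem angular_neg (h : R3 → ℂ) (u : ℝ) : angular h (-u) = angular h u := by simp [angular]

theorem one_sub_exp_ne {β u : ℝ} (hβ : 0 < β) (hu : u ≠ 0) : 1 - Real.exp (-β * u) ≠ 0 := by
  intro h0
  have := div_one_sub_exp_pos hβ hu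
  rw [h0, div_zero] at this
  exact lt_irrefl _ this

/-- Detailed balance. -/
theorem IsEnergyDensity.neg_eq (hG : IsEnergyDensity Q h G) (hβ : 0 < Q.β) (u : ℝ) :
    G (-u) = Real.exp (-Q.β * u) * G u := by
  by_cases hu : u = 0
  · simp [hu]
  have h1 := one_sub_exp_ne hβ hu
  have h2 := one_sub_exp_ne hβ (neg_ne_zero.2 hu)
  rw [hG.eq u hu, hG.eq (-u) (neg_ne_zero.2 hu), angular_neg, abs_neg]
  have h3 : Real.exp (-Q.β * -u) * Real.exp (-Q.β * u) = 1 := by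
    rw [← Real.exp_add]; simp
  have h4 : (1 - Real.exp (-Q.β * -u)) * Real.exp (-Q.β * u) = -(1 - Real.exp (-Q.β * u)) := by
    linear_combination -h3
  have : -u / (1 - Real.exp (-Q.β * -u)) =
      Real.exp (-Q.β * u) * (u / (1 - Real.exp (-Q.β * u))) := by
    generalize Real.exp (-Q.β * -u) = E' at *
    generalize Real.exp (-Q.β * u) = E at *
    field_simp
    linear_combination -h4
  rw [this]
  ring

/-- By detailed balance `G(t) - G(-t) = (1 - exp(-β t)) G(t)`, which cancels the thermal
denominator. This is why `a` does not depend on the temperature. -/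
theorem IsEnergyDensity.oddQuot_zero (hG : IsEnergyDensity Q h G) (hβ : 0 < Q.β) {t : ℝ}
    (ht : 0 < t) : oddQuot G 0 t = t * angular h t := by
  have h1 := one_sub_exp_ne hβ ht.ne'
  rw [oddQuot, zero_add, zero_sub, hG.neg_eq hβ, hG.eq t ht.ne', abs_of_pos ht]
  generalize Real.exp (-Q.β * t) = E at *
  field_simp

/-- For `u > 0` one has `u 𝒢(u) = ((1 - exp(-β u)) / u) G(u)`, and the first factor tends to the
derivative `β`. -/
theorem IsEnergyDensity.tendsto_mul_angular (hG : IsEnergyDensity Q h G) (hβ : 0 < Q.β) :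
    Tendsto (fun u : ℝ => u * angular h u) (𝓝[>] 0) (𝓝 (Q.β * G 0)) := by
  have h1 : Tendsto G (𝓝[>] 0) (𝓝 (G 0)) :=
    (hG.tame.continuous.tendsto 0).mono_left nhdsWithin_le_nhds
  have h2 : HasDerivAt (fun u : ℝ => -Real.exp (-Q.β * u)) Q.β 0 := by
    have h := ((hasDerivAt_id (0:ℝ)).const_mul (-Q.β)).exp.neg
    simpa [Pi.neg_def] using h
  have h3 : Tendsto (fun u : ℝ => (1 - Real.exp (-Q.β * u)) / u) (𝓝[>] 0) (𝓝 Q.β) := by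
    have h := (hasDerivAt_iff_tendsto_slope.1 h2).mono_left
      (nhdsWithin_mono 0 (fun u (hu : 0 < u) => hu.ne'))
    refine h.congr fun u => ?_
    rw [slope_def_field]
    simp
    ring
  refine (h3.mul h1).congr' ?_
  filter_upwards [self_mem_nhdsWithin] with u hu
  have hu : 0 < u := hu
  have h4 := one_sub_exp_ne hβ hu.ne'
  rw [hG.eq u hu.ne', abs_of_pos hu]
  generalize Real.exp (-Q.β * u) = E at *
  field_simp

theorem norm_sq_div_polar (hβ : 0 < Q.β) (h : R3 → ℂ) (x : X) (hx : 0 < x.1) :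
    x.1 ^ 2 * (‖h (x.1 • (x.2 : R3))‖ ^ 2 / ‖x.1 • (x.2 : R3)‖) =
      (1 - Real.exp (-Q.β * x.1)) / x.1 * ‖glue Q h x‖ ^ 2 := by
  have h4 := one_sub_exp_ne hβ hx.ne'
  have hs : ‖(x.2 : R3)‖ = 1 := by simp
  have := norm_glue_sq hβ h x.1 x.2
  rw [Prod.mk.eta, abs_of_pos hx] at this
  rw [this, norm_smul, hs, Real.norm_of_nonneg hx.le]
  generalize Real.exp (-Q.β * x.1) = E at *
  field_simp

/-- In polar coordinates the integrand is `‖glue Q h‖²` times `(1 - exp(-β u)) / u`, and the latter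
is at most `β`. -/
theorem integrable_invOmega (hβ : 0 < Q.β) (hmem : MemLp (glue Q h) 2 oneMeasure) :
    Integrable fun k : R3 => ‖h k‖ ^ 2 / ‖k‖ := by
  have hsq : Integrable (fun x => ‖glue Q h x‖ ^ 2) oneMeasure :=
    (memLp_two_iff_integrable_sq_norm hmem.1).1 hmem
  have hset : MeasurableSet (Set.Ioi (0:ℝ) ×ˢ (Set.univ : Set S2)) :=
    measurableSet_Ioi.prod MeasurableSet.univ
  rw [integrable_polar_iff]
  refine IntegrableOn.congr_fun (f := fun x : X =>
    (1 - Real.exp (-Q.β * x.1)) / x.1 * ‖glue Q h x‖ ^ 2) ?_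
    (fun x hx => (norm_sq_div_polar hβ h x hx.1).symm) hset
  refine hsq.integrableOn.bdd_mul (c := Q.β) (Measurable.aestronglyMeasurable (by fun_prop)) ?_
  refine (ae_restrict_iff' hset).2 (ae_of_all _ fun x hx => ?_)
  have hx : 0 < x.1 := hx.1
  have h1 := Real.add_one_le_exp (-Q.β * x.1)
  have h2 : Real.exp (-Q.β * x.1) ≤ 1 := Real.exp_le_one_iff.2 (by nlinarith)
  rw [Real.norm_of_nonneg (div_nonneg (by linarith) hx.le), div_le_iff₀ hx]
  linarith

/-- The Jacobian `t²` against `1 / ‖k‖` leaves the factor `t` of `IsEnergyDensity.oddQuot_zero`.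
This identifies the principal value at `0` with `⟨g, ω⁻¹ g⟩`. -/
theorem IsEnergyDensity.integral_oddQuot_zero (hG : IsEnergyDensity Q h G) (hβ : 0 < Q.β)
    (hmem : MemLp (glue Q h) 2 oneMeasure) :
    ∫ t in Set.Ioi (0:ℝ), oddQuot G 0 t = ∫ k : R3, ‖h k‖ ^ 2 / ‖k‖ := by
  have hI := (integrable_polar_iff _).1 (integrable_invOmega hβ hmem)
  rw [integral_polar]
  have := setIntegral_prod (μ := (volume : Measure ℝ)) (ν := sphereMeasure) _ hI
  refine Eq.trans ?_ this.symm
  refine setIntegral_congr_fun measurableSet_Ioi fun t ht => ?_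
  have ht : 0 < t := ht
  simp only [Measure.restrict_univ]
  rw [hG.oddQuot_zero hβ ht, angular, ← integral_const_mul]
  congr 1 with s
  have hs : ‖(s : R3)‖ = 1 := by simp
  rw [norm_smul, hs, Real.norm_of_nonneg ht.le, abs_of_pos ht]
  field_simp

theorem IsEnergyDensity.gamma_eq (hG : IsEnergyDensity Q Q.g1 G) (hβ : 0 < Q.β) :
    gammaPlus Q = Q.β * G 0 :=
  (hG.tendsto_mul_angular hβ).limUnder_eq

theorem IsEnergyDensity.eq_two_mul (hG : IsEnergyDensity Q h G) {b : ℝ} (hb : 0 < b) :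
    G (2 * b) = 4 * b ^ 2 * angular h (2 * b) / (1 - Real.exp (-(2 * Q.β * b))) := by
  rw [hG.eq (2 * b) (by positivity), abs_of_pos (by positivity),
    show -Q.β * (2 * b) = -(2 * Q.β * b) by ring]
  ring

theorem coth_eq {x : ℝ} (hx : x ≠ 0) :
    coth x = (1 + Real.exp (-(2 * x))) / (1 - Real.exp (-(2 * x))) := by
  have h1 : Real.exp (-(2 * x)) = (Real.exp (-x)) ^ 2 := by
    rw [← Real.exp_nat_mul]; congr 1; push_cast; ring
  have h2 : Real.exp x * Real.exp (-x) = 1 := by rw [← Real.exp_add]; simp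
  have h3 : Real.sinh x ≠ 0 := by rwa [Ne, Real.sinh_eq_zero]
  have h4 : 1 - Real.exp (-(2 * x)) ≠ 0 := by
    have := one_sub_exp_ne (β := 2) two_pos hx
    rwa [neg_mul] at this
  rw [coth, div_eq_div_iff h3 h4, Real.cosh_eq, Real.sinh_eq, h1]
  linear_combination (-Real.exp (-x)) * h2

/-- Detailed balance gives `G(2u) + G(-2u) = (1 + exp(-2β u)) G(2u)` for `u > 0`, and the quotient
of `1 ± exp(-2β u)` is the hyperbolic cotangent. Both sides are even in `u`. -/
theorem IsEnergyDensity.add_neg_eq (hG : IsEnergyDensity Q h G) (hβ : 0 < Q.β) {u : ℝ}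
    (hu : u ≠ 0) :
    G (2 * u) + G (-(2 * u)) = 4 * (u ^ 2 * angular h (2 * u) * coth (Q.β * |u|)) := by
  wlog hpos : 0 < u generalizing u
  · have := this (neg_ne_zero.2 hu) (neg_pos.2 (lt_of_le_of_ne (not_lt.1 hpos) hu))
    rw [mul_neg, neg_neg, angular_neg, abs_neg, neg_sq] at this
    rw [← this, add_comm]
  rw [hG.neg_eq hβ, hG.eq_two_mul hpos, coth_eq (by positivity), abs_of_pos hpos,
    show 2 * (Q.β * u) = 2 * Q.β * u by ring, show -Q.β * (2 * u) = -(2 * Q.β * u) by ring]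
  ring

theorem oddQuot_neg (G : ℝ → ℝ) (c t : ℝ) :
    oddQuot (fun u => G (-u)) c t = -oddQuot G (-c) t := by
  simp only [oddQuot, neg_sub, neg_add_rev]
  rw [← neg_div, neg_sub]
  congr 3 <;> ring

theorem integral_oddQuot_neg (G : ℝ → ℝ) (c : ℝ) :
    ∫ t in Set.Ioi (0:ℝ), oddQuot (fun u => G (-u)) c t =
      -∫ t in Set.Ioi (0:ℝ), oddQuot G (-c) t := by
  rw [← integral_neg]
  simp only [oddQuot_neg]

/-- Off `0` the kernel is a quarter of `G(2u) + G(-2u)`, hence almost everywhere equal to a tame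
density. Rescaling `t` by `2` splits its odd quotient at `b` into those of `G` at `2b` and `-2b`. -/
theorem IsEnergyDensity.hasPV_kernel (hG : IsEnergyDensity Q Q.g2 G) (hβ : 0 < Q.β) (b : ℝ) :
    HasPV (kernel2 Q) b (((∫ t in Set.Ioi (0:ℝ), oddQuot G (2 * b) t) -
      ∫ t in Set.Ioi (0:ℝ), oddQuot G (-(2 * b)) t) / 4) := by
  obtain ⟨K, hK⟩ := hG.tame.lipschitz
  obtain ⟨M, hM⟩ := hG.tame.bounded
  have hK0 : 0 ≤ K := by simpa using (abs_nonneg _).trans (hK 1 0)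
  have hint2 : Integrable fun u => G (2 * u) := hG.tame.integrable.comp_mul_left' two_ne_zero
  have hintn : Integrable fun u => G (-(2 * u)) := hint2.comp_neg.congr
    (ae_of_all _ fun u => by simp)
  have htame : TameDensity fun u => (G (2 * u) + G (-(2 * u))) / 4 := by
    refine ⟨(hint2.add hintn).div_const 4, ⟨K, fun x y => ?_⟩, ⟨M, fun x => ?_⟩⟩
    · have h1 := hK (2 * x) (2 * y)
      have h2 := hK (-(2 * x)) (-(2 * y))
      rw [← mul_sub, abs_mul, abs_two] at h1
      rw [show -(2 * x) - -(2 * y) = -2 * (x - y) by ring, abs_mul] at h2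
      norm_num at h2
      rw [abs_le] at h1 h2 ⊢
      constructor <;> linarith
    · have h1 := hM (2 * x)
      have h2 := hM (-(2 * x))
      have h0 := (abs_nonneg _).trans h1
      rw [abs_le] at h1 h2 ⊢
      constructor <;> linarith
  have hpv := htame.hasPV b
  have hae : (fun u => (G (2 * u) + G (-(2 * u))) / 4) =ᵐ[volume] kernel2 Q := by
    have : ∀ᵐ u : ℝ, u ≠ 0 := by simp [ae_iff]
    filter_upwards [this] with u hu
    rw [hG.add_neg_eq hβ hu, kernel2]
    ring
  convert hpv.congr hae using 1
  have hpt : ∀ t, oddQuot (fun u => (G (2 * u) + G (-(2 * u))) / 4) b t =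
      (oddQuot G (2 * b) (2 * t) - oddQuot G (-(2 * b)) (2 * t)) / 2 := by
    intro t
    simp only [oddQuot]
    rw [show 2 * (b + t) = 2 * b + 2 * t by ring, show 2 * (b - t) = 2 * b - 2 * t by ring,
      show -(2 * b + 2 * t) = -(2 * b) - 2 * t by ring,
      show -(2 * b - 2 * t) = -(2 * b) + 2 * t by ring]
    by_cases ht : t = 0
    · simp [ht]
    field_simp
    ring
  simp only [hpt]
  have h1 := hG.tame.integrableOn_oddQuot (2 * b)
  have h2 := hG.tame.integrableOn_oddQuot (-(2 * b))
  have := integral_comp_mul_left_Ioi (fun t => oddQuot G (2 * b) t - oddQuot G (-(2 * b)) t) 0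
    two_pos
  rw [integral_div, this, mul_zero, integral_sub h1 h2, smul_eq_mul]
  ring

end

/-! ### Vectors with at most two particles -/

section Components

variable {N : ℕ}

theorem vec_ext {ψ χ : Vec N} (h : ∀ n, comp ψ n =ᵐ[nMeasure n] comp χ n) : ψ = χ := by
  refine Subtype.ext (Subtype.ext (funext fun n => ?_))
  exact Lp.ext (h n)

theorem comp_add (ψ χ : Vec N) (n : ℕ) :
    comp (ψ + χ) n =ᵐ[nMeasure n] fun x => comp ψ n x + comp χ n x :=
  Lp.coeFn_add _ _

theorem comp_sub (ψ χ : Vec N) (n : ℕ) :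
    comp (ψ - χ) n =ᵐ[nMeasure n] fun x => comp ψ n x - comp χ n x :=
  Lp.coeFn_sub _ _

theorem comp_smul (c : ℂ) (ψ : Vec N) (n : ℕ) :
    comp (c • ψ) n =ᵐ[nMeasure n] fun x => c • comp ψ n x :=
  Lp.coeFn_smul _ _

theorem memLp_comp (ψ : Vec N) (n : ℕ) : MemLp (comp ψ n) 2 (nMeasure n) := Lp.memLp _

/-- The family of components of a vector with at most two particles. -/
def fam (w : Doubled N) (F : X → Doubled N) (H : X → X → Doubled N) :
    (n : ℕ) → (Fin n → X) → Doubled N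
  | 0, _ => w
  | 1, x => F (x 0)
  | 2, x => H (x 0) (x 1)
  | _ + 3, _ => 0

/-- The vector `ψ` has the components `C`. -/
def HasComps (ψ : Vec N) (C : (n : ℕ) → (Fin n → X) → Doubled N) : Prop :=
  ∀ n, comp ψ n =ᵐ[nMeasure n] C n

theorem measurePreserving_one :
    MeasurePreserving (fun x : Fin 1 → X => x 0) (nMeasure 1) oneMeasure :=
  measurePreserving_funUnique oneMeasure (Fin 1)

theorem measurePreserving_one_symm :
    MeasurePreserving (fun (x : X) (_ : Fin 1) => x) oneMeasure (nMeasure 1) :=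
  (measurePreserving_funUnique oneMeasure (Fin 1)).symm

theorem memLp_one_iff {E : Type*} [NormedAddCommGroup E] {F : X → E} :
    MemLp (fun x : Fin 1 → X => F (x 0)) 2 (nMeasure 1) ↔ MemLp F 2 oneMeasure :=
  ⟨fun h => h.comp_measurePreserving measurePreserving_one_symm,
    fun h => h.comp_measurePreserving measurePreserving_one⟩

theorem ae_one_iff {p : X → Prop} : (∀ᵐ x ∂(nMeasure 1), p (x 0)) ↔ ∀ᵐ y ∂oneMeasure, p y :=
  ⟨fun h => measurePreserving_one_symm.quasiMeasurePreserving.ae h,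
    fun h => measurePreserving_one.quasiMeasurePreserving.ae h⟩

theorem nMeasure_zero : nMeasure 0 = Measure.dirac (fun i => Fin.elim0 i) :=
  Measure.pi_of_empty _ _

instance (n : ℕ) : SigmaFinite (nMeasure n) :=
  inferInstanceAs (SigmaFinite (Measure.pi fun _ => oneMeasure))

instance : IsProbabilityMeasure (nMeasure 0) := by
  rw [nMeasure_zero]; infer_instance

theorem ae_zero_iff {p : (Fin 0 → X) → Prop} :
    (∀ᵐ x ∂(nMeasure 0), p x) ↔ p (fun i => Fin.elim0 i) := by
  constructor
  · intro h
    obtain ⟨x, hx⟩ := h.exists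
    rwa [Subsingleton.elim x (fun i => Fin.elim0 i)] at hx
  · intro h
    refine ae_of_all _ fun x => ?_
    rwa [Subsingleton.elim x (fun i => Fin.elim0 i)]

theorem exists_hasComps (w : Doubled N) {F : X → Doubled N} {H : X → X → Doubled N}
    (hF : MemLp F 2 oneMeasure)
    (hH : MemLp (fun x : Fin 2 → X => H (x 0) (x 1)) 2 (nMeasure 2))
    (hsym : ∀ a b, H a b = H b a) : ∃ ψ : Vec N, HasComps ψ (fam w F H) := by
  have hmem : ∀ n, MemLp (fam w F H n) 2 (nMeasure n) := by
    intro n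
    match n with
    | 0 => exact memLp_const w
    | 1 => exact memLp_one_iff.2 hF
    | 2 => exact hH
    | n + 3 => exact MemLp.zero'
  have hperm : ∀ n (π : Equiv.Perm (Fin n)) (x : Fin n → X),
      fam w F H n (fun i => x (π i)) = fam w F H n x := by
    intro n π x
    match n with
    | 0 => rfl
    | 1 => simp only [fam, Subsingleton.elim (π 0) 0]
    | 2 =>
      simp only [fam]
      have h01 : π 0 ≠ π 1 := fun h => by simpa using π.injective h
      generalize π 0 = i at *
      generalize π 1 = j at *
      fin_cases i <;> fin_cases j <;> simp at h01 ⊢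
      exact hsym _ _
    | n + 3 => rfl
  -- Only the sectors `0`, `1`, `2` are nonzero, so the sum of squared norms is finite.
  have hmemℓ : Memℓp (fun n => (hmem n).toLp : ∀ n, Sector N n) 2 := by
    refine memℓp_gen (summable_of_hasFiniteSupport (Set.Finite.subset (Set.finite_Iio 3) ?_))
    intro n hn
    by_contra h3
    obtain ⟨m, rfl⟩ : ∃ m, n = m + 3 := ⟨n - 3, by simp at h3; omega⟩
    refine hn ?_
    have : (hmem (m + 3)).toLp = 0 := by
      rw [← MemLp.toLp_zero MemLp.zero']
      rfl
    simp [this]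
  refine ⟨⟨⟨_, hmemℓ⟩, fun n π => ?_⟩, fun n => (hmem n).coeFn_toLp⟩
  change Lp.compMeasurePreserving _ (measurePreserving_perm π) ((hmem n).toLp) = (hmem n).toLp
  rw [Lp.toLp_compMeasurePreserving]
  congr 1
  funext x
  exact hperm n π x

theorem HasComps.ext {ψ χ : Vec N} {C : (n : ℕ) → (Fin n → X) → Doubled N} (h : HasComps ψ C)
    (h' : HasComps χ C) : ψ = χ :=
  vec_ext fun n => (h n).trans (h' n).symm

theorem HasComps.congr {ψ : Vec N} {C C' : (n : ℕ) → (Fin n → X) → Doubled N}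
    (h : HasComps ψ C) (hC : ∀ n, C n =ᵐ[nMeasure n] C' n) : HasComps ψ C' :=
  fun n => (h n).trans (hC n)

theorem fam_congr {w : Doubled N} {F F' : X → Doubled N} (H : X → X → Doubled N)
    (hF : F =ᵐ[oneMeasure] F') (n : ℕ) : fam w F H n =ᵐ[nMeasure n] fam w F' H n := by
  match n with
  | 0 => rfl
  | 1 => exact ae_one_iff.2 hF
  | 2 => rfl
  | n + 3 => rfl

theorem HasComps.memLp_one {ψ : Vec N} {w : Doubled N} {F : X → Doubled N}
    {H : X → X → Doubled N} (h : HasComps ψ (fam w F H)) : MemLp F 2 oneMeasure :=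
  memLp_one_iff.1 ((memLp_congr_ae (h 1)).1 (memLp_comp ψ 1))

theorem HasComps.memLp_two {ψ : Vec N} {w : Doubled N} {F : X → Doubled N}
    {H : X → X → Doubled N} (h : HasComps ψ (fam w F H)) :
    MemLp (fun x : Fin 2 → X => H (x 0) (x 1)) 2 (nMeasure 2) :=
  (memLp_congr_ae (h 2)).1 (memLp_comp ψ 2)

theorem HasComps.smul {ψ : Vec N} {w : Doubled N} {F : X → Doubled N}
    {H : X → X → Doubled N} (h : HasComps ψ (fam w F H)) (c : ℂ) :
    HasComps (c • ψ) (fam (c • w) (fun x => c • F x) (fun a b => c • H a b)) := by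
  intro n
  filter_upwards [comp_smul c ψ n, h n] with x h1 h2
  rw [h1, h2]
  match n with
  | 0 => rfl
  | 1 => rfl
  | 2 => rfl
  | n + 3 => exact smul_zero c

theorem HasComps.add {ψ ψ' : Vec N} {w w' : Doubled N} {F F' : X → Doubled N}
    {H H' : X → X → Doubled N} (h : HasComps ψ (fam w F H)) (h' : HasComps ψ' (fam w' F' H')) :
    HasComps (ψ + ψ') (fam (w + w') (fun x => F x + F' x) (fun a b => H a b + H' a b)) := by
  intro n
  filter_upwards [comp_add ψ ψ' n, h n, h' n] with x h1 h2 h3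
  rw [h1, h2, h3]
  match n with
  | 0 => rfl
  | 1 => rfl
  | 2 => rfl
  | n + 3 => exact add_zero 0

theorem HasComps.sub {ψ ψ' : Vec N} {w w' : Doubled N} {F F' : X → Doubled N}
    {H H' : X → X → Doubled N} (h : HasComps ψ (fam w F H)) (h' : HasComps ψ' (fam w' F' H')) :
    HasComps (ψ - ψ') (fam (w - w') (fun x => F x - F' x) (fun a b => H a b - H' a b)) := by
  intro n
  filter_upwards [comp_sub ψ ψ' n, h n, h' n] with x h1 h2 h3
  rw [h1, h2, h3]
  match n with
  | 0 => rfl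
  | 1 => rfl
  | 2 => rfl
  | n + 3 => exact sub_zero 0

/-- Existence of the vacuum sector embedding. -/
theorem exists_vacuum (w : Doubled N) : ∃ ψ : Vec N, HasComps ψ (fam w 0 0) :=
  exists_hasComps w MemLp.zero' MemLp.zero' fun _ _ => rfl

/-- The embedding `w ↦ w ⊗ Ω`. -/
noncomputable def vacuum : Doubled N →ₗ[ℂ] Vec N where
  toFun w := (exists_vacuum w).choose
  map_add' w w' := by
    have h := (exists_vacuum w).choose_spec.add (exists_vacuum w').choose_spec
    refine (exists_vacuum (w + w')).choose_spec.ext (h.congr fun n => ?_)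
    simp only [Pi.zero_apply, add_zero]
    rfl
  map_smul' c w := by
    have h := (exists_vacuum w).choose_spec.smul c
    refine (exists_vacuum (c • w)).choose_spec.ext (h.congr fun n => ?_)
    simp only [Pi.zero_apply, smul_zero]
    rfl

theorem hasComps_vacuum (w : Doubled N) : HasComps (vacuum w) (fam w 0 0) :=
  (exists_vacuum w).choose_spec

theorem continuous_vacuum : Continuous (vacuum : Doubled N →ₗ[ℂ] Vec N) :=
  LinearMap.continuous_of_finiteDimensional _

/-! ### Products over particles -/

theorem quasiMeasurePreserving_succAbove {n : ℕ} (i : Fin (n + 1)) :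
    Measure.QuasiMeasurePreserving (fun (x : Fin (n + 1) → X) (k : Fin n) => x (i.succAbove k))
      (nMeasure (n + 1)) (nMeasure n) := by
  have h1 := (measurePreserving_piFinSuccAbove (α := fun _ : Fin (n + 1) => X)
    (fun _ => oneMeasure) i).quasiMeasurePreserving
  exact Measure.quasiMeasurePreserving_snd.comp h1

/-- Fubini in the form needed for annihilation operators: an almost everywhere identity of
`(n+1)`-particle components may be used under the integral over one particle. -/
theorem ae_ae_cons {n : ℕ} {p : (Fin (n + 1) → X) → Prop}
    (h : ∀ᵐ z ∂(nMeasure (n + 1)), p z) :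
    ∀ᵐ x ∂(nMeasure n), ∀ᵐ y ∂oneMeasure, p (Fin.cons y x) := by
  have h1 := ((measurePreserving_piFinSuccAbove (α := fun _ : Fin (n + 1) => X)
    (fun _ => oneMeasure) 0).symm).quasiMeasurePreserving
  have h2 := h1.ae h
  have h3 := (Measure.measurePreserving_swap (μ := nMeasure n)
    (ν := oneMeasure)).quasiMeasurePreserving.ae h2
  have h4 := Measure.ae_ae_of_ae_prod h3
  filter_upwards [h4] with x hx
  filter_upwards [hx] with y hy
  simpa [MeasurableEquiv.piFinSuccAbove, Fin.consEquiv] using hy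

theorem memLp_two_mul {E : Type*} [NormedAddCommGroup E] [NormedSpace ℂ E] {f : X → ℂ}
    {F : X → E} (hf : MemLp f 2 oneMeasure) (hF : MemLp F 2 oneMeasure) :
    MemLp (fun x : Fin 2 → X => f (x 0) • F (x 1)) 2 (nMeasure 2) := by
  have h0 : MemLp (fun z : X × X => f z.1 • F z.2) 2 (oneMeasure.prod oneMeasure) := by
    rw [memLp_two_iff_integrable_sq_norm]
    · simp only [norm_smul, mul_pow]
      exact ((memLp_two_iff_integrable_sq_norm hf.1).1 hf).mul_prod
        ((memLp_two_iff_integrable_sq_norm hF.1).1 hF)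
    · exact hf.1.comp_fst.smul hF.1.comp_snd
  exact h0.comp_measurePreserving (measurePreserving_finTwoArrow oneMeasure)

theorem memLp_two_swap {E : Type*} [NormedAddCommGroup E] {H : X → X → E}
    (h : MemLp (fun x : Fin 2 → X => H (x 0) (x 1)) 2 (nMeasure 2)) :
    MemLp (fun x : Fin 2 → X => H (x 1) (x 0)) 2 (nMeasure 2) := by
  simpa [Function.comp_def] using
    h.comp_measurePreserving (measurePreserving_perm (Equiv.swap (0 : Fin 2) 1))

theorem memLp_two_sym {E : Type*} [NormedAddCommGroup E] [NormedSpace ℂ E] {f : X → ℂ}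
    {F : X → E} (hf : MemLp f 2 oneMeasure) (hF : MemLp F 2 oneMeasure) :
    MemLp (fun x : Fin 2 → X => f (x 0) • F (x 1) + f (x 1) • F (x 0)) 2 (nMeasure 2) :=
  (memLp_two_mul hf hF).add (memLp_two_swap (H := fun a b => f a • F b) (memLp_two_mul hf hF))

end Components

section Operators

variable {N : ℕ}

/-! ### Existence of images under the operators of the model -/

/-- A matrix on the doubled space, as a continuous linear map. -/
noncomputable def actL (A : DoubledMatrix N) : Doubled N →L[ℂ] Doubled N :=
  LinearMap.toContinuousLinearMap (Matrix.toEuclideanLin A)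

theorem act_eq_actL (A : DoubledMatrix N) (v : Doubled N) : act A v = actL A v := rfl

theorem act_apply (A : DoubledMatrix N) (v : Doubled N) (p : Conf N × Conf N) :
    act A v p = ∑ q, A p q * v q := rfl

/-- The conjugation `J_S` of the doubled space. -/
noncomputable def conjS : Doubled N →L[ℝ] Doubled N :=
  LinearMap.toContinuousLinearMap
    { toFun := fun v => WithLp.toLp 2 fun p => (starRingEnd ℂ) (v (p.2, p.1))
      map_add' := fun v w => by ext p; simp
      map_smul' := fun c v => by ext p; simp }

theorem conjS_apply (v : Doubled N) (p : Conf N × Conf N) :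
    conjS v p = (starRingEnd ℂ) (v (p.2, p.1)) := rfl

theorem conjS_smul (c : ℂ) (v : Doubled N) : conjS (c • v) = (starRingEnd ℂ) c • conjS v := by
  ext p; simp [conjS_apply]

theorem conjS_conjS (v : Doubled N) : conjS (conjS v) = v := by
  ext p; simp [conjS_apply]

/-- The reflection `u ↦ -u` of the one-particle space. -/
def refl (x : X) : X := (-x.1, x.2)

theorem measurePreserving_refl : MeasurePreserving refl oneMeasure oneMeasure :=
  (Measure.measurePreserving_neg (volume : Measure ℝ)).prod (MeasurePreserving.id sphereMeasure)

theorem refl_refl (x : X) : refl (refl x) = x := by simp [refl]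

theorem measurePreserving_refl_pi (n : ℕ) :
    MeasurePreserving (fun (x : Fin n → X) i => refl (x i)) (nMeasure n) (nMeasure n) :=
  measurePreserving_pi (fun _ => oneMeasure) (fun _ => oneMeasure) fun _ => measurePreserving_refl

theorem exists_sysOp (A : DoubledMatrix N) {ψ : Vec N} {w : Doubled N} {F : X → Doubled N}
    {H : X → X → Doubled N} (h : HasComps ψ (fam w F H)) (hsym : ∀ a b, H a b = H b a) :
    ∃ χ, SysOp A ψ χ ∧
      HasComps χ (fam (act A w) (fun x => act A (F x)) (fun a b => act A (H a b))) := by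
  obtain ⟨χ, hχ⟩ := exists_hasComps (act A w) (F := fun x => act A (F x))
    (H := fun a b => act A (H a b)) ((actL A).comp_memLp' h.memLp_one)
    ((actL A).comp_memLp' h.memLp_two) fun a b => by rw [hsym]
  refine ⟨χ, fun n => ?_, hχ⟩
  filter_upwards [h n, hχ n] with x h1 h2
  rw [h1, h2]
  match n with
  | 0 => rfl
  | 1 => rfl
  | 2 => rfl
  | n + 3 => exact (map_zero (actL A)).symm

/-- The number `2^{-1/2}`. -/
noncomputable def invSqrtTwo : ℂ := (((Real.sqrt 2)⁻¹ : ℝ) : ℂ)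

theorem invSqrtTwo_mul_self : invSqrtTwo * invSqrtTwo = 1 / 2 := by
  rw [invSqrtTwo, ← Complex.ofReal_mul, ← mul_inv, Real.mul_self_sqrt two_pos.le]
  norm_num

/-- From at most one particle, creation reaches sectors `1` and `2`, and annihilation reaches only
the vacuum. -/
theorem exists_field {f : X → ℂ} (hf : MemLp f 2 oneMeasure) {ψ : Vec N} {w : Doubled N}
    {F : X → Doubled N} (h : HasComps ψ (fam w F 0)) :
    ∃ χ, Field f ψ χ ∧ HasComps χ (fam
      (invSqrtTwo • ∫ y, (starRingEnd ℂ) (f y) • F y ∂oneMeasure)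
      (fun x => invSqrtTwo • f x • w)
      (fun a b => invSqrtTwo • invSqrtTwo • (f a • F b + f b • F a))) := by
  have hF := h.memLp_one
  set w' := invSqrtTwo • ∫ y, (starRingEnd ℂ) (f y) • F y ∂oneMeasure with hw'
  set F' : X → Doubled N := fun x => invSqrtTwo • f x • w with hF'
  -- One factor `2^{-1/2}` comes from the field operator, the other from the normalisation
  -- `1/√(m+1)` of creation at `m = 1`.
  set H' : X → X → Doubled N := fun a b => invSqrtTwo • invSqrtTwo • (f a • F b + f b • F a)
    with hH'
  have hmF : MemLp F' 2 oneMeasure :=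
    MemLp.const_smul (((ContinuousLinearMap.id ℂ ℂ).smulRight w).comp_memLp' hf) invSqrtTwo
  have hmH : MemLp (fun x : Fin 2 → X => H' (x 0) (x 1)) 2 (nMeasure 2) :=
    ((memLp_two_sym hf hF).const_smul invSqrtTwo).const_smul invSqrtTwo
  have hsym : ∀ a b, H' a b = H' b a := fun a b => by simp only [hH', add_comm]
  obtain ⟨χ, hχ⟩ := exists_hasComps w' hmF hmH hsym
  refine ⟨χ, fun n => ?_, hχ⟩
  have hann : ∀ᵐ x ∂(nMeasure n), ∫ y, (starRingEnd ℂ) (f y) • comp ψ (n + 1) (Fin.cons y x)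
      ∂oneMeasure = ∫ y, (starRingEnd ℂ) (f y) • fam w F 0 (n + 1) (Fin.cons y x) ∂oneMeasure := by
    filter_upwards [ae_ae_cons (h (n + 1))] with x hx
    refine integral_congr_ae ?_
    filter_upwards [hx] with y hy
    rw [hy]
  have hcre : ∀ m (i : Fin (m + 1)), ∀ᵐ x ∂(nMeasure (m + 1)),
      comp ψ m (fun k => x (i.succAbove k)) = fam w F 0 m (fun k => x (i.succAbove k)) :=
    fun m i => (quasiMeasurePreserving_succAbove i).ae (h m)
  match n with
  | 0 =>
    filter_upwards [hχ 0, hann] with x h1 h2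
    rw [h1, annihilateFn, h2]
    simp only [createFn, fam, zero_add, Nat.cast_zero, Real.sqrt_one, Complex.ofReal_one, one_smul,
      Fin.cons_zero]
    rfl
  | 1 =>
    filter_upwards [hχ 1, hann, hcre 0 0] with x h1 h2 h3
    rw [h1, annihilateFn, h2, createFn, Fin.sum_univ_one, h3]
    simp [fam, hF', invSqrtTwo]
  | 2 =>
    filter_upwards [hχ 2, hann, hcre 1 0, hcre 1 1] with x h1 h2 h3 h4
    rw [h1, annihilateFn, h2, createFn, Fin.sum_univ_two, h3, h4]
    have hs : Real.sqrt (((1 : ℕ) : ℝ) + 1) = Real.sqrt 2 := by norm_num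
    simp only [fam, smul_zero, integral_zero, add_zero, hs]
    rfl
  | 3 =>
    filter_upwards [hχ 3, hann, ae_all_iff.2 (hcre 2)] with x h1 h2 h3
    rw [h1, annihilateFn, h2, createFn, Finset.sum_congr rfl fun i _ => by rw [h3 i]]
    simp [fam]
  | n + 4 =>
    filter_upwards [hχ (n + 4), hann, ae_all_iff.2 (hcre (n + 3))] with x h1 h2 h3
    rw [h1, annihilateFn, h2, createFn, Finset.sum_congr rfl fun i _ => by rw [h3 i]]
    simp [fam]

end Operators

/-! ### The interaction on vectors with at most one particle -/

section Interaction

variable {N : ℕ}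

/-- `A ⊗ 1` on the doubled space. -/
noncomputable def leftM (A : SysMatrix N) : DoubledMatrix N := A ⊗ₖ (1 : SysMatrix N)

/-- `1 ⊗ A` on the doubled space. -/
noncomputable def rightM (A : SysMatrix N) : DoubledMatrix N := (1 : SysMatrix N) ⊗ₖ A

/-- The vacuum component of `V ψ`. -/
noncomputable def vacV (Q : Model N) (f₁ f₂ : X → ℂ) (F : X → Doubled N) : Doubled N :=
  (Q.lam1 : ℂ) • act (leftM (v1 N)) (invSqrtTwo • ∫ y, (starRingEnd ℂ) (f₁ y) • F y ∂oneMeasure) +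
    (Q.lam2 : ℂ) • act (leftM (v2 N))
      (invSqrtTwo • ∫ y, (starRingEnd ℂ) (f₂ y) • F y ∂oneMeasure)

/-- The one-particle component of `V ψ`. -/
noncomputable def oneV (Q : Model N) (f₁ f₂ : X → ℂ) (w : Doubled N) (x : X) : Doubled N :=
  (Q.lam1 : ℂ) • act (leftM (v1 N)) (invSqrtTwo • f₁ x • w) +
    (Q.lam2 : ℂ) • act (leftM (v2 N)) (invSqrtTwo • f₂ x • w)

/-- The two-particle component of `V ψ`. -/
noncomputable def twoV (Q : Model N) (f₁ f₂ : X → ℂ) (F : X → Doubled N) (a b : X) : Doubled N :=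
  (Q.lam1 : ℂ) • act (leftM (v1 N)) (invSqrtTwo • invSqrtTwo • (f₁ a • F b + f₁ b • F a)) +
    (Q.lam2 : ℂ) • act (leftM (v2 N)) (invSqrtTwo • invSqrtTwo • (f₂ a • F b + f₂ b • F a))

theorem twoV_symm (Q : Model N) (f₁ f₂ : X → ℂ) (F : X → Doubled N) (a b : X) :
    twoV Q f₁ f₂ F a b = twoV Q f₁ f₂ F b a := by
  simp only [twoV, add_comm]

theorem memLp_oneV (Q : Model N) {f₁ f₂ : X → ℂ} (h₁ : MemLp f₁ 2 oneMeasure)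
    (h₂ : MemLp f₂ 2 oneMeasure) (w : Doubled N) : MemLp (oneV Q f₁ f₂ w) 2 oneMeasure := by
  have key : ∀ (c : ℂ) (A : DoubledMatrix N) {f : X → ℂ}, MemLp f 2 oneMeasure →
      MemLp (fun x => c • act A (invSqrtTwo • f x • w)) 2 oneMeasure := fun c A f hf =>
    ((actL A).comp_memLp' (MemLp.const_smul
      (((ContinuousLinearMap.id ℂ ℂ).smulRight w).comp_memLp' hf) invSqrtTwo)).const_smul c
  exact (key _ _ h₁).add (key _ _ h₂)

theorem memLp_twoV (Q : Model N) {f₁ f₂ : X → ℂ} {F : X → Doubled N}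
    (h₁ : MemLp f₁ 2 oneMeasure) (h₂ : MemLp f₂ 2 oneMeasure) (hF : MemLp F 2 oneMeasure) :
    MemLp (fun x : Fin 2 → X => twoV Q f₁ f₂ F (x 0) (x 1)) 2 (nMeasure 2) := by
  have key : ∀ (c : ℂ) (A : DoubledMatrix N) {f : X → ℂ}, MemLp f 2 oneMeasure →
      MemLp (fun x : Fin 2 → X => c • act A (invSqrtTwo • invSqrtTwo •
        (f (x 0) • F (x 1) + f (x 1) • F (x 0)))) 2 (nMeasure 2) := fun c A f hf =>
    ((actL A).comp_memLp' (((memLp_two_sym hf hF).const_smul invSqrtTwo).const_smul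
      invSqrtTwo)).const_smul c
  exact (key _ _ h₁).add (key _ _ h₂)

theorem exists_V {Q : Model N} (h₁ : MemLp (glue Q Q.g1) 2 oneMeasure)
    (h₂ : MemLp (glue Q Q.g2) 2 oneMeasure) {ψ : Vec N} {w : Doubled N} {F : X → Doubled N}
    (h : HasComps ψ (fam w F 0)) :
    ∃ χ, V Q ψ χ ∧ HasComps χ (fam (vacV Q (glue Q Q.g1) (glue Q Q.g2) F)
      (oneV Q (glue Q Q.g1) (glue Q Q.g2) w) (twoV Q (glue Q Q.g1) (glue Q Q.g2) F)) := by
  obtain ⟨χ₁, hf₁, hc₁⟩ := exists_field h₁ h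
  obtain ⟨χ₃, hf₃, hc₃⟩ := exists_field h₂ h
  obtain ⟨χ₂, hs₂, hc₂⟩ := exists_sysOp (leftM (v1 N)) hc₁
    (fun a b => by simp only [add_comm])
  obtain ⟨χ₄, hs₄, hc₄⟩ := exists_sysOp (leftM (v2 N)) hc₃
    (fun a b => by simp only [add_comm])
  exact ⟨_, ⟨χ₁, χ₂, χ₃, χ₄, hf₁, hs₂, hf₃, hs₄, rfl⟩,
    (hc₂.smul (Q.lam1 : ℂ)).add (hc₄.smul (Q.lam2 : ℂ))⟩

/-- The weight `exp(-β u / 2)`. -/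
noncomputable def halfW (Q : Model N) (x : X) : ℂ := ((Real.exp (-(Q.β * x.1) / 2) : ℝ) : ℂ)

theorem halfW_mul_refl (Q : Model N) (x : X) : halfW Q x * halfW Q (refl x) = 1 := by
  rw [halfW, halfW, ← Complex.ofReal_mul, ← Real.exp_add]
  simp [refl, ← add_div]

/-- The one-particle part of `J Δ^{1/2}`. -/
noncomputable def tom (Q : Model N) (F : X → Doubled N) (x : X) : Doubled N :=
  Complex.exp (Complex.I * (Q.phase : ℂ)) • conjS (halfW Q (refl x) • F (refl x))

/-- The two-particle part of `J Δ^{1/2}`. -/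
noncomputable def tom2 (Q : Model N) (H : X → X → Doubled N) (a b : X) : Doubled N :=
  Complex.exp (Complex.I * (2 * (Q.phase : ℂ))) •
    conjS ((halfW Q (refl a) * halfW Q (refl b)) • H (refl a) (refl b))

/-- The weight `exp(-β u / 2)` is unbounded as `u → -∞`, so square integrability of the weighted
components is a genuine domain condition. -/
theorem exists_modularHalf {Q : Model N} {ψ : Vec N} {w : Doubled N} {F : X → Doubled N}
    {H : X → X → Doubled N} (h : HasComps ψ (fam w F H)) (hsym : ∀ a b, H a b = H b a)
    (hF : MemLp (fun x => halfW Q x • F x) 2 oneMeasure)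
    (hH : MemLp (fun x : Fin 2 → X => (halfW Q (x 0) * halfW Q (x 1)) • H (x 0) (x 1)) 2
      (nMeasure 2)) :
    ∃ χ, ModularHalf Q ψ χ ∧ HasComps χ (fam w (fun x => halfW Q x • F x)
      (fun a b => (halfW Q a * halfW Q b) • H a b)) := by
  obtain ⟨χ, hχ⟩ := exists_hasComps w (H := fun a b => (halfW Q a * halfW Q b) • H a b) hF hH
    fun a b => by rw [hsym, mul_comm]
  refine ⟨χ, fun n => ?_, hχ⟩
  filter_upwards [h n, hχ n] with x h1 h2
  rw [h1, h2]
  match n with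
  | 0 => simp [fam, sumU]
  | 1 => simp [fam, sumU, halfW]
  | 2 =>
    simp only [fam, sumU, halfW, Fin.sum_univ_two]
    rw [← Complex.ofReal_mul, ← Real.exp_add]
    congr 4
    ring
  | n + 3 => exact (smul_zero _).symm

theorem exists_conj (Q : Model N) {ψ : Vec N} {w : Doubled N} {F : X → Doubled N}
    {H : X → X → Doubled N} (h : HasComps ψ (fam w F H)) (hsym : ∀ a b, H a b = H b a) :
    ∃ χ, Conj Q ψ χ ∧ HasComps χ (fam (conjS w)
      (fun x => Complex.exp (Complex.I * (Q.phase : ℂ)) • conjS (F (refl x)))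
      (fun a b => Complex.exp (Complex.I * (2 * (Q.phase : ℂ))) •
        conjS (H (refl a) (refl b)))) := by
  have hmF : MemLp (fun x => Complex.exp (Complex.I * (Q.phase : ℂ)) • conjS (F (refl x))) 2
      oneMeasure :=
    (conjS.comp_memLp' (h.memLp_one.comp_measurePreserving measurePreserving_refl)).const_smul
      (Complex.exp (Complex.I * (Q.phase : ℂ)))
  have hmH : MemLp (fun x : Fin 2 → X => Complex.exp (Complex.I * (2 * (Q.phase : ℂ))) •
      conjS (H (refl (x 0)) (refl (x 1)))) 2 (nMeasure 2) :=
    (conjS.comp_memLp'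
      (h.memLp_two.comp_measurePreserving (measurePreserving_refl_pi 2))).const_smul
      (Complex.exp (Complex.I * (2 * (Q.phase : ℂ))))
  obtain ⟨χ, hχ⟩ := exists_hasComps (conjS w) (H := fun a b =>
    Complex.exp (Complex.I * (2 * (Q.phase : ℂ))) • conjS (H (refl a) (refl b))) hmF hmH
    fun a b => by rw [hsym]
  refine ⟨χ, fun n => ?_, hχ⟩
  filter_upwards [hχ n, (measurePreserving_refl_pi n).quasiMeasurePreserving.ae (h n)]
    with x h1 h2 σ τ
  change comp ψ n (fun i => (-(x i).1, (x i).2)) = _ at h2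
  rw [h1, h2]
  match n with
  | 0 => simp [fam, conjS_apply]
  | 1 => simp [fam, conjS_apply]
  | 2 => simp [fam, conjS_apply]
  | n + 3 => simp [fam]

theorem exists_tomita {Q : Model N} {ψ : Vec N} {w : Doubled N} {F : X → Doubled N}
    {H : X → X → Doubled N} (h : HasComps ψ (fam w F H)) (hsym : ∀ a b, H a b = H b a)
    (hF : MemLp (fun x => halfW Q x • F x) 2 oneMeasure)
    (hH : MemLp (fun x : Fin 2 → X => (halfW Q (x 0) * halfW Q (x 1)) • H (x 0) (x 1)) 2
      (nMeasure 2)) :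
    ∃ χ, Tomita Q ψ χ ∧ HasComps χ (fam (conjS w) (tom Q F) (tom2 Q H)) := by
  obtain ⟨η, h1, h2⟩ := exists_modularHalf h hsym hF hH
  obtain ⟨χ, h3, h4⟩ := exists_conj Q h2 fun a b => by rw [hsym, mul_comm]
  exact ⟨χ, ⟨η, h1, h3⟩, h4⟩

/-- The weights at `u` and `-u` are inverse to each other. Hence vectors in the image of `J Δ^{1/2}`
lie again in the domain of `Δ^{1/2}`. -/
theorem halfW_smul_tom (Q : Model N) (F : X → Doubled N) (x : X) :
    halfW Q x • tom Q F x =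
      Complex.exp (Complex.I * (Q.phase : ℂ)) • conjS (F (refl x)) := by
  have hreal : (starRingEnd ℂ) (halfW Q (refl x)) = halfW Q (refl x) :=
    Complex.conj_ofReal _
  rw [tom, smul_comm, conjS_smul, hreal, smul_smul (halfW Q x), halfW_mul_refl, one_smul]

theorem memLp_halfW_smul_tom (Q : Model N) {F : X → Doubled N} (hF : MemLp F 2 oneMeasure) :
    MemLp (fun x => halfW Q x • tom Q F x) 2 oneMeasure := by
  simp only [halfW_smul_tom]
  exact (conjS.comp_memLp' (hF.comp_measurePreserving measurePreserving_refl)).const_smul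
    (Complex.exp (Complex.I * (Q.phase : ℂ)))

/-- The weight can be absorbed into the form factors, so the domain conditions after applying `V`
reduce to square integrability of `halfW Q x * glue Q g x`. -/
theorem halfW_smul_oneV (Q : Model N) (f₁ f₂ : X → ℂ) (w : Doubled N) (x : X) :
    halfW Q x • oneV Q f₁ f₂ w x =
      oneV Q (fun x => halfW Q x * f₁ x) (fun x => halfW Q x * f₂ x) w x := by
  simp only [oneV, act_eq_actL, map_smul, smul_add, smul_smul]
  congr 2 <;> ring

theorem halfW_smul_twoV (Q : Model N) (f₁ f₂ : X → ℂ) (F : X → Doubled N) (a b : X) :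
    (halfW Q a * halfW Q b) • twoV Q f₁ f₂ F a b =
      twoV Q (fun x => halfW Q x * f₁ x) (fun x => halfW Q x * f₂ x)
        (fun x => halfW Q x • F x) a b := by
  simp only [twoV, act_eq_actL, map_smul, map_add, smul_add, smul_smul]
  module

/-- The first `J Δ^{1/2}` requires `hF`; the domain condition of the second one holds because the
weight undoes the first on the one-particle part and falls on the form factors elsewhere. -/
theorem exists_interaction {Q : Model N} (h₁ : MemLp (glue Q Q.g1) 2 oneMeasure)
    (h₂ : MemLp (glue Q Q.g2) 2 oneMeasure)
    (h₁' : MemLp (fun x => halfW Q x * glue Q Q.g1 x) 2 oneMeasure)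
    (h₂' : MemLp (fun x => halfW Q x * glue Q Q.g2 x) 2 oneMeasure)
    {ψ : Vec N} {w : Doubled N} {F : X → Doubled N} (h : HasComps ψ (fam w F 0))
    (hF : MemLp (fun x => halfW Q x • F x) 2 oneMeasure) :
    ∃ χ, Interaction Q ψ χ ∧ HasComps χ (fam
      (vacV Q (glue Q Q.g1) (glue Q Q.g2) F - conjS (vacV Q (glue Q Q.g1) (glue Q Q.g2) (tom Q F)))
      (fun x => oneV Q (glue Q Q.g1) (glue Q Q.g2) w x -
        tom Q (oneV Q (glue Q Q.g1) (glue Q Q.g2) (conjS w)) x)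
      (fun a b => twoV Q (glue Q Q.g1) (glue Q Q.g2) F a b -
        tom2 Q (twoV Q (glue Q Q.g1) (glue Q Q.g2) (tom Q F)) a b)) := by
  obtain ⟨χ₁, hV₁, hc₁⟩ := exists_V h₁ h₂ h
  have h0 : MemLp (fun x : Fin 2 → X => (halfW Q (x 0) * halfW Q (x 1)) •
      (0 : X → X → Doubled N) (x 0) (x 1)) 2 (nMeasure 2) := by
    simp only [Pi.zero_apply, smul_zero]
    exact MemLp.zero'
  obtain ⟨χ₂, hT₂, hc₂⟩ := exists_tomita h (fun _ _ => rfl) hF h0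
  have hz : tom2 Q (0 : X → X → Doubled N) = 0 := by
    funext a b
    simp [tom2]
  rw [hz] at hc₂
  obtain ⟨χ₃, hV₃, hc₃⟩ := exists_V h₁ h₂ hc₂
  have hone : MemLp (fun x => halfW Q x •
      oneV Q (glue Q Q.g1) (glue Q Q.g2) (conjS w) x) 2 oneMeasure := by
    simp only [halfW_smul_oneV]
    exact memLp_oneV Q h₁' h₂' _
  have htwo : MemLp (fun x : Fin 2 → X => (halfW Q (x 0) * halfW Q (x 1)) •
      twoV Q (glue Q Q.g1) (glue Q Q.g2) (tom Q F) (x 0) (x 1)) 2 (nMeasure 2) := by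
    simp only [halfW_smul_twoV]
    exact memLp_twoV Q h₁' h₂' (memLp_halfW_smul_tom Q h.memLp_one)
  obtain ⟨χ₄, hT₄, hc₄⟩ := exists_tomita hc₃ (twoV_symm _ _ _ _) hone htwo
  exact ⟨_, ⟨χ₁, χ₂, χ₃, χ₄, hV₁, hT₂, hV₃, hT₄, rfl⟩, hc₁.sub hc₄⟩

end Interaction

section Uniqueness

variable {N : ℕ} {Q : Model N}

/-! ### The register Liouvillian is diagonal -/

theorem site_pauliZ (j : Fin N) :
    site pauliZ j = Matrix.diagonal fun σ : Conf N => ((sgn (σ j) : ℝ) : ℂ) := by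
  ext σ σ'
  by_cases h : σ = σ'
  · subst h
    simp [site, pauliZ]
  · rw [Matrix.diagonal_apply_ne _ h, site]
    split_ifs with hk
    · have hj : σ j ≠ σ' j := fun hj => h (funext fun k => by
        by_cases hkj : k = j
        · rw [hkj, hj]
        · exact hk k hkj)
      simp [pauliZ, hj]
    · rfl

theorem hamiltonian_eq (Q : Model N) :
    hamiltonian Q = Matrix.diagonal fun σ => ((energy Q σ : ℝ) : ℂ) := by
  ext σ σ'
  simp only [hamiltonian, site_pauliZ, Matrix.diagonal_mul_diagonal, Matrix.add_apply,
    Matrix.sum_apply, Matrix.smul_apply, smul_eq_mul]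
  by_cases h : σ = σ'
  · subst h
    simp only [Matrix.diagonal_apply_eq, energy]
    push_cast
    simp only [mul_assoc]
  · simp [Matrix.diagonal_apply_ne _ h]

theorem act_liouvilleS (v : Doubled N) (p : Conf N × Conf N) :
    act (liouvilleS Q) v p = ((energyDiff Q p.1 p.2 : ℝ) : ℂ) * v p := by
  rw [act_apply, Finset.sum_eq_single p]
  · simp [liouvilleS, hamiltonian_eq, Matrix.sub_apply, Matrix.kroneckerMap_apply, energyDiff]
  · intro q _ hq
    have : liouvilleS Q p q = 0 := by
      rw [liouvilleS, hamiltonian_eq, Matrix.sub_apply, Matrix.kroneckerMap_apply,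
        Matrix.kroneckerMap_apply]
      by_cases h1 : p.1 = q.1
      · have h2 : p.2 ≠ q.2 := fun h2 => hq (Prod.ext h1 h2).symm
        simp [Matrix.one_apply_ne h2, Matrix.diagonal_apply_ne _ h2]
      · simp [Matrix.one_apply_ne h1, Matrix.diagonal_apply_ne _ h1]
    rw [this, zero_mul]
  · simp

/-! ### The relations are functional -/

theorem Field.unique {f : X → ℂ} {ψ χ χ' : Vec N} (h : Field f ψ χ) (h' : Field f ψ χ') :
    χ = χ' :=
  vec_ext fun n => by filter_upwards [h n, h' n] with x h1 h2; rw [h1, h2]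

theorem SysOp.unique {A : DoubledMatrix N} {ψ χ χ' : Vec N} (h : SysOp A ψ χ)
    (h' : SysOp A ψ χ') : χ = χ' :=
  vec_ext fun n => by filter_upwards [h n, h' n] with x h1 h2; rw [h1, h2]

theorem ModularHalf.unique {ψ χ χ' : Vec N} (h : ModularHalf Q ψ χ) (h' : ModularHalf Q ψ χ') :
    χ = χ' :=
  vec_ext fun n => by filter_upwards [h n, h' n] with x h1 h2; rw [h1, h2]

theorem Conj.unique {ψ χ χ' : Vec N} (h : Conj Q ψ χ) (h' : Conj Q ψ χ') : χ = χ' :=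
  vec_ext fun n => by
    filter_upwards [h n, h' n] with x h1 h2
    ext p
    exact (h1 p.1 p.2).trans (h2 p.1 p.2).symm

theorem Tomita.unique {ψ χ χ' : Vec N} (h : Tomita Q ψ χ) (h' : Tomita Q ψ χ') : χ = χ' := by
  obtain ⟨η, h1, h2⟩ := h
  obtain ⟨η', h1', h2'⟩ := h'
  obtain rfl := h1.unique h1'
  exact h2.unique h2'

theorem V.unique {ψ χ χ' : Vec N} (h : V Q ψ χ) (h' : V Q ψ χ') : χ = χ' := by
  obtain ⟨a, b, c, d, h1, h2, h3, h4, rfl⟩ := h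
  obtain ⟨a', b', c', d', h1', h2', h3', h4', rfl⟩ := h'
  obtain rfl := h1.unique h1'
  obtain rfl := h2.unique h2'
  obtain rfl := h3.unique h3'
  obtain rfl := h4.unique h4'
  rfl

theorem Interaction.unique {ψ χ χ' : Vec N} (h : Interaction Q ψ χ) (h' : Interaction Q ψ χ') :
    χ = χ' := by
  obtain ⟨a, b, c, d, h1, h2, h3, h4, rfl⟩ := h
  obtain ⟨a', b', c', d', h1', h2', h3', h4', rfl⟩ := h'
  obtain rfl := h1.unique h1'
  obtain rfl := h2.unique h2'
  obtain rfl := h3.unique h3'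
  obtain rfl := h4.unique h4'
  rfl

theorem ranP_iff {e : ℝ} {ψ : Vec N} : RanP Q e ψ ↔ ∀ n, ∀ᵐ x ∂(nMeasure n), ∀ p,
    ((energyDiff Q p.1 p.2 + sumU x - e : ℝ) : ℂ) * comp ψ n x p = 0 := by
  refine forall_congr' fun n => ⟨fun h => ?_, fun h => ?_⟩
  · filter_upwards [h, comp_smul (e : ℂ) ψ n] with x h1 h2 p
    rw [h2] at h1
    have h3 := congrArg (fun v : Doubled N => v p) h1
    simp only [PiLp.smul_apply, PiLp.add_apply, act_liouvilleS, smul_eq_mul] at h3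
    push_cast
    linear_combination -h3
  · filter_upwards [h, comp_smul (e : ℂ) ψ n] with x h1 h2
    rw [h2]
    ext p
    have h3 := h1 p
    simp only [PiLp.smul_apply, PiLp.add_apply, act_liouvilleS, smul_eq_mul]
    push_cast at h3
    linear_combination -h3

theorem RanP.sub {e : ℝ} {ψ χ : Vec N} (h : RanP Q e ψ) (h' : RanP Q e χ) :
    RanP Q e (ψ - χ) := by
  rw [ranP_iff] at *
  intro n
  filter_upwards [h n, h' n, comp_sub ψ χ n] with x h1 h2 h3 p
  rw [h3, PiLp.sub_apply, mul_sub, h1, h2, sub_zero]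

theorem eq_of_inner_sub_eq_zero {E : Type*} [NormedAddCommGroup E] [InnerProductSpace ℂ E]
    {ψ χ χ' : E} (h : inner ℂ (χ' - χ) (ψ - χ) = 0) (h' : inner ℂ (χ' - χ) (ψ - χ') = 0) :
    χ = χ' := by
  have h3 : inner ℂ (χ' - χ) (χ' - χ) = 0 := by
    rw [← sub_eq_zero.2 (h.trans h'.symm), ← inner_sub_right, sub_sub_sub_cancel_left]
  rw [inner_self_eq_zero, sub_eq_zero] at h3
  exact h3.symm

theorem P.unique {e : ℝ} {ψ χ χ' : Vec N} (h : P Q e ψ χ) (h' : P Q e ψ χ') : χ = χ' := by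
  have hr := h'.1.sub h.1
  exact eq_of_inner_sub_eq_zero (h.2 _ hr) (h'.2 _ hr)

theorem Pbar.unique {e : ℝ} {ψ χ χ' : Vec N} (h : Pbar Q e ψ χ) (h' : Pbar Q e ψ χ') :
    χ = χ' := by
  have := P.unique h h'
  exact sub_right_injective this

theorem resolvent_denom_ne {t ε : ℝ} (hε : 0 < ε) : (t : ℂ) + Complex.I * ε ≠ 0 := by
  intro h
  have := congrArg Complex.im h
  simp at this
  exact hε.ne' this

theorem res_iff {e ε : ℝ} {ψ χ : Vec N} : Res Q e ε ψ χ ↔ ∀ n, ∀ᵐ x ∂(nMeasure n), ∀ p,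
    (((energyDiff Q p.1 p.2 + sumU x - e : ℝ) : ℂ) + Complex.I * ε) * comp χ n x p =
      comp ψ n x p := by
  refine forall_congr' fun n => ⟨fun h => ?_, fun h => ?_⟩
  · filter_upwards [h, comp_add ψ (((e : ℂ) - Complex.I * (ε : ℂ)) • χ) n,
      comp_smul ((e : ℂ) - Complex.I * (ε : ℂ)) χ n] with x h1 h2 h4 p
    rw [h2, h4] at h1
    have h3 := congrArg (fun v : Doubled N => v p) h1
    simp only [PiLp.smul_apply, PiLp.add_apply, act_liouvilleS, smul_eq_mul] at h3
    push_cast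
    linear_combination -h3
  · filter_upwards [h, comp_add ψ (((e : ℂ) - Complex.I * (ε : ℂ)) • χ) n,
      comp_smul ((e : ℂ) - Complex.I * (ε : ℂ)) χ n] with x h1 h2 h4
    rw [h2, h4]
    ext p
    have h3 := h1 p
    simp only [PiLp.smul_apply, PiLp.add_apply, act_liouvilleS, smul_eq_mul]
    push_cast at h3
    linear_combination -h3

theorem Res.unique {e ε : ℝ} (hε : 0 < ε) {ψ χ χ' : Vec N} (h : Res Q e ε ψ χ)
    (h' : Res Q e ε ψ χ') : χ = χ' :=
  vec_ext fun n => by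
    filter_upwards [res_iff.1 h n, res_iff.1 h' n] with x h1 h2
    ext p
    exact mul_left_cancel₀ (resolvent_denom_ne hε) ((h1 p).trans (h2 p).symm)

/-- The regularised operator is given by unspecified intermediate vectors; since every factor is
functional, exhibiting one chain determines the value. Injectivity of `L_0 - e + iε` uses `ε > 0`.
-/
theorem LevelShiftReg.unique {e ε : ℝ} (hε : 0 < ε) {ψ χ χ' : Vec N}
    (h : LevelShiftReg Q e ε ψ χ) (h' : LevelShiftReg Q e ε ψ χ') : χ = χ' := by
  obtain ⟨a, b, c, d, f, h1, h2, h3, h4, h5, h6⟩ := h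
  obtain ⟨a', b', c', d', f', h1', h2', h3', h4', h5', h6'⟩ := h'
  obtain rfl := h1.unique h1'
  obtain rfl := h2.unique h2'
  obtain rfl := h3.unique hε h3'
  obtain rfl := h4.unique h4'
  obtain rfl := h5.unique h5'
  exact h6.unique h6'

/-! ### The spectral projection and the resolvent -/

/-- With all other particles fixed, equality pins one real coordinate to a single value, which is a
null condition. -/
theorem ae_sumU_ne (n : ℕ) (c : ℝ) : ∀ᵐ x ∂(nMeasure (n + 1)), sumU x ≠ c := by
  have hmp := measurePreserving_piFinSuccAbove (α := fun _ : Fin (n + 1) => X)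
    (fun _ => oneMeasure) 0
  have h1 : ∀ᵐ z ∂(oneMeasure.prod (nMeasure n)), z.1.1 + sumU z.2 ≠ c := by
    have hm : MeasurableSet {z : X × (Fin n → X) | z.1.1 + sumU z.2 ≠ c} := by
      refine (measurableSet_eq_fun ?_ measurable_const).compl
      unfold sumU
      fun_prop
    have hswap : ∀ᵐ z ∂((nMeasure n).prod oneMeasure), z.2.1 + sumU z.1 ≠ c := by
      refine (Measure.ae_prod_iff_ae_ae (measurable_swap hm)).2 (ae_of_all _ fun x => ?_)
      have h0 : ∀ᵐ u : ℝ, u ≠ c - sumU x := by simp [ae_iff]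
      have h2 := (Measure.quasiMeasurePreserving_fst (μ := (volume : Measure ℝ))
        (ν := sphereMeasure)).ae h0
      filter_upwards [h2] with y hy h3
      exact hy (eq_sub_of_add_eq h3)
    exact (Measure.measurePreserving_swap (μ := oneMeasure)
      (ν := nMeasure n)).quasiMeasurePreserving.ae hswap
  have h2 := hmp.quasiMeasurePreserving.ae h1
  filter_upwards [h2] with x hx
  simpa [sumU, Fin.sum_univ_succ, MeasurableEquiv.piFinSuccAbove, Fin.tail] using hx

/-- On a sector with particles, an eigenvector can be nonzero only where `sumU` equals one of the
finitely many numbers `e - energyDiff Q σ τ`, and that set is null. -/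
theorem RanP.exists_vacuum {e : ℝ} {ψ : Vec N} (h : RanP Q e ψ) :
    ∃ w : Doubled N, ψ = vacuum w ∧ ∀ p, energyDiff Q p.1 p.2 ≠ e → w p = 0 := by
  rw [ranP_iff] at h
  have h0 := ae_zero_iff.1 (h 0)
  refine ⟨comp ψ 0 (fun i => Fin.elim0 i), ?_, fun p hp => ?_⟩
  · refine HasComps.ext (C := fam _ 0 0) (fun n => ?_) (hasComps_vacuum _)
    match n with
    | 0 => exact ae_zero_iff.2 rfl
    | n + 1 =>
      have hne : ∀ᵐ x ∂(nMeasure (n + 1)), ∀ p : Conf N × Conf N,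
          sumU x ≠ e - energyDiff Q p.1 p.2 :=
        ae_all_iff.2 fun p => ae_sumU_ne n _
      have hz : ∀ x, fam (comp ψ 0 fun i => Fin.elim0 i) (0 : X → Doubled N) 0 (n + 1) x = 0 := by
        intro x
        match n with
        | 0 => rfl
        | 1 => rfl
        | n + 2 => rfl
      filter_upwards [h (n + 1), hne] with x h1 h2
      rw [hz]
      ext p
      refine (mul_eq_zero.1 (h1 p)).resolve_left ?_
      rw [Complex.ofReal_eq_zero]
      intro h3
      exact h2 p (by linarith)
  · have := h0 p
    refine (mul_eq_zero.1 this).resolve_left ?_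
    rw [Complex.ofReal_eq_zero]
    simpa [sumU, sub_eq_zero] using hp

theorem ranP_vacuum {e : ℝ} {w : Doubled N} (hw : ∀ p, energyDiff Q p.1 p.2 ≠ e → w p = 0) :
    RanP Q e (vacuum w) := by
  rw [ranP_iff]
  intro n
  filter_upwards [hasComps_vacuum w n] with x hx p
  rw [hx]
  match n with
  | 0 =>
    by_cases hp : energyDiff Q p.1 p.2 = e
    · simp [sumU, hp]
    · simp [fam, hw p hp]
  | 1 => simp [fam]
  | 2 => simp [fam]
  | n + 3 => simp [fam]

/-- The projection of a register vector to the eigenspace of `L_S` for `e`. -/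
noncomputable def projW (Q : Model N) (e : ℝ) (w : Doubled N) : Doubled N :=
  WithLp.toLp 2 fun p => if energyDiff Q p.1 p.2 = e then w p else 0

theorem projW_apply (e : ℝ) (w : Doubled N) (p : Conf N × Conf N) :
    projW Q e w p = if energyDiff Q p.1 p.2 = e then w p else 0 := rfl

theorem inner_eq_zero_of_comp {η ζ : Vec N}
    (h : ∀ n, ∀ᵐ x ∂(nMeasure n), inner ℂ (comp η n x) (comp ζ n x) = 0) :
    inner ℂ η ζ = 0 := by
  change inner ℂ (η : FullSpace N) (ζ : FullSpace N) = 0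
  rw [lp.inner_eq_tsum]
  have hz : ∀ n, inner ℂ ((η : FullSpace N) n) ((ζ : FullSpace N) n) = 0 := by
    intro n
    rw [L2.inner_def]
    exact integral_eq_zero_of_ae (h n)
  simp only [hz, tsum_zero]

theorem HasComps.proj {e : ℝ} {ψ : Vec N} {w : Doubled N} {F : X → Doubled N}
    {H : X → X → Doubled N} (h : HasComps ψ (fam w F H)) : P Q e ψ (vacuum (projW Q e w)) := by
  refine ⟨ranP_vacuum fun p hp => by simp [projW_apply, hp], fun η hη => ?_⟩
  obtain ⟨v, rfl, hv⟩ := hη.exists_vacuum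
  refine inner_eq_zero_of_comp fun n => ?_
  filter_upwards [hasComps_vacuum v n, h.sub (hasComps_vacuum (projW Q e w)) n] with x h1 h2
  rw [h1, h2]
  match n with
  | 0 =>
    simp only [fam, PiLp.inner_apply, PiLp.sub_apply, projW_apply]
    refine Finset.sum_eq_zero fun p _ => ?_
    by_cases hp : energyDiff Q p.1 p.2 = e
    · simp [hp]
    · simp [hv p hp]
  | 1 => simp [fam]
  | 2 => simp [fam]
  | n + 3 => simp [fam]

/-- The range of `P_e` lies in the vacuum sector, so `P_e` annihilates a vector without vacuum
component. -/
theorem HasComps.pbar_self {e : ℝ} {ψ : Vec N} {F : X → Doubled N}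
    {H : X → X → Doubled N} (h : HasComps ψ (fam 0 F H)) : Pbar Q e ψ ψ := by
  have h1 := h.proj (Q := Q) (e := e)
  have h2 : projW Q e (0 : Doubled N) = 0 := by
    ext p
    simp [projW_apply]
  rw [h2, map_zero] at h1
  rwa [Pbar, sub_self]

/-- The resolvent of `L_0` on one-particle functions. -/
noncomputable def resF (Q : Model N) (e ε : ℝ) (F : X → Doubled N) (x : X) : Doubled N :=
  WithLp.toLp 2 fun p =>
    (((energyDiff Q p.1 p.2 + x.1 - e : ℝ) : ℂ) + Complex.I * ε)⁻¹ * F x p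

theorem norm_resolvent_le {t ε : ℝ} (hε : 0 < ε) :
    ‖((t : ℂ) + Complex.I * ε)⁻¹‖ ≤ ε⁻¹ := by
  rw [norm_inv]
  refine inv_anti₀ hε ?_
  have := Complex.abs_im_le_norm ((t : ℂ) + Complex.I * ε)
  simpa [abs_of_pos hε] using this

theorem memLp_resF (Q : Model N) (e : ℝ) {ε : ℝ} (hε : 0 < ε) {F : X → Doubled N}
    (hF : MemLp F 2 oneMeasure) : MemLp (resF Q e ε F) 2 oneMeasure := by
  refine MemLp.of_eval_piLp fun p => ?_
  have hp : MemLp (fun x => F x p) 2 oneMeasure := hF.eval_piLp p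
  refine MemLp.of_le_mul (c := ε⁻¹) hp ?_ (ae_of_all _ fun x => ?_)
  · exact (Measurable.aestronglyMeasurable (by fun_prop)).mul hp.1
  · simp only [resF, norm_mul]
    exact mul_le_mul_of_nonneg_right (norm_resolvent_le hε) (norm_nonneg _)

theorem exists_res {e ε : ℝ} (hε : 0 < ε) {ψ : Vec N} {F : X → Doubled N}
    (h : HasComps ψ (fam 0 F 0)) :
    ∃ χ, Res Q e ε ψ χ ∧ HasComps χ (fam 0 (resF Q e ε F) 0) := by
  obtain ⟨χ, hχ⟩ := exists_hasComps (0 : Doubled N) (H := 0) (memLp_resF Q e hε h.memLp_one)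
    MemLp.zero' fun _ _ => rfl
  refine ⟨χ, res_iff.2 fun n => ?_, hχ⟩
  filter_upwards [h n, hχ n] with x h1 h2 p
  rw [h1, h2]
  match n with
  | 0 => simp [fam]
  | 1 =>
    simp only [fam, resF, sumU, Fin.sum_univ_one]
    rw [mul_inv_cancel_left₀ (resolvent_denom_ne hε)]
  | 2 => simp [fam]
  | n + 3 => simp [fam]

end Uniqueness

section Simplification

variable {N : ℕ} {Q : Model N}

/-! ### The interaction in terms of left and right multiplication -/

/-- A matrix with real entries. -/
def RealEntries (A : SysMatrix N) : Prop := ∀ σ τ, (starRingEnd ℂ) (A σ τ) = A σ τ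

theorem RealEntries.sum {ι : Type*} (s : Finset ι) {A : ι → SysMatrix N}
    (h : ∀ i, RealEntries (A i)) : RealEntries (∑ i ∈ s, A i) := fun σ τ => by
  rw [Matrix.sum_apply, map_sum]
  exact Finset.sum_congr rfl fun i _ => h i σ τ

theorem RealEntries.site {A : Matrix ℤˣ ℤˣ ℂ} (h : ∀ s t, (starRingEnd ℂ) (A s t) = A s t)
    (j : Fin N) : RealEntries (site A j) := fun σ τ => by
  unfold QubitRegister.site
  split_ifs
  · exact h _ _
  · exact map_zero _

theorem realEntries_v1 : RealEntries (v1 N) :=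
  RealEntries.sum _ fun j => RealEntries.site (fun s t => by
    unfold pauliZ
    by_cases h : s = t
    · subst h; rw [Matrix.diagonal_apply_eq, Complex.conj_ofReal]
    · rw [Matrix.diagonal_apply_ne _ h, map_zero]) j

theorem realEntries_v2 : RealEntries (v2 N) :=
  RealEntries.sum _ fun j => RealEntries.site (fun s t => by
    unfold pauliX
    split_ifs <;> simp) j

/-- `J_S` exchanges the two tensor factors, which turns left into right multiplication; the complex
conjugation passes through because the entries are real. -/
theorem conjS_act_leftM {A : SysMatrix N} (hA : RealEntries A) (w : Doubled N) :
    conjS (act (leftM A) w) = act (rightM A) (conjS w) := by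
  ext p
  rw [conjS_apply, act_apply, act_apply, map_sum]
  refine Fintype.sum_equiv (Equiv.prodComm _ _) _ _ fun q => ?_
  rw [map_mul, conjS_apply]
  congr 1
  have h1 : ∀ σ τ : Conf N, (starRingEnd ℂ) ((1 : SysMatrix N) σ τ) = (1 : SysMatrix N) σ τ :=
    fun σ τ => by rw [Matrix.one_apply]; split_ifs <;> simp
  rw [leftM, rightM, Matrix.kroneckerMap_apply, Matrix.kroneckerMap_apply, map_mul, hA, h1,
    mul_comm]
  rfl

theorem sqrt_weight {β u : ℝ} (hβ : 0 < β) (hu : u ≠ 0) :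
    Real.exp (-(β * -u) / 2) * Real.sqrt (-u / (1 - Real.exp (-β * -u))) =
      Real.sqrt (u / (1 - Real.exp (-β * u))) := by
  have h1 := one_sub_exp_ne hβ hu
  have h2 := one_sub_exp_ne hβ (neg_ne_zero.2 hu)
  have h0 : Real.exp (-(β * -u) / 2) = Real.sqrt (Real.exp (-β * -u)) := by
    rw [← Real.exp_half]
    congr 1
    ring
  rw [h0, ← Real.sqrt_mul (Real.exp_pos _).le]
  congr 1
  have h3 : Real.exp (-β * -u) * Real.exp (-β * u) = 1 := by
    rw [← Real.exp_add]; simp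
  generalize Real.exp (-β * -u) = E' at *
  generalize Real.exp (-β * u) = E at *
  field_simp
  linear_combination h3

/-- The one-particle vector `g_β` is fixed by `J Δ^{1/2}`: the reflection swaps the two branches of
the gluing, the phase and conjugation undo each other, and `sqrt_weight` matches the thermal
factors. -/
theorem glue_conj_refl (hβ : 0 < Q.β) (h : R3 → ℂ) {x : X} (hx : x.1 ≠ 0) :
    Complex.exp (Complex.I * (Q.phase : ℂ)) *
      (starRingEnd ℂ) (halfW Q (refl x) * glue Q h (refl x)) = glue Q h x := by
  have hw := sqrt_weight hβ hx
  have hE : Complex.exp (Complex.I * (Q.phase : ℂ)) *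
      (starRingEnd ℂ) (Complex.exp (Complex.I * (Q.phase : ℂ))) = 1 := by
    rw [← Complex.exp_conj, ← Complex.exp_add]
    simp
  unfold glue halfW refl
  simp only [abs_neg, map_mul, Complex.conj_ofReal]
  rw [← hw]
  rcases lt_or_gt_of_ne hx with hlt | hgt
  · rw [if_pos (by linarith), if_neg (by linarith)]
    push_cast
    ring
  · rw [if_neg (by linarith), if_pos hgt.le, neg_neg, map_mul, Complex.conj_conj]
    rw [Complex.ofReal_mul, Complex.ofReal_mul, Complex.ofReal_mul]
    linear_combination ((Real.exp (-(Q.β * -x.1) / 2) : ℝ) *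
      (Real.sqrt (-x.1 / (1 - Real.exp (-Q.β * -x.1))) : ℝ) * (Real.sqrt |x.1| : ℝ) *
        h (x.1 • (x.2 : R3)) : ℂ) * hE

theorem ae_ne_zero : ∀ᵐ x ∂oneMeasure, x.1 ≠ 0 := by
  have h0 : ∀ᵐ u : ℝ, u ≠ 0 := by simp [ae_iff]
  exact (Measure.quasiMeasurePreserving_fst (μ := (volume : Measure ℝ))
    (ν := sphereMeasure)).ae h0

theorem measurable_halfW (Q : Model N) : Measurable (halfW Q) := by
  unfold halfW
  fun_prop

theorem norm_halfW_mul_glue (hβ : 0 < Q.β) (h : R3 → ℂ) {x : X} (hx : x.1 ≠ 0) :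
    ‖halfW Q x * glue Q h x‖ = ‖glue Q h (refl x)‖ := by
  have h1 := glue_conj_refl hβ h (x := refl x) (by simpa [refl] using hx)
  rw [refl_refl] at h1
  rw [← h1, norm_mul (Complex.exp _), RCLike.norm_conj, mul_comm Complex.I, Complex.norm_exp_ofReal_mul_I, one_mul]

/-- By invariance under `J Δ^{1/2}`, the weighted form factor has pointwise the modulus of the
reflected one, so it is square integrable although the weight is unbounded. -/
theorem memLp_halfW_mul_glue (hβ : 0 < Q.β) {h : R3 → ℂ} (hm : MemLp (glue Q h) 2 oneMeasure) :
    MemLp (fun x => halfW Q x * glue Q h x) 2 oneMeasure := by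
  refine MemLp.of_le (hm.comp_measurePreserving measurePreserving_refl)
    ((measurable_halfW Q).aestronglyMeasurable.mul hm.1) ?_
  filter_upwards [ae_ne_zero] with x hx
  exact (norm_halfW_mul_glue hβ h hx).le

/-- The conjugated one-particle function is obtained from right multiplication. -/
theorem tom_oneV (hβ : 0 < Q.β) (w : Doubled N) {x : X} (hx : x.1 ≠ 0) :
    tom Q (oneV Q (glue Q Q.g1) (glue Q Q.g2) (conjS w)) x =
      (Q.lam1 : ℂ) • invSqrtTwo • glue Q Q.g1 x • act (rightM (v1 N)) w +
        (Q.lam2 : ℂ) • invSqrtTwo • glue Q Q.g2 x • act (rightM (v2 N)) w := by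
  have hr : (starRingEnd ℂ) invSqrtTwo = invSqrtTwo := Complex.conj_ofReal _
  rw [← glue_conj_refl hβ Q.g1 hx, ← glue_conj_refl hβ Q.g2 hx]
  simp only [tom, oneV, act_eq_actL, map_smul, map_add, smul_add, conjS_smul, Complex.conj_ofReal,
    hr, map_mul]
  simp only [← act_eq_actL, conjS_act_leftM realEntries_v1, conjS_act_leftM realEntries_v2,
    conjS_conjS]
  module

/-- After the reflection `u ↦ -u`, one factor `halfW` comes from `Δ^{1/2}` acting on `F`, and
another from rewriting the reflected form factor through `glue_conj_refl`. Together they form the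
weight `exp(-β u)`. -/
theorem conjS_integral_tom (hβ : 0 < Q.β) {h : R3 → ℂ} (hm : MemLp (glue Q h) 2 oneMeasure)
    {F : X → Doubled N} (hF : MemLp (fun x => halfW Q x • F x) 2 oneMeasure) :
    conjS (∫ y, (starRingEnd ℂ) (glue Q h y) • tom Q F y ∂oneMeasure) =
      ∫ y, (halfW Q y ^ 2 * (starRingEnd ℂ) (glue Q h y)) • F y ∂oneMeasure := by
  have htom : MemLp (tom Q F) 2 oneMeasure :=
    (conjS.comp_memLp' (hF.comp_measurePreserving measurePreserving_refl)).const_smul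
      (Complex.exp (Complex.I * (Q.phase : ℂ)))
  have hconj : MemLp (fun y => (starRingEnd ℂ) (glue Q h y)) 2 oneMeasure :=
    (Complex.conjCLE : ℂ →L[ℝ] ℂ).comp_memLp' hm
  have hint : Integrable (fun y => (starRingEnd ℂ) (glue Q h y) • tom Q F y) oneMeasure :=
    memLp_one_iff_integrable.1 (MemLp.smul htom hconj)
  rw [← ContinuousLinearMap.integral_comp_comm _ hint]
  have hemb : MeasurableEmbedding refl :=
    (MeasurableEquiv.mk (Function.Involutive.toPerm refl refl_refl)
      measurePreserving_refl.measurable measurePreserving_refl.measurable).measurableEmbedding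
  rw [← measurePreserving_refl.integral_comp hemb]
  refine integral_congr_ae ?_
  filter_upwards [ae_ne_zero] with y hy
  have h1 := congrArg (starRingEnd ℂ) (glue_conj_refl hβ h hy)
  rw [map_mul, Complex.conj_conj] at h1
  have hreal : ∀ x, (starRingEnd ℂ) (halfW Q x) = halfW Q x := fun x => Complex.conj_ofReal _
  have h2 := halfW_mul_refl Q y
  rw [conjS_smul, Complex.conj_conj, tom, conjS_smul, conjS_conjS, refl_refl, smul_smul, smul_smul,
    ← h1]
  congr 1
  linear_combination (-halfW Q y * glue Q h (refl y) *
    (starRingEnd ℂ) (Complex.exp (Complex.I * (Q.phase : ℂ)))) * h2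

/-- The one-particle component of `I (w ⊗ Ω)`. -/
noncomputable def oneI (Q : Model N) (w : Doubled N) (x : X) : Doubled N :=
  (Q.lam1 : ℂ) • invSqrtTwo • glue Q Q.g1 x • (act (leftM (v1 N)) w - act (rightM (v1 N)) w) +
    (Q.lam2 : ℂ) • invSqrtTwo • glue Q Q.g2 x • (act (leftM (v2 N)) w - act (rightM (v2 N)) w)

/-- The vacuum component of `I ψ`, for `ψ` with one-particle component `F`. -/
noncomputable def vacI (Q : Model N) (F : X → Doubled N) : Doubled N :=
  (Q.lam1 : ℂ) • invSqrtTwo •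
      (act (leftM (v1 N)) (∫ y, (starRingEnd ℂ) (glue Q Q.g1 y) • F y ∂oneMeasure) -
        act (rightM (v1 N))
          (∫ y, (halfW Q y ^ 2 * (starRingEnd ℂ) (glue Q Q.g1 y)) • F y ∂oneMeasure)) +
    (Q.lam2 : ℂ) • invSqrtTwo •
      (act (leftM (v2 N)) (∫ y, (starRingEnd ℂ) (glue Q Q.g2 y) • F y ∂oneMeasure) -
        act (rightM (v2 N))
          (∫ y, (halfW Q y ^ 2 * (starRingEnd ℂ) (glue Q Q.g2 y)) • F y ∂oneMeasure))

theorem vacI_eq (hβ : 0 < Q.β) (h₁ : MemLp (glue Q Q.g1) 2 oneMeasure)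
    (h₂ : MemLp (glue Q Q.g2) 2 oneMeasure) {F : X → Doubled N}
    (hF : MemLp (fun x => halfW Q x • F x) 2 oneMeasure) :
    vacV Q (glue Q Q.g1) (glue Q Q.g2) F - conjS (vacV Q (glue Q Q.g1) (glue Q Q.g2) (tom Q F)) =
      vacI Q F := by
  have hr : (starRingEnd ℂ) invSqrtTwo = invSqrtTwo := Complex.conj_ofReal _
  simp only [vacV, vacI, act_eq_actL, map_smul, map_add, conjS_smul, Complex.conj_ofReal, hr]
  simp only [← act_eq_actL, conjS_act_leftM realEntries_v1, conjS_act_leftM realEntries_v2,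
    conjS_integral_tom hβ h₁ hF, conjS_integral_tom hβ h₂ hF]
  module

theorem exists_interaction_vacuum (hβ : 0 < Q.β) (h₁ : MemLp (glue Q Q.g1) 2 oneMeasure)
    (h₂ : MemLp (glue Q Q.g2) 2 oneMeasure) (w : Doubled N) :
    ∃ χ, Interaction Q (vacuum w) χ ∧ HasComps χ (fam 0 (oneI Q w) 0) := by
  have hF : MemLp (fun x => halfW Q x • (0 : X → Doubled N) x) 2 oneMeasure := by
    simp only [Pi.zero_apply, smul_zero]
    exact MemLp.zero'
  obtain ⟨χ, hχ, hc⟩ := exists_interaction h₁ h₂ (memLp_halfW_mul_glue hβ h₁)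
    (memLp_halfW_mul_glue hβ h₂) (hasComps_vacuum w) hF
  refine ⟨χ, hχ, ?_⟩
  rw [vacI_eq hβ h₁ h₂ hF] at hc
  have hvac : vacI Q (0 : X → Doubled N) = 0 := by
    simp [vacI, act_eq_actL]
  have htom : tom Q (0 : X → Doubled N) = 0 := by
    funext x
    simp [tom]
  have htwo : ∀ f₁ f₂, twoV Q f₁ f₂ (0 : X → Doubled N) = 0 := fun f₁ f₂ => by
    funext a b
    simp [twoV, act_eq_actL]
  have hH : (fun a b => twoV Q (glue Q Q.g1) (glue Q Q.g2) (0 : X → Doubled N) a b -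
      tom2 Q (twoV Q (glue Q Q.g1) (glue Q Q.g2) (tom Q 0)) a b) = 0 := by
    rw [htom, htwo]
    funext a b
    simp [tom2]
  rw [hvac, hH] at hc
  refine hc.congr (fam_congr _ ?_)
  filter_upwards [ae_ne_zero] with x hx
  rw [tom_oneV hβ w hx]
  simp only [oneV, oneI, act_eq_actL, map_smul]
  module

theorem memLp_oneI {f₁ f₂ : X → ℂ} (h₁ : MemLp f₁ 2 oneMeasure) (h₂ : MemLp f₂ 2 oneMeasure)
    (v v' : Doubled N) : MemLp (fun x => (Q.lam1 : ℂ) • invSqrtTwo • f₁ x • v +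
      (Q.lam2 : ℂ) • invSqrtTwo • f₂ x • v') 2 oneMeasure := by
  have key : ∀ (c : ℂ) (v : Doubled N) {f : X → ℂ}, MemLp f 2 oneMeasure →
      MemLp (fun x => c • invSqrtTwo • f x • v) 2 oneMeasure := fun c v f hf =>
    (MemLp.const_smul (((ContinuousLinearMap.id ℂ ℂ).smulRight v).comp_memLp' hf)
      invSqrtTwo).const_smul c
  exact (key _ _ h₁).add (key _ _ h₂)

theorem halfW_smul_resF (e ε : ℝ) (F : X → Doubled N) (x : X) :
    halfW Q x • resF Q e ε F x = resF Q e ε (fun x => halfW Q x • F x) x := by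
  ext p
  simp only [resF, PiLp.smul_apply, smul_eq_mul]
  ring

/-- The regularised level shift operator on `w ⊗ Ω`. -/
theorem levelShiftReg_vacuum (hβ : 0 < Q.β) (h₁ : MemLp (glue Q Q.g1) 2 oneMeasure)
    (h₂ : MemLp (glue Q Q.g2) 2 oneMeasure) (w : Doubled N) (e : ℝ) {ε : ℝ} (hε : 0 < ε) :
    LevelShiftReg Q e ε (vacuum w)
      (vacuum (projW Q e (vacI Q (resF Q e ε (oneI Q w))))) := by
  obtain ⟨ψ₁, hI₁, hc₁⟩ := exists_interaction_vacuum hβ h₁ h₂ w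
  obtain ⟨ψ₃, hR₃, hc₃⟩ := exists_res (Q := Q) (e := e) hε hc₁
  have hF : MemLp (fun x => halfW Q x • resF Q e ε (oneI Q w) x) 2 oneMeasure := by
    simp only [halfW_smul_resF]
    refine memLp_resF Q e hε ?_
    have := memLp_oneI (Q := Q) (memLp_halfW_mul_glue hβ h₁) (memLp_halfW_mul_glue hβ h₂)
      (act (leftM (v1 N)) w - act (rightM (v1 N)) w) (act (leftM (v2 N)) w - act (rightM (v2 N)) w)
    refine (memLp_congr_ae (ae_of_all _ fun x => ?_)).1 this
    simp only [oneI, smul_add, smul_smul]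
    congr 2 <;> ring
  obtain ⟨ψ₅, hI₅, hc₅⟩ := exists_interaction h₁ h₂ (memLp_halfW_mul_glue hβ h₁)
    (memLp_halfW_mul_glue hβ h₂) hc₃ hF
  rw [vacI_eq hβ h₁ h₂ hF] at hc₅
  -- Both projections `P̄_e` act as the identity, since `I (w ⊗ Ω)` and its image under the
  -- resolvent have no vacuum component.
  exact ⟨ψ₁, ψ₁, ψ₃, ψ₃, ψ₅, hI₁, hc₁.pbar_self, hR₃, hc₃.pbar_self, hI₅, hc₅.proj⟩

end Simplification

section Components

variable {N : ℕ} {Q : Model N}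

/-! ### Spin flips -/

/-- The configuration with the `j`-th spin reversed. -/
def flip (j : Fin N) (σ : Conf N) : Conf N := Function.update σ j (-σ j)

theorem flip_same (j : Fin N) (σ : Conf N) : flip j σ j = -σ j := Function.update_self _ _ _

theorem flip_ne {j k : Fin N} (h : k ≠ j) (σ : Conf N) : flip j σ k = σ k :=
  Function.update_of_ne h _ _

theorem flip_flip (j : Fin N) (σ : Conf N) : flip j (flip j σ) = σ := by
  funext k
  by_cases h : k = j
  · subst h; simp [flip_same]
  · simp [flip_ne h]

theorem sgn_neg (s : ℤˣ) : sgn (-s) = -sgn s := by simp [sgn]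

theorem sgn_eq (s : ℤˣ) : s = 1 ∧ sgn s = 1 ∨ s = -1 ∧ sgn s = -1 := by
  rcases Int.units_eq_one_or s with h | h
  · left; simp [h, sgn]
  · right; simp [h, sgn]

theorem sgn_injective : Function.Injective sgn := by
  intro s t h
  rcases sgn_eq s with ⟨h1, h2⟩ | ⟨h1, h2⟩ <;> rcases sgn_eq t with ⟨h3, h4⟩ | ⟨h3, h4⟩
  · rw [h1, h3]
  · rw [h2, h4] at h; norm_num at h
  · rw [h2, h4] at h; norm_num at h
  · rw [h1, h3]

theorem site_pauliX (j : Fin N) (σ σ' : Conf N) :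
    site pauliX j σ σ' = if σ' = flip j σ then 1 else 0 := by
  unfold site pauliX
  by_cases h : σ' = flip j σ
  · subst h
    have hne : σ j ≠ -σ j := by
      rcases Int.units_eq_one_or (σ j) with h | h <;> rw [h] <;> decide
    rw [if_pos fun k hk => (flip_ne hk σ).symm, flip_same, if_neg hne, if_pos rfl]
  · rw [if_neg h]
    split_ifs with h1 h2
    · rfl
    · refine absurd (funext fun k => ?_) h
      by_cases hk : k = j
      · subst hk
        rw [flip_same]
        exact Int.units_ne_iff_eq_neg.1 (Ne.symm h2)
      · rw [flip_ne hk, h1 k hk]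
    · rfl

theorem act_leftM_apply (A : SysMatrix N) (w : Doubled N) (p : Conf N × Conf N) :
    act (leftM A) w p = ∑ σ, A p.1 σ * w (σ, p.2) := by
  rw [act_apply, Fintype.sum_prod_type]
  refine Finset.sum_congr rfl fun σ _ => ?_
  rw [Finset.sum_eq_single p.2]
  · simp [leftM, Matrix.kroneckerMap_apply]
  · intro τ _ hτ
    simp [leftM, Matrix.kroneckerMap_apply, Matrix.one_apply_ne (Ne.symm hτ)]
  · simp

theorem act_rightM_apply (A : SysMatrix N) (w : Doubled N) (p : Conf N × Conf N) :
    act (rightM A) w p = ∑ τ, A p.2 τ * w (p.1, τ) := by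
  rw [act_apply, Fintype.sum_prod_type, Finset.sum_eq_single p.1]
  · refine Finset.sum_congr rfl fun τ _ => ?_
    simp [rightM, Matrix.kroneckerMap_apply]
  · intro σ _ hσ
    refine Finset.sum_eq_zero fun τ _ => ?_
    simp [rightM, Matrix.kroneckerMap_apply, Matrix.one_apply_ne (Ne.symm hσ)]
  · simp

theorem sum_v1 (σ : Conf N) (f : Conf N → ℂ) :
    ∑ σ', v1 N σ σ' * f σ' = ((∑ j, sgn (σ j) : ℝ) : ℂ) * f σ := by
  have h : v1 N = Matrix.diagonal fun σ : Conf N => ((∑ j, sgn (σ j) : ℝ) : ℂ) := by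
    ext σ σ'
    rw [v1, Matrix.sum_apply]
    simp only [site_pauliZ]
    by_cases h : σ = σ'
    · subst h; simp
    · simp [Matrix.diagonal_apply_ne _ h]
  rw [h, Finset.sum_eq_single σ]
  · rw [Matrix.diagonal_apply_eq]
  · intro σ' _ hne
    rw [Matrix.diagonal_apply_ne _ (Ne.symm hne), zero_mul]
  · simp

theorem sum_v2 (σ : Conf N) (f : Conf N → ℂ) :
    ∑ σ', v2 N σ σ' * f σ' = ∑ j, f (flip j σ) := by
  simp only [v2, Matrix.sum_apply, site_pauliX, Finset.sum_mul]
  rw [Finset.sum_comm]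
  simp

theorem act_leftM_v1 (w : Doubled N) (p : Conf N × Conf N) :
    act (leftM (v1 N)) w p = ((∑ j, sgn (p.1 j) : ℝ) : ℂ) * w p := by
  rw [act_leftM_apply, sum_v1 p.1 fun σ => w (σ, p.2)]

theorem act_rightM_v1 (w : Doubled N) (p : Conf N × Conf N) :
    act (rightM (v1 N)) w p = ((∑ j, sgn (p.2 j) : ℝ) : ℂ) * w p := by
  rw [act_rightM_apply, sum_v1 p.2 fun τ => w (p.1, τ)]

theorem act_leftM_v2 (w : Doubled N) (p : Conf N × Conf N) :
    act (leftM (v2 N)) w p = ∑ j, w (flip j p.1, p.2) := by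
  rw [act_leftM_apply, sum_v2 p.1 fun σ => w (σ, p.2)]

theorem act_rightM_v2 (w : Doubled N) (p : Conf N × Conf N) :
    act (rightM (v2 N)) w p = ∑ j, w (p.1, flip j p.2) := by
  rw [act_rightM_apply, sum_v2 p.2 fun τ => w (p.1, τ)]

/-! ### Resonances -/

theorem energy_eq (hJ : Q.J = 0) (σ : Conf N) : energy Q σ = ∑ j, Q.B j * sgn (σ j) := by
  simp [energy, hJ]

theorem energyDiff_eq (hJ : Q.J = 0) (σ τ : Conf N) :
    energyDiff Q σ τ = ∑ j, Q.B j * (sgn (σ j) - sgn (τ j)) := by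
  simp only [energyDiff, energy_eq hJ, mul_sub, Finset.sum_sub_distrib]

theorem energy_flip (hJ : Q.J = 0) (j : Fin N) (σ : Conf N) :
    energy Q (flip j σ) = energy Q σ - 2 * Q.B j * sgn (σ j) := by
  rw [energy_eq hJ, energy_eq hJ, ← Finset.sum_erase_add _ _ (Finset.mem_univ j),
    ← Finset.sum_erase_add Finset.univ (fun j => Q.B j * sgn (σ j)) (Finset.mem_univ j), flip_same,
    sgn_neg, Finset.sum_congr rfl fun k hk => by rw [flip_ne (Finset.ne_of_mem_erase hk)]]
  ring

/-- Without pair interaction, the difference of the two eigenvalues is `2 ∑ B_j n_j`, where `n_j` is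
half the difference of the site contributions, and genericity forces `n = 0`. -/
theorem resonance_iff (hJ : Q.J = 0) (hgen : GenericField Q.B) (σ τ σ' τ' : Conf N) :
    energyDiff Q σ τ = energyDiff Q σ' τ' ↔
      ∀ j, sgn (σ j) - sgn (τ j) = sgn (σ' j) - sgn (τ' j) := by
  refine ⟨fun h => ?_, fun h => by simp only [energyDiff_eq hJ, h]⟩
  have key : ∀ s t s' t' : ℤˣ, ∃ n : ℤ, |n| ≤ 2 ∧
      2 * (n : ℝ) = (sgn s - sgn t) - (sgn s' - sgn t') := by
    intro s t s' t'
    have hk : ∀ s : ℤˣ, ∃ k : ℤ, 0 ≤ k ∧ k ≤ 1 ∧ sgn s = 2 * k - 1 := by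
      intro s
      rcases sgn_eq s with ⟨-, h⟩ | ⟨-, h⟩
      · exact ⟨1, by norm_num, by norm_num, by rw [h]; norm_num⟩
      · exact ⟨0, by norm_num, by norm_num, by rw [h]; norm_num⟩
    obtain ⟨a, ha, ha', h1⟩ := hk s
    obtain ⟨b, hb, hb', h2⟩ := hk t
    obtain ⟨c, hc, hc', h3⟩ := hk s'
    obtain ⟨d, hd, hd', h4⟩ := hk t'
    -- Writing each sign as `2k - 1` with `k ∈ {0,1}`, the constants cancel and half the combination
    -- is an integer between `-2` and `2`.
    refine ⟨a - b - c + d, by rw [abs_le]; constructor <;> linarith, ?_⟩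
    rw [h1, h2, h3, h4]
    push_cast
    ring
  choose n hn hn' using fun j => key (σ j) (τ j) (σ' j) (τ' j)
  have hsum : ∑ j, Q.B j * (n j : ℝ) = 0 := by
    rw [energyDiff_eq hJ, energyDiff_eq hJ, ← sub_eq_zero, ← Finset.sum_sub_distrib] at h
    have : 2 * ∑ j, Q.B j * (n j : ℝ) = 0 := by
      rw [← h, Finset.mul_sum]
      refine Finset.sum_congr rfl fun j _ => ?_
      linear_combination Q.B j * hn' j
    linarith
  intro j
  have h0 := hn' j
  rw [hgen n hn hsum j] at h0
  simp at h0
  linarith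

/-- A register vector supported on the resonant pairs of configurations. -/
def Supported (Q : Model N) (e : ℝ) (w : Doubled N) : Prop :=
  ∀ p : Conf N × Conf N, energyDiff Q p.1 p.2 ≠ e → w p = 0

theorem Supported.eq_zero {e : ℝ} {w : Doubled N} (hw : Supported Q e w) (hJ : Q.J = 0)
    (hgen : GenericField Q.B) {p q : Conf N × Conf N} (hp : energyDiff Q p.1 p.2 = e) (i : Fin N)
    (h : sgn (q.1 i) - sgn (q.2 i) ≠ sgn (p.1 i) - sgn (p.2 i)) : w q = 0 := by
  refine hw q fun hq => h ?_
  exact (resonance_iff hJ hgen q.1 q.2 p.1 p.2).1 (hq.trans hp.symm) i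

theorem sgn_ne_neg (s : ℤˣ) : sgn s ≠ -sgn s := by
  rcases sgn_eq s with ⟨-, h⟩ | ⟨-, h⟩ <;> rw [h] <;> norm_num

/-! ### Commutators with `v_2` near a resonant pair -/

section Resonant

variable {e : ℝ} {w : Doubled N} (hw : Supported Q e w) (hJ : Q.J = 0)
    (hgen : GenericField Q.B) {p : Conf N × Conf N} (hp : energyDiff Q p.1 p.2 = e)

include hw hJ hgen hp

/-- Flipping one spin of one copy changes `σ_i - τ_i` by `±2`, which leaves the resonant set. -/
theorem Supported.flip_left (i : Fin N) : w (flip i p.1, p.2) = 0 :=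
  hw.eq_zero hJ hgen hp i fun h => sgn_ne_neg (p.1 i) (by
    simp only [flip_same, sgn_neg] at h; linarith)

theorem Supported.flip_right (i : Fin N) : w (p.1, flip i p.2) = 0 :=
  hw.eq_zero hJ hgen hp i fun h => sgn_ne_neg (p.2 i) (by
    simp only [flip_same, sgn_neg] at h; linarith)

/-- With opposite spins at `i`, the double flip reverses the nonzero difference `σ_i - τ_i`. -/
theorem Supported.flip_both (i : Fin N) (h : p.1 i ≠ p.2 i) :
    w (flip i p.1, flip i p.2) = 0 :=
  hw.eq_zero hJ hgen hp i fun h' => h (sgn_injective (by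
    simp only [flip_same, sgn_neg] at h'; linarith))

/-- At a resonant pair the energy-exchange term is absent from the one-particle component. This is
half of the reason why no cross terms in `λ_1 λ_2` occur; `Supported.flip_left` and
`Supported.flip_right` give the other half. -/
theorem Supported.comm_v2 : (act (leftM (v2 N)) w - act (rightM (v2 N)) w) p = 0 := by
  rw [PiLp.sub_apply, act_leftM_v2, act_rightM_v2,
    Finset.sum_eq_zero fun i _ => hw.flip_left hJ hgen hp i,
    Finset.sum_eq_zero fun i _ => hw.flip_right hJ hgen hp i, sub_zero]

/-- Among all second flips only those at the same site `i` return to a resonant pair: on the left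
they restore `p`, on the right they give the double flip. -/
theorem Supported.comm_v2_flip_left (i : Fin N) :
    (act (leftM (v2 N)) w - act (rightM (v2 N)) w) (flip i p.1, p.2) =
      w p - w (flip i p.1, flip i p.2) := by
  rw [PiLp.sub_apply, act_leftM_v2, act_rightM_v2, Finset.sum_eq_single i,
    Finset.sum_eq_single i]
  · rw [flip_flip]
  · intro j _ hj
    refine hw.eq_zero hJ hgen hp i fun h => sgn_ne_neg (p.1 i) ?_
    simp only [flip_same, flip_ne (Ne.symm hj), sgn_neg] at h
    linarith
  · simp
  · intro j _ hj
    refine hw.eq_zero hJ hgen hp i fun h => sgn_ne_neg (p.1 i) ?_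
    simp only [flip_same, flip_ne (Ne.symm hj), sgn_neg] at h
    linarith
  · simp

theorem Supported.comm_v2_flip_right (i : Fin N) :
    (act (leftM (v2 N)) w - act (rightM (v2 N)) w) (p.1, flip i p.2) =
      w (flip i p.1, flip i p.2) - w p := by
  rw [PiLp.sub_apply, act_leftM_v2, act_rightM_v2, Finset.sum_eq_single i,
    Finset.sum_eq_single i]
  · rw [flip_flip]
  · intro j _ hj
    refine hw.eq_zero hJ hgen hp i fun h => sgn_ne_neg (p.2 i) ?_
    simp only [flip_same, flip_ne (Ne.symm hj), sgn_neg] at h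
    linarith
  · simp
  · intro j _ hj
    refine hw.eq_zero hJ hgen hp i fun h => sgn_ne_neg (p.2 i) ?_
    simp only [flip_same, flip_ne (Ne.symm hj), sgn_neg] at h
    linarith
  · simp

end Resonant

theorem comm_v1 (w : Doubled N) (p : Conf N × Conf N) :
    (act (leftM (v1 N)) w - act (rightM (v1 N)) w) p = (e0 p.1 p.2 : ℂ) * w p := by
  rw [PiLp.sub_apply, act_leftM_v1, act_rightM_v1, ← sub_mul, ← Complex.ofReal_sub, e0,
    Finset.sum_sub_distrib]

/-! ### The vacuum component of the second order term -/

/-- The Cauchy integral of a density at distance `ε` below the real axis. -/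
noncomputable def cauchy (G : ℝ → ℝ) (c ε : ℝ) : ℂ :=
  ∫ u : ℝ, (G u : ℂ) * (((u - c : ℝ) : ℂ) + Complex.I * ε)⁻¹

theorem integral_mul_glue_sq {h : R3 → ℂ} {G : ℝ → ℝ} (hG : IsEnergyDensity Q h G)
    (hβ : 0 < Q.β) (k : ℝ → ℂ)
    (hI : Integrable (fun y : X => k y.1 * ((‖glue Q h y‖ ^ 2 : ℝ) : ℂ)) oneMeasure) :
    ∫ y, k y.1 * ((‖glue Q h y‖ ^ 2 : ℝ) : ℂ) ∂oneMeasure = ∫ u : ℝ, k u * (G u : ℂ) := by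
  have h1 := integral_prod (μ := (volume : Measure ℝ)) (ν := sphereMeasure) _ hI
  refine h1.trans (integral_congr_ae ?_)
  have h0 : ∀ᵐ u : ℝ, u ≠ 0 := by simp [ae_iff]
  filter_upwards [h0] with u hu
  rw [integral_const_mul, integral_complex_ofReal, hG.eq u hu, ← innerDensity_glue hβ]
  simp only [innerDensity, real_inner_self_eq_norm_sq]

theorem conj_mul_eq (a b z : ℂ) : (starRingEnd ℂ) z * (a * (z * b)) =
    b * (a * ((‖z‖ ^ 2 : ℝ) : ℂ)) := by
  rw [Complex.ofReal_pow, ← Complex.conj_mul']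
  ring

/-! ### Pairing the resolved one-particle vector with the form factor -/

section Evaluation

variable {h : R3 → ℂ} {G : ℝ → ℝ} (hG : IsEnergyDensity Q h G) (hβ : 0 < Q.β)
    (hm : MemLp (glue Q h) 2 oneMeasure) {F : X → Doubled N} {q : Conf N × Conf N} {c ε : ℝ}
    {d : ℂ} (hε : 0 < ε)
    (hq : ∀ y, F y q = (((y.1 - c : ℝ) : ℂ) + Complex.I * ε)⁻¹ * (glue Q h y * d))

include hG hβ hm hε hq

/-- The coordinate is the resolvent times `g_β`, so pairing with `g_β` gives `|g_β|²`, and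
integrating over the sphere leaves the energy density. -/
theorem integral_conj_glue (hF : MemLp F 2 oneMeasure) :
    (∫ y, (starRingEnd ℂ) (glue Q h y) • F y ∂oneMeasure) q = d * cauchy G c ε := by
  have hconj : MemLp (fun y => (starRingEnd ℂ) (glue Q h y)) 2 oneMeasure :=
    (Complex.conjCLE : ℂ →L[ℝ] ℂ).comp_memLp' hm
  have hint : Integrable (fun y => (starRingEnd ℂ) (glue Q h y) • F y) oneMeasure :=
    memLp_one_iff_integrable.1 (MemLp.smul hF hconj)
  rw [eval_integral_piLp fun i => hint.eval_piLp i]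
  simp only [PiLp.smul_apply, smul_eq_mul, hq, conj_mul_eq]
  rw [integral_const_mul, integral_mul_glue_sq hG hβ
    (fun u => (((u - c : ℝ) : ℂ) + Complex.I * ε)⁻¹)]
  · simp only [cauchy, mul_comm]
  · have hsq : Integrable (fun x => ‖glue Q h x‖ ^ 2) oneMeasure :=
      (memLp_two_iff_integrable_sq_norm hm.1).1 hm
    exact hsq.ofReal.bdd_mul (Measurable.aestronglyMeasurable (by fun_prop))
      (ae_of_all _ fun y => norm_resolvent_le hε)

/-- As for the unweighted pairing, except that the extra weight `exp(-β u)` turns `G(u)` into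
`G(-u)` by detailed balance. -/
theorem integral_halfW_conj_glue (hF : MemLp (fun x => halfW Q x • F x) 2 oneMeasure) :
    (∫ y, (halfW Q y ^ 2 * (starRingEnd ℂ) (glue Q h y)) • F y ∂oneMeasure) q =
      d * cauchy (fun u => G (-u)) c ε := by
  have hm' := memLp_halfW_mul_glue hβ hm
  have hreal : ∀ x, (starRingEnd ℂ) (halfW Q x) = halfW Q x := fun x => Complex.conj_ofReal _
  have hconj : MemLp (fun y => halfW Q y * (starRingEnd ℂ) (glue Q h y)) 2 oneMeasure := by
    have := (Complex.conjCLE : ℂ →L[ℝ] ℂ).comp_memLp' hm'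
    refine (memLp_congr_ae (ae_of_all _ fun y => ?_)).1 this
    simp [hreal]
  have hint : Integrable (fun y => (halfW Q y ^ 2 * (starRingEnd ℂ) (glue Q h y)) • F y)
      oneMeasure := by
    refine (memLp_one_iff_integrable.1 (MemLp.smul hF hconj)).congr (ae_of_all _ fun y => ?_)
    simp only [smul_smul, Pi.smul_apply']
    congr 1
    ring
  have hexp : ∀ u : ℝ, ((Real.exp (-(Q.β * u) / 2) : ℝ) : ℂ) ^ 2 * (G u : ℂ) = (G (-u) : ℂ) := by
    intro u
    rw [hG.neg_eq hβ, ← Complex.ofReal_pow, ← Complex.ofReal_mul, ← Real.exp_nat_mul]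
    congr 3
    push_cast
    ring
  rw [eval_integral_piLp fun i => hint.eval_piLp i]
  simp only [PiLp.smul_apply, smul_eq_mul, hq, mul_assoc, conj_mul_eq]
  have hre : ∀ y, halfW Q y ^ 2 * (d * ((((y.1 - c : ℝ) : ℂ) + Complex.I * ε)⁻¹ *
      ((‖glue Q h y‖ ^ 2 : ℝ) : ℂ))) = d * ((((Real.exp (-(Q.β * y.1) / 2) : ℝ) : ℂ) ^ 2 *
      (((y.1 - c : ℝ) : ℂ) + Complex.I * ε)⁻¹) * ((‖glue Q h y‖ ^ 2 : ℝ) : ℂ)) := by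
    intro y
    rw [halfW]
    ring
  simp only [hre]
  rw [integral_const_mul, integral_mul_glue_sq hG hβ
    (fun u => ((Real.exp (-(Q.β * u) / 2) : ℝ) : ℂ) ^ 2 *
      (((u - c : ℝ) : ℂ) + Complex.I * ε)⁻¹)]
  · rw [cauchy]
    congr 2
    funext u
    rw [← hexp]
    ring
  -- The weight is unbounded, so integrability is taken from the weighted form factor being in `L²`,
  -- not from `glue` itself.
  · have hsq : Integrable (fun x => ‖halfW Q x * glue Q h x‖ ^ 2) oneMeasure :=
      (memLp_two_iff_integrable_sq_norm hm'.1).1 hm'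
    have hsq' : Integrable (fun x => ((‖halfW Q x * glue Q h x‖ ^ 2 : ℝ) : ℂ)) oneMeasure :=
      hsq.ofReal
    have := hsq'.bdd_mul (f := fun y : X => (((y.1 - c : ℝ) : ℂ) + Complex.I * ε)⁻¹) (Measurable.aestronglyMeasurable (by fun_prop))
      (ae_of_all _ fun y => norm_resolvent_le hε)
    refine this.congr (ae_of_all _ fun y => ?_)
    have hn : ‖halfW Q y‖ = Real.exp (-(Q.β * y.1) / 2) := by
      rw [halfW, Complex.norm_real, Real.norm_of_nonneg (Real.exp_pos _).le]
    simp only [norm_mul, mul_pow, hn, Complex.ofReal_mul, Complex.ofReal_pow]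
    ring

end Evaluation

end Components

section Limit

variable {N : ℕ} {Q : Model N}

/-! ### The limit of the regularised level shift operator -/

/-- The principal value `P.V. ∫ G(u) / (u - c) du` in symmetrised form. -/
noncomputable def symmPV (G : ℝ → ℝ) (c : ℝ) : ℝ := ∫ t in Set.Ioi (0:ℝ), oddQuot G c t

theorem TameDensity.tendsto_cauchy_neg {G : ℝ → ℝ} (hG : TameDensity G) (c : ℝ) :
    Tendsto (fun ε : ℝ => cauchy (fun u => G (-u)) (-c) ε) (𝓝[>] 0)
      (𝓝 (-(symmPV G c : ℂ) - Complex.I * ((Real.pi * G c : ℝ) : ℂ))) := by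
  have h := hG.comp_neg.tendsto_cauchy (-c)
  rw [integral_oddQuot_neg, neg_neg, Complex.ofReal_neg] at h
  exact h

/-- The value of the second order term on resonant configurations. -/
theorem vacI_apply {G₁ G₂ : ℝ → ℝ} (hG₁ : IsEnergyDensity Q Q.g1 G₁)
    (hG₂ : IsEnergyDensity Q Q.g2 G₂) (hβ : 0 < Q.β) (h₁ : MemLp (glue Q Q.g1) 2 oneMeasure)
    (h₂ : MemLp (glue Q Q.g2) 2 oneMeasure) (hJ : Q.J = 0) (hgen : GenericField Q.B)
    {e : ℝ} {w : Doubled N} (hw : Supported Q e w) {p : Conf N × Conf N}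
    (hp : energyDiff Q p.1 p.2 = e) {ε : ℝ} (hε : 0 < ε) :
    vacI Q (resF Q e ε (oneI Q w)) p = (1 / 2) * ((Q.lam1 : ℂ) ^ 2 * (e0 p.1 p.2 : ℂ) * w p *
      (((∑ j, sgn (p.1 j) : ℝ) : ℂ) * cauchy G₁ 0 ε -
        ((∑ j, sgn (p.2 j) : ℝ) : ℂ) * cauchy (fun u => G₁ (-u)) (-0) ε) +
      (Q.lam2 : ℂ) ^ 2 * ∑ i, (w p - w (flip i p.1, flip i p.2)) *
        (cauchy G₂ (2 * Q.B i * sgn (p.1 i)) ε +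
          cauchy (fun u => G₂ (-u)) (-(2 * Q.B i * sgn (p.2 i))) ε)) := by
  have hone : MemLp (oneI Q w) 2 oneMeasure := memLp_oneI h₁ h₂ _ _
  have hF : MemLp (resF Q e ε (oneI Q w)) 2 oneMeasure := memLp_resF Q e hε hone
  have hF' : MemLp (fun x => halfW Q x • resF Q e ε (oneI Q w) x) 2 oneMeasure := by
    simp only [halfW_smul_resF]
    refine memLp_resF Q e hε ((memLp_congr_ae (ae_of_all _ fun x => ?_)).1
      (memLp_oneI (Q := Q) (memLp_halfW_mul_glue hβ h₁) (memLp_halfW_mul_glue hβ h₂)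
        (act (leftM (v1 N)) w - act (rightM (v1 N)) w)
        (act (leftM (v2 N)) w - act (rightM (v2 N)) w)))
    simp only [oneI, smul_add, smul_smul]
    congr 2 <;> ring
  have hone_apply : ∀ y q, oneI Q w y q = Q.lam1 * (invSqrtTwo * (glue Q Q.g1 y *
      (act (leftM (v1 N)) w - act (rightM (v1 N)) w) q)) + Q.lam2 * (invSqrtTwo *
      (glue Q Q.g2 y * (act (leftM (v2 N)) w - act (rightM (v2 N)) w) q)) := fun y q => by
    simp only [oneI, PiLp.add_apply, PiLp.smul_apply, smul_eq_mul]
  -- The pole is at `0` because `v_1` conserves energy. The centre is kept as a variable so that it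
  -- can also be instantiated at `-0`, the form in which `TameDensity.tendsto_cauchy_neg` applies.
  have hq₁ : ∀ c : ℝ, c = 0 → ∀ y, resF Q e ε (oneI Q w) y p =
      (((y.1 - c : ℝ) : ℂ) + Complex.I * ε)⁻¹ *
        (glue Q Q.g1 y * (Q.lam1 * invSqrtTwo * ((e0 p.1 p.2 : ℂ) * w p))) := by
    rintro c rfl y
    simp only [resF]
    rw [hone_apply, hw.comm_v2 hJ hgen hp, comm_v1, hp, add_sub_cancel_left, sub_zero]
    ring
  -- Reversing spin `i` on the left lowers the energy difference by `2 B_i σ_i`, which puts the pole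
  -- at `u = 2 B_i σ_i`; on the right the pole is at `-2 B_i τ_i`.
  have hqL : ∀ i y, resF Q e ε (oneI Q w) y (flip i p.1, p.2) =
      (((y.1 - 2 * Q.B i * sgn (p.1 i) : ℝ) : ℂ) + Complex.I * ε)⁻¹ *
        (glue Q Q.g2 y * (Q.lam2 * invSqrtTwo * (w p - w (flip i p.1, flip i p.2)))) := by
    intro i y
    simp only [resF]
    rw [hone_apply, hw.comm_v2_flip_left hJ hgen hp, comm_v1, hw.flip_left hJ hgen hp,
      energyDiff, energy_flip hJ, ← hp, energyDiff]
    congr 3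
    · push_cast; ring
    · ring
  have hqR : ∀ i y, resF Q e ε (oneI Q w) y (p.1, flip i p.2) =
      (((y.1 - -(2 * Q.B i * sgn (p.2 i)) : ℝ) : ℂ) + Complex.I * ε)⁻¹ *
        (glue Q Q.g2 y * (Q.lam2 * invSqrtTwo * (w (flip i p.1, flip i p.2) - w p))) := by
    intro i y
    simp only [resF]
    rw [hone_apply, hw.comm_v2_flip_right hJ hgen hp, comm_v1, hw.flip_right hJ hgen hp,
      energyDiff, energy_flip hJ, ← hp, energyDiff]
    congr 3
    · push_cast; ring
    · ring
  simp only [vacI, PiLp.add_apply, PiLp.sub_apply, PiLp.smul_apply, smul_eq_mul, act_leftM_v1,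
    act_rightM_v1, act_leftM_v2, act_rightM_v2]
  have hsum : (∑ i, (∫ y, (starRingEnd ℂ) (glue Q Q.g2 y) • resF Q e ε (oneI Q w) y
        ∂oneMeasure) (flip i p.1, p.2)) -
      ∑ i, (∫ y, (halfW Q y ^ 2 * (starRingEnd ℂ) (glue Q Q.g2 y)) • resF Q e ε (oneI Q w) y
        ∂oneMeasure) (p.1, flip i p.2) =
      Q.lam2 * invSqrtTwo * ∑ i, (w p - w (flip i p.1, flip i p.2)) *
        (cauchy G₂ (2 * Q.B i * sgn (p.1 i)) ε +
          cauchy (fun u => G₂ (-u)) (-(2 * Q.B i * sgn (p.2 i))) ε) := by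
    rw [← Finset.sum_sub_distrib, Finset.mul_sum]
    refine Finset.sum_congr rfl fun i _ => ?_
    rw [integral_conj_glue hG₂ hβ h₂ hε (hqL i) hF,
      integral_halfW_conj_glue hG₂ hβ h₂ hε (hqR i) hF']
    ring
  rw [integral_conj_glue hG₁ hβ h₁ hε (hq₁ 0 rfl) hF,
    integral_halfW_conj_glue hG₁ hβ h₁ hε (hq₁ (-0) neg_zero) hF', hsum, ← invSqrtTwo_mul_self]
  ring

/-- The limit of the second order term on resonant configurations. -/
noncomputable def limitValue (Q : Model N) (G₁ G₂ : ℝ → ℝ) (w : Doubled N)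
    (p : Conf N × Conf N) : ℂ :=
  (1 / 2) * ((Q.lam1 : ℂ) ^ 2 * (e0 p.1 p.2 : ℂ) * w p *
    (((∑ j, sgn (p.1 j) : ℝ) : ℂ) *
        ((symmPV G₁ 0 : ℂ) - Complex.I * ((Real.pi * G₁ 0 : ℝ) : ℂ)) -
      ((∑ j, sgn (p.2 j) : ℝ) : ℂ) *
        (-(symmPV G₁ 0 : ℂ) - Complex.I * ((Real.pi * G₁ 0 : ℝ) : ℂ))) +
    (Q.lam2 : ℂ) ^ 2 * ∑ i, (w p - w (flip i p.1, flip i p.2)) *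
      (((symmPV G₂ (2 * Q.B i * sgn (p.1 i)) : ℂ) -
          Complex.I * ((Real.pi * G₂ (2 * Q.B i * sgn (p.1 i)) : ℝ) : ℂ)) +
        (-(symmPV G₂ (2 * Q.B i * sgn (p.2 i)) : ℂ) -
          Complex.I * ((Real.pi * G₂ (2 * Q.B i * sgn (p.2 i)) : ℝ) : ℂ))))

theorem tendsto_vacI_apply {G₁ G₂ : ℝ → ℝ} (hG₁ : IsEnergyDensity Q Q.g1 G₁)
    (hG₂ : IsEnergyDensity Q Q.g2 G₂) (hβ : 0 < Q.β) (h₁ : MemLp (glue Q Q.g1) 2 oneMeasure)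
    (h₂ : MemLp (glue Q Q.g2) 2 oneMeasure) (hJ : Q.J = 0) (hgen : GenericField Q.B)
    {e : ℝ} {w : Doubled N} (hw : Supported Q e w) {p : Conf N × Conf N}
    (hp : energyDiff Q p.1 p.2 = e) :
    Tendsto (fun ε => vacI Q (resF Q e ε (oneI Q w)) p) (𝓝[>] 0)
      (𝓝 (limitValue Q G₁ G₂ w p)) := by
  have h1 := (hG₁.tame.tendsto_cauchy 0).const_mul ((∑ j, sgn (p.1 j) : ℝ) : ℂ)
  have h2 := (hG₁.tame.tendsto_cauchy_neg 0).const_mul ((∑ j, sgn (p.2 j) : ℝ) : ℂ)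
  have h3 := tendsto_finsetSum Finset.univ fun i _ =>
    ((hG₂.tame.tendsto_cauchy (2 * Q.B i * sgn (p.1 i))).add
      (hG₂.tame.tendsto_cauchy_neg (2 * Q.B i * sgn (p.2 i)))).const_mul
        (w p - w (flip i p.1, flip i p.2))
  have h4 := (((h1.sub h2).const_mul ((Q.lam1 : ℂ) ^ 2 * (e0 p.1 p.2 : ℂ) * w p)).add
    (h3.const_mul ((Q.lam2 : ℂ) ^ 2))).const_mul (1 / 2)
  refine Tendsto.congr' ?_ h4
  filter_upwards [self_mem_nhdsWithin] with ε hε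
  exact (vacI_apply hG₁ hG₂ hβ h₁ h₂ hJ hgen hw hp hε).symm

/-! ### The explicit operator -/

theorem flip_involutive_ne (j : Fin N) (σ : Conf N) : flip j σ ≠ σ := fun h => by
  have := congrFun h j
  rw [flip_same] at this
  have h2 := sgn_ne_neg (σ j)
  rw [← sgn_neg, this] at h2
  exact h2 rfl

/-- Spins equal at `j` and unchanged elsewhere leave only two columns in the row of `p`: `p` itself
and the double flip at `j`. -/
theorem act_onPair (m : Matrix (Fin 2) (Fin 2) ℂ) (j : Fin N) (w : Doubled N)
    (p : Conf N × Conf N) (hp : p.1 j = p.2 j) :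
    act (onPair m j) w p = m (pos (p.1 j)) (pos (p.1 j)) * w p +
      m (pos (p.1 j)) (pos (-p.1 j)) * w (flip j p.1, flip j p.2) := by
  rw [act_apply, Fintype.sum_eq_add p (flip j p.1, flip j p.2)]
  · congr 2
    · simp [onPair, hp]
    · unfold onPair
      rw [if_pos]
      · simp only [flip_same]
      · refine ⟨fun k hk => ⟨(flip_ne hk _).symm, (flip_ne hk _).symm⟩, hp, ?_⟩
        simp only [flip_same, hp]
  · intro h
    exact flip_involutive_ne j p.1 (congrArg Prod.fst h).symm
  · rintro q ⟨hq1, hq2⟩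
    rw [onPair, if_neg, zero_mul]
    rintro ⟨hk, -, hqj⟩
    by_cases hs : q.1 j = p.1 j
    · refine hq1 (Prod.ext (funext fun k => ?_) (funext fun k => ?_))
      · by_cases hkj : k = j
        · rw [hkj, hs]
        · exact (hk k hkj).1.symm
      · by_cases hkj : k = j
        · rw [hkj, ← hqj, hs, hp]
        · exact (hk k hkj).2.symm
    · have hs' : q.1 j = -p.1 j := Int.units_ne_iff_eq_neg.1 hs
      refine hq2 (Prod.ext (funext fun k => ?_) (funext fun k => ?_))
      · by_cases hkj : k = j
        · rw [hkj, hs']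
          exact (flip_same j p.1).symm
        · exact (hk k hkj).1.symm.trans (flip_ne hkj p.1).symm
      · by_cases hkj : k = j
        · rw [hkj, ← hqj, hs', hp]
          exact (flip_same j p.2).symm
        · exact (hk k hkj).2.symm.trans (flip_ne hkj p.2).symm

theorem act_explicitShift (σ τ : Conf N) (w : Doubled N) (p : Conf N × Conf N) :
    act (explicitShift Q σ τ) w p =
      (Complex.I * (Q.lam1 : ℂ) ^ 2 * (y1 Q σ τ : ℂ) +
        (Q.lam2 : ℂ) ^ 2 * ((x2 Q σ τ : ℂ) + Complex.I * (y2 Q σ τ : ℂ))) * w p +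
      ∑ j with σ j = τ j, act (onPair (matM (coefA Q σ τ) (coefB Q j) (coefC Q j)) j) w p := by
  have h1 : ∀ (c : ℂ) (A : DoubledMatrix N), act (c • (1 : DoubledMatrix N) + A) w p =
      c * w p + act A w p := fun c A => by
    simp only [act_apply, Matrix.add_apply, Matrix.smul_apply, add_mul, Finset.sum_add_distrib,
      Matrix.one_apply]
    simp
  rw [explicitShift, h1]
  congr 1
  simp only [act_apply, Matrix.sum_apply, Finset.sum_mul]
  exact Finset.sum_comm

theorem e0_congr {σ τ σ' τ' : Conf N}
    (h : ∀ j, sgn (σ j) - sgn (τ j) = sgn (σ' j) - sgn (τ' j)) : e0 σ τ = e0 σ' τ' := by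
  simp only [e0, h]

theorem eq_iff_of_resonant {σ τ σ' τ' : Conf N}
    (h : ∀ j, sgn (σ j) - sgn (τ j) = sgn (σ' j) - sgn (τ' j)) (j : Fin N) :
    σ j = τ j ↔ σ' j = τ' j := by
  rw [← sgn_injective.eq_iff, ← sgn_injective.eq_iff, ← sub_eq_zero, h, sub_eq_zero]

theorem sgn_eq_of_resonant {s t s' t' : ℤˣ} (h : sgn s - sgn t = sgn s' - sgn t') (hne : s ≠ t) :
    sgn s = sgn s' := by
  rcases sgn_eq s with ⟨h1, h1'⟩ | ⟨h1, h1'⟩ <;> rcases sgn_eq t with ⟨h2, h2'⟩ | ⟨h2, h2'⟩ <;>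
    rcases sgn_eq s' with ⟨-, h3⟩ | ⟨-, h3⟩ <;> rcases sgn_eq t' with ⟨-, h4⟩ | ⟨-, h4⟩ <;>
    first
      | exact absurd (h1.trans h2.symm) hne
      | (rw [h1', h2', h3, h4] at h; norm_num at h; done)
      | rw [h1', h3]

/-- All coefficients depend on `σ` and `τ` only through the differences `σ_j - τ_j`; where the spins
differ, the difference determines `σ_j`. Hence the operator is constant on a resonance class, while
the limit is computed separately at each pair of the class. -/
theorem explicitShift_congr {σ τ σ' τ' : Conf N}
    (h : ∀ j, sgn (σ j) - sgn (τ j) = sgn (σ' j) - sgn (τ' j)) :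
    explicitShift Q σ τ = explicitShift Q σ' τ' := by
  have hx : x2 Q σ τ = x2 Q σ' τ' := by
    simp only [x2, ne_eq, eq_iff_of_resonant h]
    congr 1
    refine Finset.sum_congr rfl fun j hj => ?_
    have hne := (Finset.mem_filter.1 hj).2
    rw [sgn_eq_of_resonant (h j) ((eq_iff_of_resonant h j).not.2 hne)]
  have hy1 : y1 Q σ τ = y1 Q σ' τ' := by simp only [y1, e0_congr h]
  have hy2 : y2 Q σ τ = y2 Q σ' τ' := by simp only [y2, ne_eq, eq_iff_of_resonant h]
  have ha : coefA Q σ τ = coefA Q σ' τ' := by simp only [coefA, e0_congr h]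
  simp only [explicitShift, hx, hy1, hy2, ha, eq_iff_of_resonant h]

/-- The imaginary parts at the poles `-2B_j` and `2B_j` are the jump rates `b_j` and `b_j c_j`;
their ratio `c_j` is detailed balance. -/
theorem pi_mul_density {h : R3 → ℂ} {G : ℝ → ℝ} (hG : IsEnergyDensity Q h G) {b : ℝ} (hb : 0 < b)
    (hβ : 0 < Q.β) : Q.lam2 ^ 2 * (Real.pi * G (-(2 * b))) =
      4 * Real.pi * Q.lam2 ^ 2 * (b ^ 2 * angular h (2 * b)) /
        (Real.exp (2 * Q.β * b) - 1) ∧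
    Q.lam2 ^ 2 * (Real.pi * G (2 * b)) =
      4 * Real.pi * Q.lam2 ^ 2 * (b ^ 2 * angular h (2 * b)) /
        (Real.exp (2 * Q.β * b) - 1) * Real.exp (2 * Q.β * b) := by
  have h1 : 1 < Real.exp (2 * Q.β * b) := Real.one_lt_exp_iff.2 (by positivity)
  have h2 : Real.exp (-(2 * Q.β * b)) = (Real.exp (2 * Q.β * b))⁻¹ := Real.exp_neg _
  have h3 : Real.exp (-Q.β * (2 * b)) = (Real.exp (2 * Q.β * b))⁻¹ := by
    rw [← h2]; congr 1; ring
  rw [hG.neg_eq hβ, hG.eq_two_mul hb, h2, h3]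
  generalize Real.exp (2 * Q.β * b) = E at *
  have hE : E ≠ 0 := by linarith
  have hE1 : E - 1 ≠ 0 := by linarith
  have hE2 : 1 - E⁻¹ ≠ 0 := by
    rw [sub_ne_zero]
    intro h
    have := inv_inj.1 (inv_one.trans h)
    linarith
  have hE3 : (1 - E⁻¹) = (E - 1) / E := by field_simp
  rw [hE3]
  constructor <;> field_simp

/-- For equal spins the two poles coincide after reflection: the principal values cancel and the
imaginary parts add. The real number `a` is free: its diagonal contribution to `matM` is added back
here, and is later supplied by the `λ_1` term. -/
theorem limitValue_term_of_eq {G₂ : ℝ → ℝ} (hG₂ : IsEnergyDensity Q Q.g2 G₂) (hβ : 0 < Q.β)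
    (hB : ∀ j, 0 < Q.B j) (a : ℝ) (w : Doubled N) (p : Conf N × Conf N) (i : Fin N)
    (hi : p.1 i = p.2 i) :
    (1 / 2) * (Q.lam2 : ℂ) ^ 2 * ((w p - w (flip i p.1, flip i p.2)) *
      (((symmPV G₂ (2 * Q.B i * sgn (p.1 i)) : ℂ) -
          Complex.I * ((Real.pi * G₂ (2 * Q.B i * sgn (p.1 i)) : ℝ) : ℂ)) +
        (-(symmPV G₂ (2 * Q.B i * sgn (p.2 i)) : ℂ) -
          Complex.I * ((Real.pi * G₂ (2 * Q.B i * sgn (p.2 i)) : ℝ) : ℂ)))) =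
      a * w p * (((sgn (p.1 i) + sgn (p.2 i)) / 2 : ℝ) : ℂ) -
        act (onPair (matM a (coefB Q i) (coefC Q i)) i) w p := by
  obtain ⟨h1, h2⟩ := pi_mul_density hG₂ (hB i) hβ
  change _ = coefB Q i at h1
  change _ = coefB Q i * coefC Q i at h2
  rw [act_onPair _ _ _ _ hi, ← hi]
  rcases sgn_eq (p.1 i) with ⟨hs, hs'⟩ | ⟨hs, hs'⟩
  · have h2' := congrArg (fun x : ℝ => (x : ℂ)) h2
    simp only [Complex.ofReal_mul, Complex.ofReal_pow] at h2'
    have hn : pos (-1) = 1 := rfl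
    rw [hs', hs, mul_one, hn, show pos 1 = 0 from rfl]
    simp only [matM, Matrix.of_apply, Matrix.cons_val', Matrix.cons_val_zero,
      Matrix.cons_val_one, Matrix.cons_val_fin_one, Complex.ofReal_mul]
    push_cast
    linear_combination (-Complex.I * (w p - w (flip i p.1, flip i p.2))) * h2'
  · have h1' := congrArg (fun x : ℝ => (x : ℂ)) h1
    simp only [Complex.ofReal_mul, Complex.ofReal_pow] at h1'
    rw [hs', hs, mul_neg_one, neg_neg, show pos (-1) = 1 from rfl, show pos 1 = 0 from rfl]
    simp only [matM, Matrix.of_apply, Matrix.cons_val', Matrix.cons_val_zero,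
      Matrix.cons_val_one, Matrix.cons_val_fin_one, Complex.ofReal_mul]
    push_cast
    linear_combination (-Complex.I * (w p - w (flip i p.1, flip i p.2))) * h1'

/-- For opposite spins the densities at `2B_i` and `-2B_i` add up to the hyperbolic cotangent, while
the principal values at these points are subtracted and give that of `kernel2`, with sign `s`. -/
theorem limitValue_term_of_ne {G₂ : ℝ → ℝ} (hG₂ : IsEnergyDensity Q Q.g2 G₂) (hβ : 0 < Q.β)
    {i : Fin N} (hB : 0 < Q.B i) {s t : ℤˣ} (h : s ≠ t) :
    ((symmPV G₂ (2 * Q.B i * sgn s) : ℂ) -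
        Complex.I * ((Real.pi * G₂ (2 * Q.B i * sgn s) : ℝ) : ℂ)) +
      (-(symmPV G₂ (2 * Q.B i * sgn t) : ℂ) -
        Complex.I * ((Real.pi * G₂ (2 * Q.B i * sgn t) : ℝ) : ℂ)) =
      ((4 * (sgn s * pv (kernel2 Q) (Q.B i)) : ℝ) : ℂ) - Complex.I * ((4 * Real.pi *
        (Q.B i ^ 2 * angular Q.g2 (2 * Q.B i) * coth (Q.β * Q.B i)) : ℝ) : ℂ) := by
  have h1 : 4 * pv (kernel2 Q) (Q.B i) =
      symmPV G₂ (2 * Q.B i) - symmPV G₂ (-(2 * Q.B i)) := by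
    rw [(hG₂.hasPV_kernel hβ (Q.B i)).pv_eq, symmPV, symmPV]
    ring
  have h2 := hG₂.add_neg_eq hβ hB.ne'
  rw [abs_of_pos hB] at h2
  have h1' := congrArg (fun x : ℝ => (x : ℂ)) h1
  have h2' := congrArg (fun x : ℝ => (x : ℂ)) h2
  push_cast at h1' h2'
  have ht : t = -s := Int.units_ne_iff_eq_neg.1 h.symm
  rw [ht, sgn_neg]
  rcases sgn_eq s with ⟨-, hs⟩ | ⟨-, hs⟩
  · rw [hs, mul_one, mul_neg_one]
    push_cast
    linear_combination -h1' - Complex.I * Real.pi * h2'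
  · rw [hs, mul_neg_one, neg_neg, mul_one]
    push_cast
    linear_combination h1' - Complex.I * Real.pi * h2'

/-- The `λ_1` bracket equals `(∑σ + ∑τ) ⟨g_1, ω⁻¹ g_1⟩ - iπ e_0 G₁(0)`. Its first part is
distributed over the sites with equal spins as the diagonal `±a`, and its second part gives `y_1`;
the `λ_2` sum is split according to whether the two spins agree. -/
theorem limitValue_eq {G₁ G₂ : ℝ → ℝ} (hG₁ : IsEnergyDensity Q Q.g1 G₁)
    (hG₂ : IsEnergyDensity Q Q.g2 G₂) (hβ : 0 < Q.β) (h₁ : MemLp (glue Q Q.g1) 2 oneMeasure)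
    (hB : ∀ j, 0 < Q.B j) {w : Doubled N} {p : Conf N × Conf N}
    (hflip : ∀ i, p.1 i ≠ p.2 i → w (flip i p.1, flip i p.2) = 0) :
    limitValue Q G₁ G₂ w p = -act (explicitShift Q p.1 p.2) w p := by
  have hpv : symmPV G₁ 0 = invOmega Q := hG₁.integral_oddQuot_zero hβ h₁
  have hy1 : y1 Q p.1 p.2 = Real.pi * e0 p.1 p.2 ^ 2 * G₁ 0 / 2 := by
    rw [y1, hG₁.gamma_eq hβ]
    field_simp
  have heq := Finset.sum_congr (s₁ := {i | p.1 i = p.2 i}) rfl fun i hi =>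
    limitValue_term_of_eq hG₂ hβ hB (coefA Q p.1 p.2) w p i (Finset.mem_filter.1 hi).2
  have hne := Finset.sum_congr (s₁ := {i | ¬ p.1 i = p.2 i}) rfl fun i hi =>
    congrArg₂ (fun x y => (w p - x) * y) (hflip i (Finset.mem_filter.1 hi).2)
      (limitValue_term_of_ne hG₂ hβ (hB i) (Finset.mem_filter.1 hi).2)
  -- Opposite spins cancel in `σ_j + τ_j`, so the total over all sites is carried by the sites with
  -- equal spins.
  have hsgn : ∑ j with p.1 j = p.2 j, (sgn (p.1 j) + sgn (p.2 j)) / 2 =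
      ((∑ j, sgn (p.1 j)) + ∑ j, sgn (p.2 j)) / 2 := by
    rw [← Finset.sum_add_distrib, Finset.sum_div]
    refine Finset.sum_subset (Finset.filter_subset _ _) fun j _ hj => ?_
    have h : p.2 j = -p.1 j := Int.units_ne_iff_eq_neg.1 fun h => hj (by simp [h])
    rw [h, sgn_neg, add_neg_cancel, zero_div]
  have he0 : (e0 p.1 p.2 : ℂ) = ((∑ j, sgn (p.1 j) : ℝ) : ℂ) - ((∑ j, sgn (p.2 j) : ℝ) : ℂ) := by
    rw [e0, Finset.sum_sub_distrib, Complex.ofReal_sub]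
  rw [← Finset.mul_sum, Finset.sum_sub_distrib, ← Finset.mul_sum, ← Complex.ofReal_sum, hsgn] at heq
  simp only [sub_zero] at hne
  rw [← Finset.mul_sum, Finset.sum_sub_distrib, ← Finset.mul_sum, ← Complex.ofReal_sum, ← Complex.ofReal_sum,
    ← Finset.mul_sum, ← Finset.mul_sum] at hne
  have hsplit := fun F : Fin N → ℂ =>
    Finset.sum_filter_add_sum_filter_not Finset.univ (fun i => p.1 i = p.2 i) F
  rw [act_explicitShift, limitValue, ← hsplit, hne, hpv, hy1, x2, y2]
  have ha : (coefA Q p.1 p.2 : ℂ) = -Q.lam1 ^ 2 * e0 p.1 p.2 * invOmega Q := by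
    rw [coefA]; push_cast; ring
  rw [ha] at heq
  push_cast at heq he0 ⊢
  rw [he0] at heq ⊢
  linear_combination heq

end Limit

section LevelShiftOperator

variable {N : ℕ} {Q : Model N}

/-! ### The level shift operator on the range of the projection -/

theorem act_onPair_of_ne (m : Matrix (Fin 2) (Fin 2) ℂ) (j : Fin N) (w : Doubled N)
    (p : Conf N × Conf N) (hp : p.1 j ≠ p.2 j) : act (onPair m j) w p = 0 := by
  rw [act_apply]
  refine Finset.sum_eq_zero fun q _ => ?_
  rw [onPair, if_neg fun h => hp h.2.1, zero_mul]

/-- A double flip at a site with equal spins preserves the energy difference. So the explicit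
operator leaves the range of `P_e` invariant, which settles the off-resonant coordinates of the
limit. -/
theorem Supported.act_explicitShift {e : ℝ} {w : Doubled N} (hw : Supported Q e w) (hJ : Q.J = 0)
    (σ τ : Conf N) : Supported Q e (act (explicitShift Q σ τ) w) := by
  intro p hp
  rw [QubitRegister.act_explicitShift, hw p hp, mul_zero, zero_add]
  refine Finset.sum_eq_zero fun j _ => ?_
  by_cases hj : p.1 j = p.2 j
  · have hflip : energyDiff Q (flip j p.1) (flip j p.2) = energyDiff Q p.1 p.2 := by
      rw [energyDiff, energyDiff, energy_flip hJ, energy_flip hJ, hj]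
      ring
    rw [act_onPair _ _ _ _ hj, hw p hp, hw (flip j p.1, flip j p.2) (by rwa [hflip])]
    ring
  · exact act_onPair_of_ne _ _ _ _ hj

theorem tendsto_projW_vacI {G₁ G₂ : ℝ → ℝ} (hG₁ : IsEnergyDensity Q Q.g1 G₁)
    (hG₂ : IsEnergyDensity Q Q.g2 G₂) (hβ : 0 < Q.β) (h₁ : MemLp (glue Q Q.g1) 2 oneMeasure)
    (h₂ : MemLp (glue Q Q.g2) 2 oneMeasure) (hJ : Q.J = 0) (hB : ∀ j, 0 < Q.B j)
    (hgen : GenericField Q.B) {σ τ : Conf N} {w : Doubled N}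
    (hw : Supported Q (energyDiff Q σ τ) w) :
    Tendsto (fun ε => projW Q (energyDiff Q σ τ)
        (vacI Q (resF Q (energyDiff Q σ τ) ε (oneI Q w)))) (𝓝[>] 0)
      (𝓝 (-act (explicitShift Q σ τ) w)) := by
  have hcomp : ∀ p : Conf N × Conf N, Tendsto (fun ε => projW Q (energyDiff Q σ τ)
        (vacI Q (resF Q (energyDiff Q σ τ) ε (oneI Q w))) p) (𝓝[>] 0)
      (𝓝 ((-act (explicitShift Q σ τ) w) p)) := by
    intro p
    simp only [projW_apply]
    by_cases hp : energyDiff Q p.1 p.2 = energyDiff Q σ τ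
    · simp only [if_pos hp]
      have h := tendsto_vacI_apply hG₁ hG₂ hβ h₁ h₂ hJ hgen hw hp
      rwa [limitValue_eq hG₁ hG₂ hβ h₁ hB fun i hi => hw.flip_both hJ hgen hp i hi,
        explicitShift_congr ((resonance_iff hJ hgen _ _ _ _).1 hp)] at h
    · simp only [if_neg hp]
      rw [PiLp.neg_apply, hw.act_explicitShift hJ σ τ p hp, neg_zero]
      exact tendsto_const_nhds
  have h := ((PiLp.continuous_toLp 2 fun _ : Conf N × Conf N => ℂ).tendsto _).comp
    (tendsto_pi_nhds.2 hcomp)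
  exact h

theorem sysOp_vacuum_iff (A : DoubledMatrix N) (w : Doubled N) (χ : Vec N) :
    SysOp A (vacuum w) χ ↔ χ = vacuum (act A w) := by
  obtain ⟨χ', h1, h2⟩ := exists_sysOp A (hasComps_vacuum w) fun _ _ => rfl
  have h3 : χ' = vacuum (act A w) := by
    refine h2.ext (C := _) ?_
    refine (hasComps_vacuum _).congr fun n => ?_
    have h0 : act A (0 : Doubled N) = 0 := map_zero _
    simp only [Pi.zero_apply, h0]
    rfl
  subst h3
  exact ⟨fun h => h.unique h1, fun h => h ▸ h1⟩

/-- Any admissible family `Φ` agrees for `ε > 0` with the computed one, by `LevelShiftReg.unique`,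
so both have the same limit. Convergence of register vectors passes to the Fock space through the
continuous map `vacuum`. -/
theorem levelShift_iff (hJ : Q.J = 0) (hB : ∀ j, 0 < Q.B j) (hgen : GenericField Q.B)
    (hβ : 0 < Q.β) {G₁ G₂ : ℝ → ℝ} (hG₁ : IsEnergyDensity Q Q.g1 G₁)
    (hG₂ : IsEnergyDensity Q Q.g2 G₂) (h₁ : MemLp (glue Q Q.g1) 2 oneMeasure)
    (h₂ : MemLp (glue Q Q.g2) 2 oneMeasure) {σ τ : Conf N} {ψ χ : Vec N}
    (hψ : RanP Q (energyDiff Q σ τ) ψ) :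
    LevelShift Q (energyDiff Q σ τ) ψ χ ↔ SysOp (explicitShift Q σ τ) ψ χ := by
  obtain ⟨w, rfl, hw⟩ := hψ.exists_vacuum
  rw [sysOp_vacuum_iff]
  have hlim := (continuous_vacuum.tendsto _).comp
    (tendsto_projW_vacI hG₁ hG₂ hβ h₁ h₂ hJ hB hgen (σ := σ) (τ := τ) hw)
  rw [map_neg] at hlim
  constructor
  · rintro ⟨-, Φ, hΦ, hχ⟩
    refine neg_injective (tendsto_nhds_unique hχ (hlim.congr' ?_))
    filter_upwards [self_mem_nhdsWithin] with ε hε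
    exact (levelShiftReg_vacuum hβ h₁ h₂ w _ hε).unique hε (hΦ ε hε)
  · rintro rfl
    exact ⟨hψ, _, fun ε hε => levelShiftReg_vacuum hβ h₁ h₂ w _ hε, hlim⟩

end LevelShiftOperator

/-! ### The matrices `M^j` -/

section MatM

theorem rootM_sq (a b c : ℝ) : rootM a b c ^ 2 = -(b : ℂ) ^ 2 * ((c : ℂ) + 1) ^ 2 +
    4 * (a : ℂ) * ((a : ℂ) + Complex.I * b * ((c : ℂ) - 1)) := by
  have h := Complex.cpow_nat_inv_pow (-(b : ℂ) ^ 2 * ((c : ℂ) + 1) ^ 2 +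
    4 * (a : ℂ) * ((a : ℂ) + Complex.I * b * ((c : ℂ) - 1))) (two_ne_zero (α := ℕ))
  rwa [Nat.cast_ofNat, ← one_div] at h

theorem zPlus_add_zMinus (a b c : ℝ) :
    zPlus a b c + zMinus a b c = Complex.I * b * ((c : ℂ) + 1) := by
  rw [zPlus, zMinus]; ring

theorem zPlus_mul_zMinus (a b c : ℝ) :
    zPlus a b c * zMinus a b c = -(a : ℂ) ^ 2 + Complex.I * a * b * (1 - c) := by
  rw [zPlus, zMinus]
  linear_combination (-1 / 4 : ℂ) * rootM_sq a b c +
    (1 / 4 * (b : ℂ) ^ 2 * (c + 1) ^ 2) * Complex.I_sq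

theorem charpoly_matM (a b c : ℝ) : (matM a b c).charpoly =
    (Polynomial.X - Polynomial.C (zPlus a b c)) * (Polynomial.X - Polynomial.C (zMinus a b c)) := by
  have ht : (matM a b c).trace = zPlus a b c + zMinus a b c := by
    rw [zPlus_add_zMinus, matM, Matrix.trace_fin_two_of]
    ring
  have hd : (matM a b c).det = zPlus a b c * zMinus a b c := by
    rw [zPlus_mul_zMinus, matM, Matrix.det_fin_two_of]
    ring
  rw [Matrix.charpoly_fin_two, ht, hd, Polynomial.C_add, Polynomial.C_mul]
  ring

theorem rootM_re_im (a b c : ℝ) :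
    (rootM a b c).re ^ 2 - (rootM a b c).im ^ 2 = -(b * (c + 1)) ^ 2 + 4 * a ^ 2 ∧
    (rootM a b c).re * (rootM a b c).im = 2 * a * b * (c - 1) := by
  have h : rootM a b c ^ 2 = ((-(b * (c + 1)) ^ 2 + 4 * a ^ 2 : ℝ) : ℂ) +
      ((4 * a * b * (c - 1) : ℝ) : ℂ) * Complex.I := by
    rw [rootM_sq]; push_cast; ring
  have hre := congrArg Complex.re h
  have him := congrArg Complex.im h
  simp only [pow_two, Complex.mul_re, Complex.add_re, Complex.ofReal_re, Complex.ofReal_im,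
    Complex.I_re, Complex.I_im] at hre
  simp only [pow_two, Complex.mul_im, Complex.add_im, Complex.ofReal_re, Complex.ofReal_im,
    Complex.I_re, Complex.I_im] at him
  constructor <;> linarith

/-- Write the root as `x + iy` and put `s = b(c+1)`, so that `x² - y² = 4a² - s²` and `xy =
2ab(c-1)`. If `|y| > s`, then `x² > 4a²`, hence `x²y² > 4a²s²`; but `x²y² = 4a²(s² - 4b²c)` is at
most `4a²s²`. -/
theorem abs_rootM_im_le {a b c : ℝ} (hb : 0 ≤ b) (hc : 0 < c) :
    |(rootM a b c).im| ≤ b * (c + 1) := by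
  obtain ⟨h1, h2⟩ := rootM_re_im a b c
  generalize (rootM a b c).re = x at *
  generalize (rootM a b c).im = y at *
  refine abs_le_of_sq_le_sq ?_ (by positivity)
  by_contra! hlt
  have hx : 4 * a ^ 2 < x ^ 2 := by linarith
  have hmul : 4 * a ^ 2 * (b * (c + 1)) ^ 2 < x ^ 2 * y ^ 2 :=
    mul_lt_mul'' hx hlt (by positivity) (by positivity)
  have h3 : x ^ 2 * y ^ 2 = 4 * a ^ 2 * (b * (c - 1)) ^ 2 := by
    rw [← mul_pow, h2]; ring
  have h4 : 0 ≤ 4 * a ^ 2 * b ^ 2 * (4 * c) := by positivity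
  linarith

/-- The same comparison with non-strict inequalities; now `16 a²b²c > 0` supplies the contradiction.
-/
theorem abs_rootM_im_lt {a b c : ℝ} (hb : 0 ≤ b) (hc : 0 < c) (hab : a * b ≠ 0) :
    |(rootM a b c).im| < b * (c + 1) := by
  obtain ⟨h1, h2⟩ := rootM_re_im a b c
  generalize (rootM a b c).re = x at *
  generalize (rootM a b c).im = y at *
  refine abs_lt_of_sq_lt_sq ?_ (by positivity)
  by_contra! hle
  have hx : 4 * a ^ 2 ≤ x ^ 2 := by linarith
  have hmul : 4 * a ^ 2 * (b * (c + 1)) ^ 2 ≤ x ^ 2 * y ^ 2 :=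
    mul_le_mul hx hle (by positivity) (by positivity)
  have h3 : x ^ 2 * y ^ 2 = 4 * a ^ 2 * (b * (c - 1)) ^ 2 := by
    rw [← mul_pow, h2]; ring
  have h4 : 0 < (a * b) ^ 2 * (16 * c) := by positivity
  linarith

theorem zPlus_im (a b c : ℝ) : (zPlus a b c).im = (b * (c + 1) + (rootM a b c).im) / 2 := by
  have h : zPlus a b c = ((1 / 2 : ℝ) : ℂ) * (((b * (c + 1) : ℝ) : ℂ) * Complex.I +
      rootM a b c) := by
    rw [zPlus]; push_cast; ring
  rw [h, Complex.im_ofReal_mul, Complex.add_im, Complex.im_ofReal_mul, Complex.I_im]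
  ring

theorem zMinus_im (a b c : ℝ) : (zMinus a b c).im = (b * (c + 1) - (rootM a b c).im) / 2 := by
  have h : zMinus a b c = ((1 / 2 : ℝ) : ℂ) * (((b * (c + 1) : ℝ) : ℂ) * Complex.I -
      rootM a b c) := by
    rw [zMinus]; push_cast; ring
  rw [h, Complex.im_ofReal_mul, Complex.sub_im, Complex.im_ofReal_mul, Complex.I_im]
  ring

/-- The discriminant is `(i b(c+1))²`. The argument of `i b(c+1)` is `π/2`, or `0` if `b = 0`, and
the principal branch includes the endpoint `π/2`; this uses `b ≥ 0`. -/
theorem rootM_of_eq_zero_left {b c : ℝ} (hb : 0 ≤ b) (hc : 0 < c) :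
    rootM 0 b c = Complex.I * b * (c + 1) := by
  have hb' : rootM 0 b c = ((((b * (c + 1) : ℝ) : ℂ) * Complex.I) ^ 2) ^ ((2 : ℕ) : ℂ)⁻¹ := by
    rw [rootM, mul_pow, Complex.I_sq, Nat.cast_ofNat, one_div]
    push_cast
    congr 1
    ring
  have hs : 0 ≤ b * (c + 1) := by positivity
  have harg : 0 ≤ (((b * (c + 1) : ℝ) : ℂ) * Complex.I).arg ∧
      (((b * (c + 1) : ℝ) : ℂ) * Complex.I).arg ≤ Real.pi / 2 := by
    have hpi := Real.pi_pos
    rcases hs.eq_or_lt with h | h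
    · rw [← h, Complex.ofReal_zero, zero_mul, Complex.arg_zero]
      exact ⟨le_rfl, by positivity⟩
    · rw [Complex.arg_real_mul _ h, Complex.arg_I]
      exact ⟨by positivity, le_rfl⟩
  rw [hb', Complex.pow_cpow_nat_inv two_ne_zero]
  · push_cast; ring
  · rw [Nat.cast_ofNat]
    linarith [Real.pi_pos, harg.1]
  · rw [Nat.cast_ofNat]
    exact harg.2

theorem rootM_of_eq_zero_right (a c : ℝ) : rootM a 0 c = 2 * ((|a| : ℝ) : ℂ) := by
  have h : rootM a 0 c = (((2 * |a| : ℝ) : ℂ) ^ 2) ^ ((2 : ℕ) : ℂ)⁻¹ := by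
    have ha : ((|a| : ℝ) : ℂ) ^ 2 = (a : ℂ) ^ 2 := by
      rw [← Complex.ofReal_pow, sq_abs, Complex.ofReal_pow]
    rw [rootM, Nat.cast_ofNat, one_div, Complex.ofReal_mul, mul_pow, ha]
    push_cast
    congr 1
    ring
  have harg : ((2 * |a| : ℝ) : ℂ).arg = 0 := Complex.arg_ofReal_of_nonneg (by positivity)
  rw [h, Complex.pow_cpow_nat_inv two_ne_zero]
  · push_cast; ring
  all_goals
    rw [harg, Nat.cast_ofNat]
    linarith [Real.pi_pos]

/-- Since `bc ≠ 0`, the first row determines `v 1` from `v 0`; the second row then follows from the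
characteristic equation of `z`. -/
theorem matM_mulVec_eq_iff {a b c : ℝ} (hb : b ≠ 0) (hc : c ≠ 0) {z : ℂ}
    (hz : z = zPlus a b c ∨ z = zMinus a b c) (v : Fin 2 → ℂ) :
    (matM a b c).mulVec v = z • v ↔ v 1 = v 0 * (1 + Complex.I * (z - a) / (b * c)) := by
  have hb' : (b : ℂ) ≠ 0 := Complex.ofReal_ne_zero.2 hb
  have hc' : (c : ℂ) ≠ 0 := Complex.ofReal_ne_zero.2 hc
  have hchar : z ^ 2 - Complex.I * b * (c + 1) * z +
      (-(a : ℂ) ^ 2 + Complex.I * a * b * (1 - c)) = 0 := by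
    rw [← zPlus_add_zMinus, ← zPlus_mul_zMinus]
    rcases hz with rfl | rfl <;> ring
  have hv : v 1 = v 0 * (1 + Complex.I * (z - a) / (b * c)) ↔
      b * c * v 1 = v 0 * (b * c + Complex.I * (z - a)) := by
    have h0 : (b : ℂ) * c * (v 0 * (1 + Complex.I * (z - a) / (b * c))) =
        v 0 * (b * c + Complex.I * (z - a)) := by
      field_simp
    rw [← h0, mul_right_inj' (mul_ne_zero hb' hc')]
  rw [hv, funext_iff, Fin.forall_fin_two]
  simp only [matM, Matrix.mulVec, dotProduct, Fin.sum_univ_two, Matrix.of_apply,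
    Matrix.cons_val', Matrix.cons_val_zero, Matrix.cons_val_one, Matrix.cons_val_fin_one,
    Pi.smul_apply, smul_eq_mul]
  constructor
  · rintro ⟨h, -⟩
    linear_combination Complex.I * h + (b * c * v 1 - b * c * v 0) * Complex.I_sq
  · intro h
    refine ⟨?_, ?_⟩
    · linear_combination -Complex.I * h - v 0 * (z - a) * Complex.I_sq
    · refine mul_left_cancel₀ (mul_ne_zero hb' hc') ?_
      linear_combination (-a + Complex.I * b - z) * h - Complex.I * v 0 * hchar +
        (v 0 * b * (z - a) - b * c * v 0 * (a + z) + b * v 0 * (a - z)) * Complex.I_sq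

theorem eigenspace_matM {a b c : ℝ} (hb : b ≠ 0) (hc : c ≠ 0) {z : ℂ}
    (hz : z = zPlus a b c ∨ z = zMinus a b c) :
    Module.End.eigenspace (Matrix.toLin' (matM a b c)) z = Submodule.span ℂ {xi a b c z} := by
  ext v
  rw [Module.End.mem_eigenspace_iff, Matrix.toLin'_apply, matM_mulVec_eq_iff hb hc hz,
    Submodule.mem_span_singleton]
  constructor
  · intro h
    refine ⟨v 0, ?_⟩
    ext i
    fin_cases i
    · simp [xi]
    · simp [xi, h]
  · rintro ⟨k, rfl⟩
    simp [xi]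

end MatM

theorem angular_nonneg (g : R3 → ℂ) (u : ℝ) : 0 ≤ angular g u :=
  integral_nonneg fun _ => by positivity

theorem coefB_nonneg {N : ℕ} {Q : Model N} (hβ : 0 < Q.β) {j : Fin N} (hB : 0 < Q.B j) :
    0 ≤ coefB Q j := by
  have h1 : 1 < Real.exp (2 * Q.β * Q.B j) := Real.one_lt_exp_iff.2 (by positivity)
  have h2 := angular_nonneg Q.g2 (2 * Q.B j)
  exact div_nonneg (by positivity) (by linarith)

end QubitRegister

theorem theorem3p4 (N : ℕ) (Q : QubitRegister.Model N) (hJ : Q.J = 0)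
    (hB : ∀ j, 0 < Q.B j) (hgen : QubitRegister.GenericField Q.B) (hβ : 0 < Q.β)
    (hreg1 : QubitRegister.Regular Q Q.g1) (hreg2 : QubitRegister.Regular Q Q.g2)
    (hcont1 : ContinuousOn (QubitRegister.angular Q.g1) (Set.Ioi 0))
    (hcont2 : ContinuousOn (QubitRegister.angular Q.g2) (Set.Ioi 0))
    (σ τ : QubitRegister.Conf N) :
    -- the integrals and limits in the explicit quantities exist
    (MeasureTheory.Integrable (fun k : QubitRegister.R3 => ‖Q.g1 k‖ ^ 2 / ‖k‖) ∧
      Filter.Tendsto (fun u : ℝ => u * QubitRegister.angular Q.g1 u)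
        (nhdsWithin 0 (Set.Ioi 0)) (nhds (QubitRegister.gammaPlus Q)) ∧
      ∀ j, QubitRegister.HasPV (QubitRegister.kernel2 Q) (Q.B j)
        (QubitRegister.pv (QubitRegister.kernel2 Q) (Q.B j))) ∧
    -- on the range of `P_e`, the level shift operator exists and is the explicit operator
    (∀ ψ χ : QubitRegister.Vec N,
      QubitRegister.RanP Q (QubitRegister.energyDiff Q σ τ) ψ →
      (QubitRegister.LevelShift Q (QubitRegister.energyDiff Q σ τ) ψ χ ↔
        QubitRegister.SysOp (QubitRegister.explicitShift Q σ τ) ψ χ)) ∧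
    -- eigenvalues and eigenvectors of the matrices `M^j`
    (∀ (j : Fin N) (a b c : ℝ), a = QubitRegister.coefA Q σ τ → b = QubitRegister.coefB Q j →
      c = QubitRegister.coefC Q j →
      (QubitRegister.matM a b c).charpoly =
        (Polynomial.X - Polynomial.C (QubitRegister.zPlus a b c)) *
          (Polynomial.X - Polynomial.C (QubitRegister.zMinus a b c)) ∧
      0 ≤ (QubitRegister.zPlus a b c).im ∧ 0 ≤ (QubitRegister.zMinus a b c).im ∧
      (a * b ≠ 0 →
        0 < (QubitRegister.zPlus a b c).im ∧ 0 < (QubitRegister.zMinus a b c).im) ∧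
      (a = 0 → QubitRegister.zPlus a b c = Complex.I * b * (c + 1) ∧
        QubitRegister.zMinus a b c = 0) ∧
      (b = 0 → QubitRegister.zPlus a b c = ((|a| : ℝ) : ℂ) ∧
        QubitRegister.zMinus a b c = -((|a| : ℝ) : ℂ)) ∧
      (b ≠ 0 → ∀ z : ℂ, (z = QubitRegister.zPlus a b c ∨ z = QubitRegister.zMinus a b c) →
        Module.End.eigenspace (Matrix.toLin' (QubitRegister.matM a b c)) z =
          Submodule.span ℂ {QubitRegister.xi a b c z})) := by
  obtain ⟨G₁, htame₁, heq₁⟩ := hreg1.exists_density hβ hcont1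
  obtain ⟨G₂, htame₂, heq₂⟩ := hreg2.exists_density hβ hcont2
  have hG₁ : QubitRegister.IsEnergyDensity Q Q.g1 G₁ := ⟨htame₁, heq₁⟩
  have hG₂ : QubitRegister.IsEnergyDensity Q Q.g2 G₂ := ⟨htame₂, heq₂⟩
  refine ⟨⟨QubitRegister.integrable_invOmega hβ hreg1.memLp_glue, ?_, fun j => ?_⟩,
    fun ψ χ hψ => QubitRegister.levelShift_iff hJ hB hgen hβ hG₁ hG₂ hreg1.memLp_glue
      hreg2.memLp_glue hψ, ?_⟩
  · rw [hG₁.gamma_eq hβ]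
    exact hG₁.tendsto_mul_angular hβ
  · have h := hG₂.hasPV_kernel hβ (Q.B j)
    rwa [h.pv_eq]
  · intro j a b c _ hb hc
    have hb0 : 0 ≤ b := hb ▸ QubitRegister.coefB_nonneg hβ (hB j)
    have hc0 : 0 < c := hc ▸ Real.exp_pos _
    -- The eigenvalues have imaginary parts `(b(c+1) ± Im rootM) / 2`, so this bound is exactly
    -- their nonnegativity.
    have him := abs_le.1 (QubitRegister.abs_rootM_im_le (a := a) hb0 hc0)
    refine ⟨QubitRegister.charpoly_matM a b c, ?_, ?_, fun hab => ?_, ?_, ?_,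
      fun hb' z hz => QubitRegister.eigenspace_matM hb' hc0.ne' hz⟩
    · rw [QubitRegister.zPlus_im]
      linarith
    · rw [QubitRegister.zMinus_im]
      linarith
    · have him' := abs_lt.1 (QubitRegister.abs_rootM_im_lt hb0 hc0 hab)
      rw [QubitRegister.zPlus_im, QubitRegister.zMinus_im]
      constructor <;> linarith
    · rintro rfl
      rw [QubitRegister.zPlus, QubitRegister.zMinus,
        QubitRegister.rootM_of_eq_zero_left hb0 hc0]
      constructor <;> ring
    · rintro rfl
      rw [QubitRegister.zPlus, QubitRegister.zMinus, QubitRegister.rootM_of_eq_zero_right]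
      constructor <;> (push_cast; ring)
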